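/- \textbf{Setting.} Let $N$ be a finite ground set, $n=|N|$, and let $f\colon 2^N\to\mathbb R_{\ge 0}$ be non-negative, monotone ($f(S)\le f(T)$ for $S\subseteq T$) and submodular ($f(S\cup\{u\})-f(S)\ge f(T\cup\{u\})-f(T)$ for $S\subseteq T\subseteq N$, $u\in N\setminus T$). Its multilinear extension is $$F(x)=\sum_{S\subseteq N} f(S)\prod_{u\in S}x_u\prod_{u\in N\setminus S}(1-x_u),\qquad x\in[0,1]^N .$$ A knapsack constraint is given by costs $p\in\mathbb R_{\ge0}^N$ and a budget $B$; it is assumed that $p_u\le B$ for every $u\in N$ and that its density $c=B/\|p\|_1$ lies in $(0,1)$. Let $\mathcal P=\{x\in[0,1]^N : \langle p,x\rangle\le B\}$, and let $\mathrm{OPT}$ maximize $f(S)$ among the sets $S\subseteq N$ with $\sum_{u\in S}p_u\le B$. For $\varepsilon\in(0,1]$ define $$\rho(c,\varepsilon)=\begin{cases}\dfrac{1-\varepsilon^{c}}{c}, & c\le 1/2,\\[2mm] \dfrac{1-2(1-c)\sqrt{\varepsilon}-\varepsilon(2c-1)}{c}, & c\ge 1/2.\end{cases}$$ Algorithms are randomized,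 may use fair random bits, and access $f$ only through a value oracle, which returns $f(S)$ for a given set $S\subseteq N$. Running time is counted on a real RAM: an oracle query, a random bit, an exact arithmetic operation ($+,-,\times,\div$) or comparison of real numbers, and an addition, subtraction or comparison of natural numbers each take one step; program constants are natural numbers, and $n,p,B,\varepsilon$ are given as input. \textbf{Theorem.} For every constant $\varepsilon\in(0,1]$ there is a polynomial-time $(1-\varepsilon-o(1),\rho(c,\varepsilon))$-bicriteria integer-approximation algorithm for maximizing the multilinear extension of a non-negative monotone submodular function over the polytope of a knapsack constraint of density $c$. Explicitly: there are an algorithm, a polynomial $T$ and a sequence $\mathrm{err}(n)\to 0$, all depending only on $\varepsilon$, such that on every instance $(N,f,p,B)$ as above the algorithm always halts within $T(n)$ steps, and its random output $x$ satisfies: \begin{itemize} \item always, $x\in[0,1]^N$ and there are $y_1,y_2\in\mathcal P$ with $y_1\le x\le\rho(c,\varepsilon)\,y_2$ coordinate-wise; \item $\mathbb E[F(x)]\ge(1-\varepsilon-\mathrm{err}(n))\cdot f(\mathrm{OPT})$. \end{itemize} -/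

import Mathlib

/-! ## Submodular functions, multilinear extension, knapsack polytope -/

namespace Bicriteria

/-- Diminishing returns: `f(S + u) - f(S) ≥ f(T + u) - f(T)` for `S ⊆ T` and `u ∉ T`. -/
def IsSubmodular {n : ℕ} (f : Finset (Fin n) → ℝ) : Prop :=
  ∀ S T : Finset (Fin n), S ⊆ T → ∀ u ∉ T, f (insert u T) - f T ≤ f (insert u S) - f S

/-- The multilinear extension
`F(x) = ∑_{S ⊆ N} f(S) ∏_{u ∈ S} x_u ∏_{u ∈ N ∖ S} (1 - x_u)`. -/
def multilinearExt {n : ℕ} (f : Finset (Fin n) → ℝ) (x : Fin n → ℝ) : ℝ :=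
  ∑ S : Finset (Fin n), f S * (∏ u ∈ S, x u) * ∏ u ∈ Sᶜ, (1 - x u)

/-- The polytope `{x ∈ [0,1]^N : ⟨p, x⟩ ≤ B}` of a knapsack constraint. -/
def knapsackPolytope {n : ℕ} (p : Fin n → ℝ) (B : ℝ) : Set (Fin n → ℝ) :=
  {x | (∀ u, 0 ≤ x u ∧ x u ≤ 1) ∧ ∑ u, p u * x u ≤ B}

/-- `O` is a feasible set of maximum value under the knapsack constraint. -/
def IsKnapsackOpt {n : ℕ} (f : Finset (Fin n) → ℝ) (p : Fin n → ℝ) (B : ℝ)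
    (O : Finset (Fin n)) : Prop :=
  ∑ u ∈ O, p u ≤ B ∧ ∀ S : Finset (Fin n), ∑ u ∈ S, p u ≤ B → f S ≤ f O

/-- The vectors a bicriteria algorithm with infeasibility ratio `β` may output:
`x ∈ [0,1]^N` with `y₁ ≤ x ≤ β y₂` for some `y₁, y₂` in the polytope `P`. -/
def IsFeasibleUpTo {n : ℕ} (P : Set (Fin n → ℝ)) (β : ℝ) (x : Fin n → ℝ) : Prop :=
  (∀ u, 0 ≤ x u ∧ x u ≤ 1) ∧ ∃ y₁ ∈ P, ∃ y₂ ∈ P, ∀ u, y₁ u ≤ x u ∧ x u ≤ β * y₂ u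

/-- The density `c = B / ‖p‖₁` of a knapsack constraint with non-negative costs `p`. -/
noncomputable def density {n : ℕ} (p : Fin n → ℝ) (B : ℝ) : ℝ := B / ∑ u, p u

/-- The infeasibility ratio `ρ(c, ε)`. -/
noncomputable def rho (c ε : ℝ) : ℝ :=
  if c ≤ 1 / 2 then (1 - ε ^ c) / c
  else (1 - 2 * (1 - c) * √ε - ε * (2 * c - 1)) / c

/-! ## Randomized algorithms with a value oracle: a real RAM

Programs of a small imperative language over two memories, one of natural numbers and one of
real numbers, both organised as arrays (`array name`, `index`).  Exact real arithmetic
`+ - * /` and comparisons have unit cost, as have addition, truncated subtraction and comparison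
of natural numbers.  There is no rounding of reals to naturals, and the only constants in a
program are natural numbers. -/

/-- Expressions with natural number values. -/
inductive NExp : Type
  | lit : ℕ → NExp
  | get : ℕ → NExp → NExp
  | add : NExp → NExp → NExp
  | sub : NExp → NExp → NExp

/-- Expressions with real values. -/
inductive RExp : Type
  | ofNat : NExp → RExp
  | get : ℕ → NExp → RExp
  | add : RExp → RExp → RExp
  | sub : RExp → RExp → RExp
  | mul : RExp → RExp → RExp
  | div : RExp → RExp → RExp

/-- Tests. -/
inductive Test : Type
  | natLe : NExp → NExp → Test
  | realLe : RExp → RExp → Test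
  | neg : Test → Test

/-- Programs.  `flip a i` stores a fresh fair random bit in cell `i` of the natural number array
`a`; `query q a i` stores in cell `i` of the real array `a` the value `f(S)` of the set `S` whose
elements are the nonzero entries of the real array `q`. -/
inductive Prog : Type
  | skip : Prog
  | setNat : ℕ → NExp → NExp → Prog
  | setReal : ℕ → NExp → RExp → Prog
  | flip : ℕ → NExp → Prog
  | query : ℕ → ℕ → NExp → Prog
  | seq : Prog → Prog → Prog
  | cond : Test → Prog → Prog → Prog
  | loop : Test → Prog → Prog

/-- A memory state, together with the tape of random bits and the number of bits read so far. -/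
structure State : Type where
  nat : ℕ → ℕ → ℕ
  real : ℕ → ℕ → ℝ
  tape : ℕ → Bool
  pos : ℕ

/-- Overwrite the cell `i` of the natural number array `a`. -/
def State.writeNat (s : State) (a i v : ℕ) : State :=
  { s with nat := Function.update s.nat a (Function.update (s.nat a) i v) }

/-- Overwrite the cell `i` of the real array `a`. -/
def State.writeReal (s : State) (a i : ℕ) (v : ℝ) : State :=
  { s with real := Function.update s.real a (Function.update (s.real a) i v) }

/-- Value of a natural number expression. -/
def NExp.eval (s : State) : NExp → ℕ
  | .lit k => k
  | .get a e => s.nat a (e.eval s)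
  | .add e₁ e₂ => e₁.eval s + e₂.eval s
  | .sub e₁ e₂ => e₁.eval s - e₂.eval s

/-- Value of a real expression (a division by zero returns zero). -/
noncomputable def RExp.eval (s : State) : RExp → ℝ
  | .ofNat e => (e.eval s : ℝ)
  | .get a e => s.real a (e.eval s)
  | .add e₁ e₂ => e₁.eval s + e₂.eval s
  | .sub e₁ e₂ => e₁.eval s - e₂.eval s
  | .mul e₁ e₂ => e₁.eval s * e₂.eval s
  | .div e₁ e₂ => e₁.eval s / e₂.eval s

/-- Truth of a test. -/
def Test.Holds (s : State) : Test → Prop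
  | .natLe e₁ e₂ => e₁.eval s ≤ e₂.eval s
  | .realLe e₁ e₂ => e₁.eval s ≤ e₂.eval s
  | .neg b => ¬ b.Holds s

open Classical in
/-- The set of ground elements marked by the nonzero entries of the real array `q`. -/
noncomputable def State.markedSet (s : State) (n q : ℕ) : Finset (Fin n) :=
  Finset.univ.filter fun u => s.real q u ≠ 0

/-- `Exec f P s t s'`: started in state `s` with value oracle `f`, the program `P` halts in state
`s'` after `t` steps.  Each assignment, coin flip, oracle query and test costs one step; as the
expressions in a program have a fixed size, this counts the elementary operations up to a constant
factor that depends on the program only. -/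
inductive Exec {n : ℕ} (f : Finset (Fin n) → ℝ) : Prog → State → ℕ → State → Prop
  | skip (s : State) : Exec f .skip s 1 s
  | setNat (s : State) (a : ℕ) (i e : NExp) :
      Exec f (.setNat a i e) s 1 (s.writeNat a (i.eval s) (e.eval s))
  | setReal (s : State) (a : ℕ) (i : NExp) (e : RExp) :
      Exec f (.setReal a i e) s 1 (s.writeReal a (i.eval s) (e.eval s))
  | flip (s : State) (a : ℕ) (i : NExp) :
      Exec f (.flip a i) s 1
        { s.writeNat a (i.eval s) (s.tape s.pos).toNat with pos := s.pos + 1 }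
  | query (s : State) (q a : ℕ) (i : NExp) :
      Exec f (.query q a i) s 1 (s.writeReal a (i.eval s) (f (s.markedSet n q)))
  | seq {P Q : Prog} {s s' s'' : State} {t t' : ℕ} :
      Exec f P s t s' → Exec f Q s' t' s'' → Exec f (.seq P Q) s (t + t') s''
  | condTrue {b : Test} {P Q : Prog} {s s' : State} {t : ℕ} :
      b.Holds s → Exec f P s t s' → Exec f (.cond b P Q) s (t + 1) s'
  | condFalse {b : Test} {P Q : Prog} {s s' : State} {t : ℕ} :
      ¬ b.Holds s → Exec f Q s t s' → Exec f (.cond b P Q) s (t + 1) s'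
  | loopDone {b : Test} {P : Prog} {s : State} :
      ¬ b.Holds s → Exec f (.loop b P) s 1 s
  | loopStep {b : Test} {P : Prog} {s s' s'' : State} {t t' : ℕ} :
      b.Holds s → Exec f P s t s' → Exec f (.loop b P) s' t' s'' →
      Exec f (.loop b P) s (t + t' + 1) s''

/-- Initial state on a knapsack instance: natural number cell `(0, 0)` holds `n = |N|`, real array
`0` holds the costs, real cells `(1, 0)` and `(1, 1)` hold the budget `B` and the parameter `ε`;
all other cells are zero, and `m` random bits `ω` are on the tape. -/
noncomputable def initState {n : ℕ} (p : Fin n → ℝ) (B ε : ℝ) {m : ℕ} (ω : Fin m → Bool) :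
    State where
  nat a i := if a = 0 ∧ i = 0 then n else 0
  real a i :=
    if a = 0 then (if h : i < n then p ⟨i, h⟩ else 0)
    else if a = 1 then (if i = 0 then B else if i = 1 then ε else 0)
    else 0
  tape i := if h : i < m then ω ⟨i, h⟩ else false
  pos := 0

/-- The output vector, read from the real array `2`. -/
def State.output (s : State) (n : ℕ) : Fin n → ℝ := fun u => s.real 2 u

/-- `x ω` is the output of the program on the given instance with random bits `ω`, and the program
halts within `m` steps for all `ω`.  In particular it never reads more than the `m` bits of `ω`. -/
def OutputsWithin (P : Prog) {n : ℕ} (f : Finset (Fin n) → ℝ) (p : Fin n → ℝ) (B ε : ℝ) (m : ℕ)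
    (x : (Fin m → Bool) → Fin n → ℝ) : Prop :=
  ∀ ω, ∃ t ≤ m, ∃ s, Exec f P (initState p B ε ω) t s ∧ s.output n = x ω

/-- Expectation over `m` independent fair random bits. -/
noncomputable def expect {m : ℕ} (X : (Fin m → Bool) → ℝ) : ℝ := (∑ ω, X ω) / 2 ^ m

end Bicriteria

/-!
The algorithm is a stochastic projected ascent.  It moves a point `y ∈ [0,1]^N` that satisfies the
budget approximately, and outputs not `y` but the image `x` of `y` under a fixed scalar map.  The
map is chosen so that `x` exceeds the budget by the factor `ρ(c, ε)` at most, and so that `y` comes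
with a vector field `V(y)`, a weighted sum of partial derivatives of the multilinear extension `F`
at points of a path determined by `y`, for which an optimal set `O` satisfies

  `F(x) + ⟨V(y), 1_O - y⟩ ≥ (1 - ε - o(1)) f(O)`.

Such a pair of map and field is called a *scheme* here.  Since the ascent makes `⟨V(y), 1_O - y⟩`
small on average, the value of `x` at a random iteration is large.

* For `c ≤ 1/2` the map is a discretisation of `x = 1 - ε^y`. Along the path `a(t) = 1 - ε^{t y}`
  the potential `w F(a) + (1 - w) F(a ∨ 1_O)` with `w = ε^{1 - t}` increases, up to the inner
  product with the field (`lowScheme_inequality`). As `t ↦ 1 - ε^t` is concave, the cost of `x` is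
  at most `(1 - ε^c) ‖p‖₁ = ρ(c, ε) B` (`sum_low_le`).
* For `c ≥ 1/2` the map is `x = q² + 2 s q y`, where `s` approximates `√ε` from above and
  `q = 1 - s`. Let `a` run from `0` to `x` and `b` from the all-one vector to `x`, and let `d` agree with
  `b` on `O` and with `a` off `O`. The potential `s² F(a) + q² F(b) + 2 s q F(d)` starts at a value
  of at least `(s² · 0 + q² + 2 s q) f(O) = (1 - s²) f(O)`, ends at `F(x)`, and increases up to the
  inner product with the field, because what is left is a sum of differences
  `∂_u F(a) - ∂_u F(b) ≥ 0` with coefficients `s² q² (1 - 2 y_u)²` (`highScheme_inequality`). The map is affine, which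
  gives the cost of `x` at once (`sum_high_le`).

Let `M` be the largest value of a singleton, so that `f ≤ n M`, and `M ≤ f(OPT)`.  An iteration
either makes a step of size `1 / (2 n⁶ M)` in the direction of an estimate of `V(y)`, obtained by
rounding the points of the path against common random thresholds, or, if `y` exceeds the budget by a
factor of more than `1 + 1/n²`, projects `y` onto the hyperplane `⟨p, y⟩ = B`.  The potential of the
analysis is the total value of the solutions found so far minus `n⁶ M ‖y - 1_O‖²`.  A step in the
direction of the field raises it by almost `(1 - ε) f(O)`, by the inequality above; a projection
raises it by `n M ≥ f(O)`, as it brings `y` closer to `1_O` by `1 / n⁵` at least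
(`sqDist_repair_le`).  Initially it is at least `-n⁷ M`, so that `n⁸` iterations suffice
(`Scheme.Valid.le_expect_output`).  Instead of the total value only one solution is kept, which is
replaced in iteration `k` with probability about `1 / (k + 1)`.

The program that carries this out is analysed with weakest preconditions for loop-free code, one
rule for loops with a known number of iterations, and the fact that a program changes only those
arrays to which it contains an assignment (`Exec.frame`).
-/

namespace Bicriteria

variable {n : ℕ}

/-! ### The multilinear extension -/

/-- The marginal `g(S + u) - g(S - u)` of `u`, as a set function. -/
def marginal (g : Finset (Fin n) → ℝ) (u : Fin n) (S : Finset (Fin n)) : ℝ :=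
  g (insert u S) - g (S.erase u)

/-- The partial derivative `∂F/∂x_u` of the multilinear extension `F` of `g`. -/
noncomputable def partialDeriv (g : Finset (Fin n) → ℝ) (u : Fin n) (x : Fin n → ℝ) : ℝ :=
  multilinearExt (marginal g u) x

theorem multilinearExt_eq_sum_erase (g : Finset (Fin n) → ℝ) (x : Fin n → ℝ) (u : Fin n) :
    multilinearExt g x = ∑ t ∈ (Finset.univ.erase u).powerset,
      (g t * (1 - x u) + g (insert u t) * x u) *
        ((∏ v ∈ t, x v) * ∏ v ∈ tᶜ.erase u, (1 - x v)) := by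
  unfold multilinearExt
  have h0 : (Finset.univ : Finset (Finset (Fin n))) =
      (insert u (Finset.univ.erase u)).powerset := by
    rw [Finset.insert_erase (Finset.mem_univ u), Finset.powerset_univ]
  rw [h0, Finset.sum_powerset_insert (Finset.notMem_erase u _), ← Finset.sum_add_distrib]
  refine Finset.sum_congr rfl fun t ht => ?_
  have hu : u ∉ t := fun h => Finset.notMem_erase u _ (Finset.mem_powerset.1 ht h)
  have h1 : ∏ v ∈ tᶜ, (1 - x v) = (1 - x u) * ∏ v ∈ tᶜ.erase u, (1 - x v) :=
    (Finset.mul_prod_erase _ _ (Finset.mem_compl.2 hu)).symm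
  have h2 : (insert u t)ᶜ = tᶜ.erase u := by
    ext v; simp
  rw [h1, h2, Finset.prod_insert hu]
  ring

/-- The multilinear extension is affine in each coordinate. -/
theorem multilinearExt_update (g : Finset (Fin n) → ℝ) (x : Fin n → ℝ) (u : Fin n) (z : ℝ) :
    multilinearExt g (Function.update x u z) - multilinearExt g x =
      (z - x u) * partialDeriv g u x := by
  unfold partialDeriv
  rw [multilinearExt_eq_sum_erase g _ u, multilinearExt_eq_sum_erase g x u,
    multilinearExt_eq_sum_erase (marginal g u) x u, ← Finset.sum_sub_distrib, Finset.mul_sum]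
  refine Finset.sum_congr rfl fun t ht => ?_
  have hu : u ∉ t := fun h => Finset.notMem_erase u _ (Finset.mem_powerset.1 ht h)
  have h1 : ∏ v ∈ t, Function.update x u z v = ∏ v ∈ t, x v :=
    Finset.prod_congr rfl fun v hv => by
      rw [Function.update_of_ne (ne_of_mem_of_not_mem hv hu)]
  have h2 : ∏ v ∈ tᶜ.erase u, (1 - Function.update x u z v) = ∏ v ∈ tᶜ.erase u, (1 - x v) :=
    Finset.prod_congr rfl fun v hv => by
      rw [Function.update_of_ne (Finset.ne_of_mem_erase hv)]
  rw [h1, h2]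
  simp only [Function.update_self, marginal, Finset.insert_idem, Finset.erase_insert_eq_erase,
    Finset.erase_eq_of_notMem hu]
  ring

/-- Changing the coordinates from `x` to `y` one after the other, each change multiplies a partial
derivative at a vertex of the box spanned by `x` and `y`. -/
theorem sum_le_multilinearExt_sub (g : Finset (Fin n) → ℝ) (x y L : Fin n → ℝ)
    (h : ∀ u z, (∀ v, z v = x v ∨ z v = y v) → L u ≤ (y u - x u) * partialDeriv g u z) :
    ∑ u, L u ≤ multilinearExt g y - multilinearExt g x := by
  have key : ∀ S : Finset (Fin n),
      ∑ u ∈ S, L u ≤ multilinearExt g (S.piecewise y x) - multilinearExt g x := by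
    intro S
    induction S using Finset.induction_on with
    | empty => simp
    | insert u S hu ih =>
      rw [Finset.sum_insert hu, Finset.piecewise_insert]
      have h1 := multilinearExt_update g (S.piecewise y x) u (y u)
      have h2 := h u (S.piecewise y x) fun v => by
        by_cases hv : v ∈ S <;> simp [hv]
      rw [Finset.piecewise_eq_of_notMem _ _ _ hu] at h1
      linarith
  simpa using key Finset.univ

theorem multilinearExt_sub (g h : Finset (Fin n) → ℝ) (x : Fin n → ℝ) :
    multilinearExt (fun S => g S - h S) x = multilinearExt g x - multilinearExt h x := by
  unfold multilinearExt
  rw [← Finset.sum_sub_distrib]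
  exact Finset.sum_congr rfl fun S _ => by ring

theorem multilinearExt_const (a : ℝ) (x : Fin n → ℝ) :
    multilinearExt (fun _ : Finset (Fin n) => a) x = a := by
  have h := Finset.prod_add x (fun u => 1 - x u) Finset.univ
  simp only [add_sub_cancel, Finset.prod_const_one, Finset.powerset_univ,
    ← Finset.compl_eq_univ_sdiff] at h
  unfold multilinearExt
  simp only [mul_assoc]
  rw [← Finset.mul_sum, ← h, mul_one]

/-- The points of the cube `[0,1]^N`. -/
def InCube (x : Fin n → ℝ) : Prop := ∀ u, 0 ≤ x u ∧ x u ≤ 1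

theorem InCube.vertex {x y z : Fin n → ℝ} (hx : InCube x) (hy : InCube y)
    (h : ∀ v, z v = x v ∨ z v = y v) : InCube z := fun v => by
  rcases h v with h | h <;> rw [h]
  exacts [hx v, hy v]

theorem multilinearExt_nonneg {g : Finset (Fin n) → ℝ} (hg : ∀ S, 0 ≤ g S) {x : Fin n → ℝ}
    (hx : InCube x) : 0 ≤ multilinearExt g x := by
  refine Finset.sum_nonneg fun S _ => mul_nonneg (mul_nonneg (hg S) ?_) ?_
  · exact Finset.prod_nonneg fun u _ => (hx u).1
  · exact Finset.prod_nonneg fun u _ => sub_nonneg.2 (hx u).2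

theorem multilinearExt_mono {g h : Finset (Fin n) → ℝ} (hgh : ∀ S, g S ≤ h S) {x : Fin n → ℝ}
    (hx : InCube x) : multilinearExt g x ≤ multilinearExt h x := by
  have := multilinearExt_nonneg (g := fun S => h S - g S) (fun S => sub_nonneg.2 (hgh S)) hx
  rw [multilinearExt_sub] at this
  linarith

theorem multilinearExt_le {g : Finset (Fin n) → ℝ} {a : ℝ} (hg : ∀ S, g S ≤ a) {x : Fin n → ℝ}
    (hx : InCube x) : multilinearExt g x ≤ a :=
  (multilinearExt_mono hg hx).trans_eq (multilinearExt_const a x)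

theorem le_multilinearExt {g : Finset (Fin n) → ℝ} {a : ℝ} (hg : ∀ S, a ≤ g S) {x : Fin n → ℝ}
    (hx : InCube x) : a ≤ multilinearExt g x :=
  (multilinearExt_const a x).symm.trans_le (multilinearExt_mono hg hx)

/-- A set function with values in `[0, a]` has an `a`-Lipschitz multilinear extension with respect
to the `ℓ¹` norm. -/
theorem multilinearExt_lipschitz {g : Finset (Fin n) → ℝ} {a : ℝ} (h0 : ∀ S, 0 ≤ g S)
    (ha : ∀ S, g S ≤ a) {x y : Fin n → ℝ} (hx : InCube x) (hy : InCube y) :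
    |multilinearExt g x - multilinearExt g y| ≤ a * ∑ u, |x u - y u| := by
  have key : ∀ x y : Fin n → ℝ, InCube x → InCube y →
      -(a * ∑ u, |x u - y u|) ≤ multilinearExt g y - multilinearExt g x := by
    intro x y hx hy
    rw [Finset.mul_sum, ← Finset.sum_neg_distrib]
    refine sum_le_multilinearExt_sub g x y _ fun u z hz => ?_
    have hz' := hx.vertex hy hz
    have h1 : |partialDeriv g u z| ≤ a := by
      rw [abs_le]
      exact ⟨le_multilinearExt (fun S => by
          have := h0 (insert u S); have := ha (S.erase u); unfold marginal; linarith) hz',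
        multilinearExt_le (fun S => by
          have := ha (insert u S); have := h0 (S.erase u); unfold marginal; linarith) hz'⟩
    have h2 := neg_abs_le ((y u - x u) * partialDeriv g u z)
    rw [abs_mul, abs_sub_comm] at h2
    have h3 := mul_le_mul_of_nonneg_left h1 (abs_nonneg (x u - y u))
    linarith
  rw [abs_le]
  have h1 := key x y hx hy
  have h2 := key y x hy hx
  simp only [abs_sub_comm (y _)] at h2
  constructor <;> linarith

theorem multilinearExt_indicator (g : Finset (Fin n) → ℝ) (S : Finset (Fin n)) :
    multilinearExt g (fun u => if u ∈ S then 1 else 0) = g S := by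
  unfold multilinearExt
  rw [Finset.sum_eq_single S]
  · rw [Finset.prod_congr rfl (g := fun _ => (1 : ℝ)) fun u hu => by simp [hu],
      Finset.prod_congr rfl (s₁ := Sᶜ) (g := fun _ => (1 : ℝ)) fun u hu => by
        simp [Finset.mem_compl.1 hu]]
    simp
  · intro T _ hT
    by_cases h : T ⊆ S
    · obtain ⟨u, huS, huT⟩ := Finset.exists_of_ssubset (h.ssubset_of_ne hT)
      rw [Finset.prod_eq_zero (s := Tᶜ) (Finset.mem_compl.2 huT) (by simp [huS]), mul_zero]
    · obtain ⟨u, huT, huS⟩ := Finset.not_subset.1 h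
      rw [Finset.prod_eq_zero (s := T) huT (by simp [huS])]
      simp
  · simp

/-! ### Monotone submodular functions -/

theorem marginal_nonneg {f : Finset (Fin n) → ℝ} (hmon : Monotone f) (u : Fin n)
    (S : Finset (Fin n)) : 0 ≤ marginal f u S :=
  sub_nonneg.2 (hmon ((Finset.erase_subset u S).trans (Finset.subset_insert u S)))

theorem IsSubmodular.marginal_anti {f : Finset (Fin n) → ℝ} (hsub : IsSubmodular f) (u : Fin n)
    {S T : Finset (Fin n)} (hST : S ⊆ T) : marginal f u T ≤ marginal f u S := by
  have h := hsub _ _ (Finset.erase_subset_erase u hST) u (Finset.notMem_erase u T)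
  have e : ∀ R : Finset (Fin n), insert u (R.erase u) = insert u R := fun R => by
    ext v; by_cases hv : v = u <;> simp [hv]
  rwa [e, e] at h

theorem IsSubmodular.marginal_le {f : Finset (Fin n) → ℝ} (hsub : IsSubmodular f)
    (h0 : ∀ S, 0 ≤ f S) {M : ℝ} (hM : ∀ u, f {u} ≤ M) (u : Fin n) (S : Finset (Fin n)) :
    marginal f u S ≤ M := by
  have h := hsub.marginal_anti u (Finset.empty_subset S)
  have h1 := h0 ∅
  have h2 := hM u
  simp only [marginal, insert_empty_eq, Finset.erase_empty] at h ⊢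
  linarith

theorem partialDeriv_nonneg {f : Finset (Fin n) → ℝ} (hmon : Monotone f) (u : Fin n)
    {x : Fin n → ℝ} (hx : InCube x) : 0 ≤ partialDeriv f u x :=
  multilinearExt_nonneg (marginal_nonneg hmon u) hx

theorem IsSubmodular.partialDeriv_anti {f : Finset (Fin n) → ℝ} (hsub : IsSubmodular f)
    (u : Fin n) {x y : Fin n → ℝ} (hx : InCube x) (hy : InCube y) (hxy : ∀ v, x v ≤ y v) :
    partialDeriv f u y ≤ partialDeriv f u x := by
  have h := sum_le_multilinearExt_sub (marginal f u) y x (fun _ => 0) fun v z hz => by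
    have hz' := hy.vertex hx hz
    have h1 : partialDeriv (marginal f u) v z ≤ 0 := multilinearExt_le (fun S => by
      have := hsub.marginal_anti u ((Finset.erase_subset v S).trans (Finset.subset_insert v S))
      unfold marginal at this ⊢
      linarith) hz'
    have h2 := hxy v
    exact mul_nonneg_of_nonpos_of_nonpos (by linarith) h1
  simp only [Finset.sum_const_zero] at h
  exact sub_nonneg.1 h

/-- The multilinear extension lies above its tangents taken at the upper end point. -/
theorem IsSubmodular.sum_partialDeriv_le {f : Finset (Fin n) → ℝ} (hsub : IsSubmodular f)
    {x y : Fin n → ℝ} (hx : InCube x) (hy : InCube y) (hxy : ∀ v, x v ≤ y v) :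
    ∑ u, (y u - x u) * partialDeriv f u y ≤ multilinearExt f y - multilinearExt f x := by
  refine sum_le_multilinearExt_sub f x y _ fun u z hz => ?_
  refine mul_le_mul_of_nonneg_left ?_ (sub_nonneg.2 (hxy u))
  refine hsub.partialDeriv_anti u (hx.vertex hy hz) hy fun v => ?_
  rcases hz v with h | h <;> rw [h]
  exact hxy v

/-- The multilinear extension lies below its tangents taken at the lower end point. -/
theorem IsSubmodular.le_sum_partialDeriv {f : Finset (Fin n) → ℝ} (hsub : IsSubmodular f)
    {x y : Fin n → ℝ} (hx : InCube x) (hy : InCube y) (hxy : ∀ v, x v ≤ y v) :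
    multilinearExt f y - multilinearExt f x ≤ ∑ u, (y u - x u) * partialDeriv f u x := by
  have h := sum_le_multilinearExt_sub f y x (fun u => (x u - y u) * partialDeriv f u x)
    fun u z hz => by
      have h1 : partialDeriv f u z ≤ partialDeriv f u x := by
        refine hsub.partialDeriv_anti u hx (hy.vertex hx hz) fun v => ?_
        rcases hz v with h | h <;> rw [h]
        exact hxy v
      exact mul_le_mul_of_nonpos_left h1 (sub_nonpos.2 (hxy u))
  have h2 : ∑ u, (y u - x u) * partialDeriv f u x = -∑ u, (x u - y u) * partialDeriv f u x := by
    rw [← Finset.sum_neg_distrib]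
    exact Finset.sum_congr rfl fun u _ => by ring
  linarith

theorem multilinearExt_le_of_le {f : Finset (Fin n) → ℝ} (hmon : Monotone f)
    {x y : Fin n → ℝ} (hx : InCube x) (hy : InCube y) (hxy : ∀ v, x v ≤ y v) :
    multilinearExt f x ≤ multilinearExt f y := by
  have h := sum_le_multilinearExt_sub f x y (fun _ => 0) fun u z hz =>
    mul_nonneg (sub_nonneg.2 (hxy u)) (partialDeriv_nonneg hmon u (hx.vertex hy hz))
  simp only [Finset.sum_const_zero] at h
  exact sub_nonneg.1 h

/-- Concavity along rays from the origin. -/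
theorem IsSubmodular.mul_multilinearExt_le {f : Finset (Fin n) → ℝ} (hsub : IsSubmodular f)
    (h0 : ∀ S, 0 ≤ f S) {x : Fin n → ℝ} (hx : InCube x) {a : ℝ} (ha : 0 ≤ a) (ha1 : a ≤ 1) :
    a * multilinearExt f x ≤ multilinearExt f (fun u => a * x u) := by
  have hax : InCube fun u => a * x u := fun u =>
    ⟨mul_nonneg ha (hx u).1, mul_le_one₀ ha1 (hx u).1 (hx u).2⟩
  have hz : InCube fun _ : Fin n => (0 : ℝ) := fun _ => ⟨le_rfl, zero_le_one⟩
  have h1 := hsub.le_sum_partialDeriv hax hx fun v => mul_le_of_le_one_left (hx v).1 ha1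
  have h2 := hsub.sum_partialDeriv_le hz hax fun v => mul_nonneg ha (hx v).1
  have h3 := multilinearExt_nonneg h0 hz
  have e1 : ∑ u, (x u - a * x u) * partialDeriv f u (fun u => a * x u) =
      (1 - a) * ∑ u, x u * partialDeriv f u (fun u => a * x u) := by
    rw [Finset.mul_sum]; exact Finset.sum_congr rfl fun u _ => by ring
  have e2 : ∑ u, (a * x u - 0) * partialDeriv f u (fun u => a * x u) =
      a * ∑ u, x u * partialDeriv f u (fun u => a * x u) := by
    rw [Finset.mul_sum]; exact Finset.sum_congr rfl fun u _ => by ring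
  rw [e1] at h1
  rw [e2] at h2
  have h4 := mul_le_mul_of_nonneg_left h1 ha
  have h5 := mul_le_mul_of_nonneg_left h2 (sub_nonneg.2 ha1)
  have h6 := mul_nonneg (sub_nonneg.2 ha1) h3
  nlinarith

/-- The values of a monotone submodular function are bounded by `n` times a bound for the
singletons. -/
theorem IsSubmodular.le_card_mul {f : Finset (Fin n) → ℝ} (hsub : IsSubmodular f)
    (hmon : Monotone f) (h0 : ∀ S, 0 ≤ f S) {M : ℝ} (hM : ∀ u, f {u} ≤ M) (hn : 0 < n)
    (S : Finset (Fin n)) : f S ≤ n * M := by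
  have hM0 : f ∅ ≤ M := (hmon (Finset.empty_subset {⟨0, hn⟩})).trans (hM _)
  have key : ∀ T : Finset (Fin n), f T ≤ max 1 (T.card : ℝ) * M := by
    intro T
    induction T using Finset.induction_on with
    | empty => simpa using hM0
    | insert u T hu ih =>
      rcases T.eq_empty_or_nonempty with rfl | hT
      · simpa using hM u
      · have h1 := hsub ∅ T (Finset.empty_subset T) u hu
        have h2 : (1 : ℝ) ≤ T.card := by exact_mod_cast hT.card_pos
        rw [max_eq_right h2] at ih
        rw [Finset.card_insert_of_notMem hu]
        have h3 := le_max_right 1 (((T.card + 1 : ℕ)) : ℝ)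
        have h4 := hM u
        have h5 := h0 ∅
        have h6 : 0 ≤ M := (h0 _).trans hM0
        have h7 := mul_le_mul_of_nonneg_right h3 h6
        simp only [insert_empty_eq] at h1
        push_cast at h7 ⊢
        linarith
  have h1 := key S
  have h2 : max 1 (S.card : ℝ) ≤ n := by
    refine max_le (by exact_mod_cast hn) ?_
    exact_mod_cast (Finset.card_le_univ S).trans_eq (Fintype.card_fin n)
  exact h1.trans (mul_le_mul_of_nonneg_right h2 ((h0 _).trans hM0))

theorem IsSubmodular.partialDeriv_le {f : Finset (Fin n) → ℝ} (hsub : IsSubmodular f)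
    (h0 : ∀ S, 0 ≤ f S) {M : ℝ} (hM : ∀ u, f {u} ≤ M) (u : Fin n) {x : Fin n → ℝ}
    (hx : InCube x) : partialDeriv f u x ≤ M :=
  multilinearExt_le (hsub.marginal_le h0 hM u) hx


/-! ### Ascent fields along discretised paths -/

/-- Scalar data describing an ascent direction at `y ∈ [0,1]^N`.  The `j`-th of `rounds` sample
points has coordinates `point j (y u)`, the partial derivative in direction `u` there enters with
weight `weight j (y u)`, and `out (y u)` are the coordinates of the solution that belongs to `y`. -/
structure Scheme where
  rounds : ℕ
  point : ℕ → ℝ → ℝ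
  weight : ℕ → ℝ → ℝ
  out : ℝ → ℝ

/-- The vector field `V(y)` of a scheme. -/
noncomputable def Scheme.field (σ : Scheme) (f : Finset (Fin n) → ℝ) (y : Fin n → ℝ)
    (u : Fin n) : ℝ :=
  ∑ j ∈ Finset.range σ.rounds,
    σ.weight j (y u) * partialDeriv f u fun v => σ.point j (y v)

/-- The properties of a scheme used by the ascent method.  The total weight of the sample points is
at most `W`, and solutions are bounded by `1 - ε`.  The last property says that a point `y` at
which the field `V(y)` has non-positive inner product with `1_O - y` yields a solution of value
at least `α f(O)`, up to an error of order `β`. -/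
structure Scheme.Valid (σ : Scheme) (ε W α β : ℝ) : Prop where
  point_mem : ∀ j < σ.rounds, ∀ z, 0 ≤ z → z ≤ 1 → 0 ≤ σ.point j z ∧ σ.point j z ≤ 1
  weight_nonneg : ∀ j < σ.rounds, ∀ z, 0 ≤ z → z ≤ 1 → 0 ≤ σ.weight j z
  sum_weight_le : ∀ z, 0 ≤ z → z ≤ 1 → ∑ j ∈ Finset.range σ.rounds, σ.weight j z ≤ W
  out_nonneg : ∀ z, 0 ≤ z → z ≤ 1 → 0 ≤ σ.out z
  out_le : ∀ z, 0 ≤ z → z ≤ 1 → σ.out z ≤ 1 - ε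
  mul_out_le : ∀ a z, 0 ≤ a → a ≤ 1 → 0 ≤ z → z ≤ 1 → a * σ.out z ≤ σ.out (a * z)
  inequality : ∀ (n : ℕ) (f : Finset (Fin n) → ℝ) (M : ℝ), (∀ S, 0 ≤ f S) → Monotone f →
    IsSubmodular f → (∀ u, f {u} ≤ M) → ∀ y : Fin n → ℝ, InCube y → ∀ O : Finset (Fin n),
    α * f O - n * M * β ≤ multilinearExt f (fun u => σ.out (y u)) +
      ∑ u, σ.field f y u * ((if u ∈ O then 1 else 0) - y u)

/-! ### The field for density at most one half -/

/-- The path `1 - (1 + h y)^{-j}` from `0` to the solution, a discretisation of `1 - ε^{t y}`. -/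
noncomputable def lowScheme (h : ℝ) (K : ℕ) : Scheme where
  rounds := K
  point j z := 1 - ((1 + h * z) ^ (j + 1))⁻¹
  weight j z := h * ((1 + h) ^ (K - j))⁻¹ * ((1 + h * z) ^ (j + 1))⁻¹
  out z := 1 - ((1 + h * z) ^ K)⁻¹

theorem inv_pow_mem {h z : ℝ} (hh : 0 ≤ h) (hz : 0 ≤ z) (j : ℕ) :
    0 ≤ ((1 + h * z) ^ j)⁻¹ ∧ ((1 + h * z) ^ j)⁻¹ ≤ 1 := by
  have h1 : 1 ≤ 1 + h * z := by have := mul_nonneg hh hz; linarith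
  exact ⟨by positivity, inv_le_one_of_one_le₀ (one_le_pow₀ h1)⟩

/-- The potential `w_j F(a_j) + (1 - w_j) F(a_j ∨ 1_O)` with `w_j = (1 + h)^{j - K}` increases
along the path `a_j = 1 - (1 + h y)^{-j}`, up to the inner product of the field with `1_O - y`. -/
theorem lowScheme_inequality {h : ℝ} (hh : 0 < h) (K : ℕ) {f : Finset (Fin n) → ℝ}
    (h0 : ∀ S, 0 ≤ f S) (hmon : Monotone f) (hsub : IsSubmodular f) {y : Fin n → ℝ}
    (hy : InCube y) (O : Finset (Fin n)) :
    (1 - ((1 + h) ^ K)⁻¹) * f O ≤ multilinearExt f (fun u => (lowScheme h K).out (y u)) +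
      ∑ u, (lowScheme h K).field f y u * ((if u ∈ O then 1 else 0) - y u) := by
  set r : ℕ → Fin n → ℝ := fun j u => ((1 + h * y u) ^ j)⁻¹ with hr
  set a : ℕ → Fin n → ℝ := fun j u => 1 - r j u with ha
  set o : ℕ → Fin n → ℝ := fun j u => if u ∈ O then 1 else a j u with ho
  set w : ℕ → ℝ := fun j => ((1 + h) ^ (K - j))⁻¹ with hw
  have hr01 : ∀ j u, 0 ≤ r j u ∧ r j u ≤ 1 := fun j u => inv_pow_mem hh.le (hy u).1 j
  have hrs : ∀ j u, r j u = (1 + h * y u) * r (j + 1) u := fun j u => by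
    have h1 : (1 + h * y u) ≠ 0 := by have := mul_nonneg hh.le (hy u).1; positivity
    simp only [hr, pow_succ, mul_inv]
    field_simp
  have hacube : ∀ j, InCube (a j) := fun j u =>
    ⟨by have := hr01 j u; simp only [ha]; linarith, by have := hr01 j u; simp only [ha]; linarith⟩
  have hocube : ∀ j, InCube (o j) := fun j u => by
    by_cases hu : u ∈ O
    · simp [ho, hu]
    · simpa [ho, hu] using hacube j u
  have hamono : ∀ j u, a j u ≤ a (j + 1) u := fun j u => by
    have h1 := hrs j u
    have h2 := mul_nonneg (mul_nonneg hh.le (hy u).1) (hr01 (j + 1) u).1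
    simp only [ha]
    nlinarith
  have homono : ∀ j u, o j u ≤ o (j + 1) u := fun j u => by
    by_cases hu : u ∈ O
    · simp [ho, hu]
    · simpa [ho, hu] using hamono j u
  have hao : ∀ j u, a j u ≤ o j u := fun j u => by
    by_cases hu : u ∈ O
    · simpa [ho, hu] using (hacube j u).2
    · simp [ho, hu]
  have hw01 : ∀ j, 0 ≤ w j ∧ w j ≤ 1 := fun j => by
    have := inv_pow_mem hh.le zero_le_one (K - j)
    rwa [mul_one] at this
  have hws : ∀ j < K, w (j + 1) = (1 + h) * w j := fun j hj => by
    have h1 : K - j = (K - (j + 1)) + 1 := by omega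
    have h2 : (1 + h) ≠ 0 := by positivity
    simp only [hw]
    rw [h1, pow_succ, mul_inv]
    field_simp
  set Φ : ℕ → ℝ := fun j => w j * multilinearExt f (a j) + (1 - w j) * multilinearExt f (o j)
    with hΦ
  have step : ∀ j < K, Φ j ≤ Φ (j + 1) +
      ∑ u, h * w j * r (j + 1) u * partialDeriv f u (a (j + 1)) *
        ((if u ∈ O then 1 else 0) - y u) := by
    intro j hj
    have h1 := hsub.sum_partialDeriv_le (hacube j) (hacube (j + 1)) (hamono j)
    have h2 := hsub.le_sum_partialDeriv (hacube (j + 1)) (hocube (j + 1)) (hao (j + 1))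
    have h3 := multilinearExt_le_of_le hmon (hocube j) (hocube (j + 1)) (homono j)
    have e : ∑ u, h * w j * r (j + 1) u * partialDeriv f u (a (j + 1)) *
          ((if u ∈ O then 1 else 0) - y u) =
        h * w j * ∑ u, (o (j + 1) u - a (j + 1) u) * partialDeriv f u (a (j + 1)) -
        w j * ∑ u, (a (j + 1) u - a j u) * partialDeriv f u (a (j + 1)) := by
      rw [Finset.mul_sum, Finset.mul_sum, ← Finset.sum_sub_distrib]
      refine Finset.sum_congr rfl fun u _ => ?_
      have h4 : a (j + 1) u - a j u = h * y u * r (j + 1) u := by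
        simp only [ha]; rw [hrs j u]; ring
      have h5 : o (j + 1) u - a (j + 1) u = (if u ∈ O then 1 else 0) * r (j + 1) u := by
        by_cases hu : u ∈ O <;> simp [ho, ha, hu]
      rw [h4, h5]
      ring
    rw [e]
    simp only [hΦ]
    rw [hws j hj]
    have h6 := mul_le_mul_of_nonneg_left h1 (hw01 j).1
    have h7 := mul_le_mul_of_nonneg_left h2 (mul_nonneg hh.le (hw01 j).1)
    have h8 := mul_le_mul_of_nonneg_left h3 (sub_nonneg.2 (hw01 j).2)
    linarith
  have tele : ∀ j ≤ K, Φ 0 ≤ Φ j + ∑ i ∈ Finset.range j,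
      ∑ u, h * w i * r (i + 1) u * partialDeriv f u (a (i + 1)) *
        ((if u ∈ O then 1 else 0) - y u) := by
    intro j
    induction j with
    | zero => intro _; simp
    | succ j ih =>
      intro hj
      rw [Finset.sum_range_succ]
      have h1 := ih (by omega)
      have h2 := step j (by omega)
      linarith
  have hfin := tele K le_rfl
  have e1 : Φ K = multilinearExt f (fun u => (lowScheme h K).out (y u)) := by
    simp [hΦ, hw, ha, hr, lowScheme]
  have e2 : o 0 = fun u => if u ∈ O then 1 else 0 := by
    funext u; simp [ho, ha, hr]
  have e3 : (1 - ((1 + h) ^ K)⁻¹) * f O ≤ Φ 0 := by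
    have h1 : Φ 0 = w 0 * multilinearExt f (a 0) + (1 - w 0) * f O := by
      simp only [hΦ]
      rw [e2, multilinearExt_indicator]
    have h2 := mul_nonneg (hw01 0).1 (multilinearExt_nonneg h0 (hacube 0))
    have h3 : w 0 = ((1 + h) ^ K)⁻¹ := by simp [hw]
    rw [h1, ← h3]
    linarith
  have e4 : ∑ u, (lowScheme h K).field f y u * ((if u ∈ O then 1 else 0) - y u) =
      ∑ i ∈ Finset.range K, ∑ u, h * w i * r (i + 1) u * partialDeriv f u (a (i + 1)) *
        ((if u ∈ O then 1 else 0) - y u) := by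
    rw [Finset.sum_comm]
    refine Finset.sum_congr rfl fun u _ => ?_
    rw [Scheme.field, Finset.sum_mul]
    rfl
  rw [e1] at hfin
  rw [e4]
  linarith

theorem lowScheme_valid {h ε : ℝ} (hh : 0 < h) {K : ℕ} (hε : ε ≤ ((1 + h) ^ K)⁻¹) :
    (lowScheme h K).Valid ε (K * h) (1 - ((1 + h) ^ K)⁻¹) 0 where
  point_mem j _ z hz hz1 := by
    have := inv_pow_mem hh.le hz (j + 1)
    simp only [lowScheme]
    constructor <;> linarith
  weight_nonneg j _ z hz hz1 := by
    simp only [lowScheme]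
    positivity
  sum_weight_le z hz hz1 := by
    have : ∀ j ∈ Finset.range K, (lowScheme h K).weight j z ≤ h := fun j _ => by
      have h1 := inv_pow_mem hh.le hz (j + 1)
      have h2 := inv_pow_mem hh.le zero_le_one (K - j)
      rw [mul_one] at h2
      simp only [lowScheme]
      rw [mul_assoc]
      exact mul_le_of_le_one_right hh.le (mul_le_one₀ h2.2 h1.1 h1.2)
    exact (Finset.sum_le_card_nsmul _ _ _ this).trans_eq (by simp)
  out_nonneg z hz hz1 := by
    have := inv_pow_mem hh.le hz K
    simp only [lowScheme]
    linarith
  out_le z hz hz1 := by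
    have h1 : ((1 + h) ^ K)⁻¹ ≤ ((1 + h * z) ^ K)⁻¹ := by
      gcongr
      exact mul_le_of_le_one_right hh.le hz1
    simp only [lowScheme]
    linarith
  mul_out_le a z ha ha1 hz hz1 := by
    have hc := (convexOn_zpow (𝕜 := ℝ) (-(K : ℤ))).2 (x := 1 + h * z) (y := 1)
      (by have := mul_nonneg hh.le hz; simp only [Set.mem_Ioi]; linarith) (by simp) ha
      (sub_nonneg.2 ha1) (by ring)
    have e : a * (1 + h * z) + (1 - a) = 1 + h * (a * z) := by ring
    simp only [smul_eq_mul, mul_one, e, zpow_neg, zpow_natCast, one_pow, inv_one] at hc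
    simp only [lowScheme]
    linarith
  inequality n f M h0 hmon hsub hM y hy O := by
    simpa using lowScheme_inequality hh K h0 hmon hsub hy O

/-! ### The field for density at least one half -/

/-- The solution is `x = q² + 2 s q y` with `q = 1 - s`, and the sample points run over the segment
from `0` to `x` and over the segment from `1` to `x`, in `m` steps each. -/
noncomputable def highScheme (s : ℝ) (m : ℕ) : Scheme where
  rounds := m + m
  point j z :=
    if j + 1 ≤ m then (j + 1) / m * ((1 - s) ^ 2 + 2 * s * (1 - s) * z)
    else 1 - (j - m) / m * (1 - ((1 - s) ^ 2 + 2 * s * (1 - s) * z))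
  weight j z :=
    if j + 1 ≤ m then 2 * s * (1 - s) * (1 - ((1 - s) ^ 2 + 2 * s * (1 - s) * z)) / m
    else 2 * s * (1 - s) * ((1 - s) ^ 2 + 2 * s * (1 - s) * z) / m
  out z := (1 - s) ^ 2 + 2 * s * (1 - s) * z

theorem high_out_mem {s z : ℝ} (hs : 0 ≤ s) (hs1 : s ≤ 1) (hz : 0 ≤ z) (hz1 : z ≤ 1) :
    0 ≤ (1 - s) ^ 2 + 2 * s * (1 - s) * z ∧
      (1 - s) ^ 2 + 2 * s * (1 - s) * z ≤ 1 - s ^ 2 := by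
  have h1 : 0 ≤ 2 * s * (1 - s) := by
    have := sub_nonneg.2 hs1
    positivity
  have h2 := mul_le_mul_of_nonneg_left hz1 h1
  have h3 := mul_nonneg h1 hz
  constructor <;> nlinarith [sq_nonneg (1 - s)]

/-- With `x = q² + 2 s q y`, `a_j = (j/m) x`, `b_j = 1 - (j/m)(1 - x)` and `c_j` equal to `b_j` on
`O` and to `a_j` off `O`, the potential `s² F(a_j) + q² F(b_j) + 2 s q F(c_j)` starts at a value of
at least `(1 - s²) f(O)`, ends at `F(x)`, and increases up to the inner product of the field with
`1_O - y`: what is left of the increment is a non-negative combination of the differences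
`∂_u F(a_{j+1}) - ∂_u F(b_j)`, with coefficients `s² q² (1 - 2 y_u)²`. -/
theorem highScheme_inequality {s : ℝ} (hs : 0 ≤ s) (hs1 : s ≤ 1) {m : ℕ} (hm : 0 < m)
    {f : Finset (Fin n) → ℝ} (h0 : ∀ S, 0 ≤ f S) (hmon : Monotone f) (hsub : IsSubmodular f)
    {M : ℝ} (hM : ∀ u, f {u} ≤ M) {y : Fin n → ℝ} (hy : InCube y) (O : Finset (Fin n)) :
    (1 - s ^ 2) * f O - n * M * (1 / m) ≤
      multilinearExt f (fun u => (highScheme s m).out (y u)) +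
      ∑ u, (highScheme s m).field f y u * ((if u ∈ O then 1 else 0) - y u) := by
  set q := 1 - s with hq
  have hq0 : 0 ≤ q := sub_nonneg.2 hs1
  set x : Fin n → ℝ := fun u => q ^ 2 + 2 * s * q * y u with hx
  set a : ℕ → Fin n → ℝ := fun j u => j / m * x u with ha
  set b : ℕ → Fin n → ℝ := fun j u => 1 - j / m * (1 - x u) with hb
  set c : ℕ → Fin n → ℝ := fun j u => if u ∈ O then b j u else a j u with hc
  set e : ℕ → Fin n → ℝ := fun j u => if u ∈ O then b j u else a (j + 1) u with he
  have hm' : (0 : ℝ) < m := by exact_mod_cast hm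
  have hx01 : ∀ u, 0 ≤ x u ∧ x u ≤ 1 := fun u => by
    have := high_out_mem hs hs1 (hy u).1 (hy u).2
    exact ⟨this.1, this.2.trans (by nlinarith [sq_nonneg s])⟩
  have ht : ∀ j ≤ m, 0 ≤ (j : ℝ) / m ∧ (j : ℝ) / m ≤ 1 := fun j hj =>
    ⟨by positivity, (div_le_one hm').2 (by exact_mod_cast hj)⟩
  have hts : ∀ j : ℕ, ((j + 1 : ℕ) : ℝ) / m = (j : ℝ) / m + 1 / m := fun j => by
    push_cast; ring
  have hm1 : (0 : ℝ) ≤ 1 / m := by positivity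
  have hacube : ∀ j ≤ m, InCube (a j) := fun j hj u =>
    ⟨mul_nonneg (ht j hj).1 (hx01 u).1, mul_le_one₀ (ht j hj).2 (hx01 u).1 (hx01 u).2⟩
  have hbcube : ∀ j ≤ m, InCube (b j) := fun j hj u => by
    have h1 := mul_nonneg (ht j hj).1 (sub_nonneg.2 (hx01 u).2)
    have h2 := mul_le_one₀ (ht j hj).2 (sub_nonneg.2 (hx01 u).2)
      (by have := (hx01 u).1; linarith : 1 - x u ≤ 1)
    simp only [hb]
    constructor <;> linarith
  have hab : ∀ j ≤ m, ∀ u, a j u ≤ b j u := fun j hj u => by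
    have := (ht j hj).2
    simp only [ha, hb]
    linarith
  have has : ∀ j u, a (j + 1) u - a j u = 1 / m * x u := fun j u => by
    simp only [ha]; rw [hts]; ring
  have hbs : ∀ j u, b j u - b (j + 1) u = 1 / m * (1 - x u) := fun j u => by
    simp only [hb]; rw [hts]; ring
  have hamono : ∀ j u, a j u ≤ a (j + 1) u := fun j u => by
    have := has j u; have := mul_nonneg hm1 (hx01 u).1; linarith
  have hbmono : ∀ j u, b (j + 1) u ≤ b j u := fun j u => by
    have := hbs j u; have := mul_nonneg hm1 (sub_nonneg.2 (hx01 u).2); linarith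
  have hccube : ∀ j ≤ m, InCube (c j) := fun j hj u => by
    by_cases hu : u ∈ O
    · simpa [hc, hu] using hbcube j hj u
    · simpa [hc, hu] using hacube j hj u
  have hecube : ∀ j < m, InCube (e j) := fun j hj u => by
    by_cases hu : u ∈ O
    · simpa [he, hu] using hbcube j hj.le u
    · simpa [he, hu] using hacube (j + 1) hj u
  have hce : ∀ j u, c j u ≤ e j u := fun j u => by
    by_cases hu : u ∈ O
    · simp [hc, he, hu]
    · simpa [hc, he, hu] using hamono j u
  have hce' : ∀ j u, c (j + 1) u ≤ e j u := fun j u => by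
    by_cases hu : u ∈ O
    · simpa [hc, he, hu] using hbmono j u
    · simp [hc, he, hu]
  have heb : ∀ j < m, ∀ u, e j u ≤ b j u := fun j hj u => by
    by_cases hu : u ∈ O
    · simp [he, hu]
    · simpa [he, hu] using (hab (j + 1) hj u).trans (hbmono j u)
  have hac : ∀ j ≤ m, ∀ u, a j u ≤ c j u := fun j hj u => by
    by_cases hu : u ∈ O
    · simpa [hc, hu] using hab j hj u
    · simp [hc, hu]
  set D : (Fin n → ℝ) → Fin n → ℝ := fun z u => partialDeriv f u z with hD
  -- The last summand compensates that the loss along `b` is seen at `b_{j+1}` and not at `b_j`.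
  set Φ : ℕ → ℝ := fun j => s ^ 2 * multilinearExt f (a j) + q ^ 2 * multilinearExt f (b j) +
    2 * s * q * multilinearExt f (c j) + ∑ u, 1 / m * (q ^ 2 * (1 - x u)) * D (b j) u with hΦ
  set G : ℕ → Fin n → ℝ := fun j u =>
    2 * s * q / m * ((1 - x u) * D (a (j + 1)) u + x u * D (b j) u) with hG
  have step : ∀ j < m, Φ j ≤ Φ (j + 1) + ∑ u, G j u * ((if u ∈ O then 1 else 0) - y u) := by
    intro j hj
    have h1 := hsub.sum_partialDeriv_le (hacube j hj.le) (hacube (j + 1) hj) (hamono j)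
    have h2 := hsub.le_sum_partialDeriv (hbcube (j + 1) hj) (hbcube j hj.le) (hbmono j)
    have h3 := hsub.sum_partialDeriv_le (hccube j hj.le) (hecube j hj) (hce j)
    have h4 := hsub.le_sum_partialDeriv (hccube (j + 1) hj) (hecube j hj) (hce' j)
    have h3' : ∑ u, (if u ∈ O then 0 else 1 / m * x u) * D (b j) u ≤
        ∑ u, (e j u - c j u) * partialDeriv f u (e j) := by
      refine Finset.sum_le_sum fun u _ => ?_
      by_cases hu : u ∈ O
      · simp [hu, he, hc]
      · have h5 : e j u - c j u = 1 / m * x u := by simpa [he, hc, hu] using has j u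
        rw [h5, if_neg hu]
        exact mul_le_mul_of_nonneg_left
          (hsub.partialDeriv_anti u (hecube j hj) (hbcube j hj.le) (heb j hj))
          (mul_nonneg hm1 (hx01 u).1)
    have h4' : ∑ u, (e j u - c (j + 1) u) * partialDeriv f u (c (j + 1)) ≤
        ∑ u, (if u ∈ O then 1 / m * (1 - x u) else 0) * D (a (j + 1)) u := by
      refine Finset.sum_le_sum fun u _ => ?_
      by_cases hu : u ∈ O
      · have h5 : e j u - c (j + 1) u = 1 / m * (1 - x u) := by simpa [he, hc, hu] using hbs j u
        rw [h5, if_pos hu]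
        exact mul_le_mul_of_nonneg_left
          (hsub.partialDeriv_anti u (hacube (j + 1) hj) (hccube (j + 1) hj) (hac (j + 1) hj))
          (mul_nonneg hm1 (sub_nonneg.2 (hx01 u).2))
      · simp [hu, he, hc]
    have h6 : 0 ≤ ∑ u, 1 / m * (s ^ 2 * q ^ 2 * (1 - 2 * y u) ^ 2) *
        (D (a (j + 1)) u - D (b j) u) := by
      refine Finset.sum_nonneg fun u _ => mul_nonneg (by positivity) (sub_nonneg.2 ?_)
      exact hsub.partialDeriv_anti u (hacube (j + 1) hj) (hbcube j hj.le) fun v =>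
        (hab (j + 1) hj v).trans (hbmono j v)
    have h7 : ∑ u, 1 / m * (s ^ 2 * q ^ 2 * (1 - 2 * y u) ^ 2) * (D (a (j + 1)) u - D (b j) u) =
        s ^ 2 * ∑ u, (a (j + 1) u - a j u) * partialDeriv f u (a (j + 1)) -
        q ^ 2 * ∑ u, (b j u - b (j + 1) u) * partialDeriv f u (b (j + 1)) +
        2 * s * q * ∑ u, (if u ∈ O then 0 else 1 / m * x u) * D (b j) u -
        2 * s * q * ∑ u, (if u ∈ O then 1 / m * (1 - x u) else 0) * D (a (j + 1)) u +
        (∑ u, 1 / m * (q ^ 2 * (1 - x u)) * D (b (j + 1)) u -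
        ∑ u, 1 / m * (q ^ 2 * (1 - x u)) * D (b j) u) +
        ∑ u, G j u * ((if u ∈ O then 1 else 0) - y u) := by
      simp only [Finset.mul_sum]
      rw [← Finset.sum_sub_distrib, ← Finset.sum_sub_distrib, ← Finset.sum_add_distrib,
        ← Finset.sum_sub_distrib, ← Finset.sum_add_distrib, ← Finset.sum_add_distrib]
      refine Finset.sum_congr rfl fun u _ => ?_
      rw [has, hbs]
      by_cases hu : u ∈ O
      · simp only [hu, if_true, hG, hD, hx, hq]
        ring
      · simp only [hu, if_false, hG, hD, hx, hq]
        ring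
    rw [h7] at h6
    have h8 := mul_le_mul_of_nonneg_left h1 (sq_nonneg s)
    have h9 := mul_le_mul_of_nonneg_left h2 (sq_nonneg q)
    have hsq : 0 ≤ 2 * s * q := by positivity
    have h10 := mul_le_mul_of_nonneg_left (h3'.trans h3) hsq
    have h11 := mul_le_mul_of_nonneg_left (h4.trans h4') hsq
    simp only [hΦ]
    linarith
  have tele : ∀ j ≤ m, Φ 0 ≤ Φ j +
      ∑ i ∈ Finset.range j, ∑ u, G i u * ((if u ∈ O then 1 else 0) - y u) := by
    intro j
    induction j with
    | zero => intro _; simp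
    | succ j ih =>
      intro hj
      rw [Finset.sum_range_succ]
      have h1 := ih (by omega)
      have h2 := step j (by omega)
      linarith
  have hfin := tele m le_rfl
  have hmm : (m : ℝ) / m = 1 := div_self hm'.ne'
  have e1 : a m = x := by funext u; simp [ha, hmm]
  have e2 : b m = x := by funext u; simp [hb, hmm]
  have e3 : c m = x := by funext u; simp [hc, e1, e2]
  have e4 : c 0 = fun u => if u ∈ O then 1 else 0 := by funext u; simp [hc, ha, hb]
  have e5 : b 0 = fun u => if u ∈ (Finset.univ : Finset (Fin n)) then 1 else 0 := by
    funext u; simp [hb]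
  have hout : multilinearExt f (fun u => (highScheme s m).out (y u)) = multilinearExt f x := rfl
  have hΦm : Φ m ≤ multilinearExt f x + n * M * (1 / m) := by
    have h1 : ∑ u, 1 / m * (q ^ 2 * (1 - x u)) * D (b m) u ≤ ∑ u : Fin n, 1 / m * M := by
      refine Finset.sum_le_sum fun u _ => ?_
      rw [mul_assoc]
      refine mul_le_mul_of_nonneg_left ?_ hm1
      have h2 : q ^ 2 * (1 - x u) ≤ 1 := by
        refine mul_le_one₀ (pow_le_one₀ hq0 (by linarith)) (sub_nonneg.2 (hx01 u).2) ?_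
        have := (hx01 u).1; linarith
      have h3 := hsub.partialDeriv_le h0 hM u (hbcube m le_rfl)
      have h4 := partialDeriv_nonneg hmon u (hbcube m le_rfl)
      exact (mul_le_of_le_one_left h4 h2).trans h3
    rw [Finset.sum_const, Finset.card_univ, Fintype.card_fin, nsmul_eq_mul] at h1
    simp only [hΦ]
    rw [e2] at h1 ⊢
    rw [e1, e3]
    have h5 : s ^ 2 * multilinearExt f x + q ^ 2 * multilinearExt f x +
        2 * s * q * multilinearExt f x = multilinearExt f x := by
      simp only [hq]; ring
    linarith
  have hΦ0 : (1 - s ^ 2) * f O ≤ Φ 0 := by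
    have h1 := mul_nonneg (sq_nonneg s) (multilinearExt_nonneg h0 (hacube 0 (by omega)))
    have h2 : 0 ≤ ∑ u, 1 / m * (q ^ 2 * (1 - x u)) * D (b 0) u := by
      refine Finset.sum_nonneg fun u _ => mul_nonneg (mul_nonneg hm1 (mul_nonneg (sq_nonneg q)
        (sub_nonneg.2 (hx01 u).2))) (partialDeriv_nonneg hmon u (hbcube 0 (by omega)))
    have h3 : multilinearExt f (b 0) = f Finset.univ := by rw [e5, multilinearExt_indicator]
    have h4 : multilinearExt f (c 0) = f O := by rw [e4, multilinearExt_indicator]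
    have h5 := mul_le_mul_of_nonneg_left (hmon (Finset.subset_univ O)) (sq_nonneg q)
    simp only [hΦ]
    rw [h3, h4]
    have h6 : (1 - s ^ 2) * f O = q ^ 2 * f O + 2 * s * q * f O := by simp only [hq]; ring
    linarith
  have hfield : ∀ u, (highScheme s m).field f y u = ∑ i ∈ Finset.range m, G i u := by
    intro u
    have : (highScheme s m).rounds = m + m := rfl
    rw [Scheme.field, this, Finset.sum_range_add, ← Finset.sum_add_distrib]
    refine Finset.sum_congr rfl fun i hi => ?_
    have hi' : i + 1 ≤ m := Finset.mem_range.1 hi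
    have hi2 : ¬ (m + i + 1 ≤ m) := by omega
    have ea : (fun v => (highScheme s m).point i (y v)) = a (i + 1) := by
      funext v; simp only [highScheme, if_pos hi', ha, hx, hq]; push_cast; ring
    have eb : (fun v => (highScheme s m).point (m + i) (y v)) = b i := by
      funext v; simp only [highScheme, if_neg hi2, hb, hx, hq]; push_cast; ring
    rw [ea, eb]
    simp only [highScheme, if_pos hi', if_neg hi2, hG, hD, hx, hq]
    ring
  have e6 : ∑ u, (highScheme s m).field f y u * ((if u ∈ O then 1 else 0) - y u) =
      ∑ i ∈ Finset.range m, ∑ u, G i u * ((if u ∈ O then 1 else 0) - y u) := by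
    rw [Finset.sum_comm]
    refine Finset.sum_congr rfl fun u _ => ?_
    rw [hfield, Finset.sum_mul]
  rw [hout, e6]
  linarith

theorem highScheme_valid {s ε : ℝ} (hs : 0 ≤ s) (hs1 : s ≤ 1) (hε : ε ≤ s ^ 2) {m : ℕ}
    (hm : 0 < m) : (highScheme s m).Valid ε 1 (1 - s ^ 2) (1 / m) where
  point_mem j hj z hz hz1 := by
    have hm' : (0 : ℝ) < m := by exact_mod_cast hm
    have hx := high_out_mem hs hs1 hz hz1
    have hx1 : (1 - s) ^ 2 + 2 * s * (1 - s) * z ≤ 1 := hx.2.trans (by nlinarith [sq_nonneg s])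
    simp only [highScheme]
    split_ifs with h
    · have h1 : ((j : ℝ) + 1) / m ≤ 1 := (div_le_one hm').2 (by exact_mod_cast h)
      exact ⟨mul_nonneg (by positivity) hx.1, mul_le_one₀ h1 hx.1 hx1⟩
    · have h2 : j < m + m := hj
      have h3 : (m : ℝ) ≤ j := by exact_mod_cast (by omega : m ≤ j)
      have h4 : (j : ℝ) ≤ m + m := by exact_mod_cast h2.le
      have h5 : ((j : ℝ) - m) / m ≤ 1 := (div_le_one hm').2 (by linarith)
      have h6 : 0 ≤ ((j : ℝ) - m) / m := div_nonneg (by linarith) hm'.le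
      have h7 := mul_le_one₀ h5 (sub_nonneg.2 hx1) (by linarith [hx.1])
      have h8 := mul_nonneg h6 (sub_nonneg.2 hx1)
      constructor <;> linarith
  weight_nonneg j hj z hz hz1 := by
    have hx := high_out_mem hs hs1 hz hz1
    have hx1 : (1 - s) ^ 2 + 2 * s * (1 - s) * z ≤ 1 := hx.2.trans (by nlinarith [sq_nonneg s])
    have h1 : 0 ≤ 2 * s * (1 - s) := mul_nonneg (by linarith) (sub_nonneg.2 hs1)
    simp only [highScheme]
    split_ifs with h
    · exact div_nonneg (mul_nonneg h1 (sub_nonneg.2 hx1)) (Nat.cast_nonneg m)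
    · exact div_nonneg (mul_nonneg h1 hx.1) (Nat.cast_nonneg m)
  sum_weight_le z hz hz1 := by
    have hm' : (m : ℝ) ≠ 0 := by exact_mod_cast hm.ne'
    have : (highScheme s m).rounds = m + m := rfl
    rw [this, Finset.sum_range_add, ← Finset.sum_add_distrib]
    have h1 : ∀ i ∈ Finset.range m, (highScheme s m).weight i z +
        (highScheme s m).weight (m + i) z = 2 * s * (1 - s) / m := fun i hi => by
      have hi' : i + 1 ≤ m := Finset.mem_range.1 hi
      have hi2 : ¬ (m + i + 1 ≤ m) := by omega
      simp only [highScheme, if_pos hi', if_neg hi2]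
      ring
    rw [Finset.sum_congr rfl h1, Finset.sum_const, Finset.card_range, nsmul_eq_mul,
      mul_div_cancel₀ _ hm']
    nlinarith [sq_nonneg (s - 1), sq_nonneg s]
  out_nonneg z hz hz1 := (high_out_mem hs hs1 hz hz1).1
  out_le z hz hz1 := (high_out_mem hs hs1 hz hz1).2.trans (by linarith)
  mul_out_le a z ha ha1 hz hz1 := by
    simp only [highScheme]
    have := mul_le_mul_of_nonneg_right ha1 (sq_nonneg (1 - s))
    linarith
  inequality n f M h0 hmon hsub hM y hy O :=
    highScheme_inequality hs hs1 hm h0 hmon hsub hM hy O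


/-! ### Averages over random bits -/

section RandomBits

open scoped BigOperators

theorem expect_eq {m : ℕ} (X : (Fin m → Bool) → ℝ) : expect X = 𝔼 ω, X ω := by
  rw [Fintype.expect_eq_sum_div_card, expect]
  simp

/-- The bits at the positions in the range of `e` are independent of everything that does not
depend on these positions. -/
theorem expect_eq_of_independent {ι κ α : Type*} [Fintype ι] [Fintype κ]
    [DecidableEq ι] [DecidableEq κ] {e : ι → κ}
    (he : Function.Injective e) (A : (κ → Bool) → α)
    (hA : ∀ ω v, A (Function.extend e v ω) = A ω) (H : α → (ι → Bool) → ℝ) :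
    𝔼 ω, H (A ω) (ω ∘ e) = 𝔼 ω, 𝔼 v, H (A ω) v := by
  -- Exchanging the bits at the positions in the range of `e` with fresh bits is an involution.
  let sw : (κ → Bool) × (ι → Bool) → (κ → Bool) × (ι → Bool) :=
    fun z => (Function.extend e z.2 z.1, z.1 ∘ e)
  have hsw : Function.Involutive sw := by
    rintro ⟨ω, v⟩
    have h1 : Function.extend e v ω ∘ e = v := Function.extend_comp he v ω
    have h2 : Function.extend e (ω ∘ e) (Function.extend e v ω) = ω := by
      funext i
      by_cases hi : ∃ j, e j = i
      · obtain ⟨j, rfl⟩ := hi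
        rw [he.extend_apply]; rfl
      · rw [Function.extend_apply' _ _ _ hi, Function.extend_apply' _ _ _ hi]
    simp only [sw, h1, h2]
  have h1 : 𝔼 ω, 𝔼 v, H (A ω) v = 𝔼 z : (κ → Bool) × (ι → Bool), H (A z.1) z.2 := by
    rw [← Finset.univ_product_univ, Finset.expect_product]
  have h2 : 𝔼 z : (κ → Bool) × (ι → Bool), H (A z.1) z.2 =
      𝔼 z : (κ → Bool) × (ι → Bool), H (A z.1) (z.1 ∘ e) := by
    refine (Fintype.expect_bijective sw hsw.bijective _ _ fun z => ?_).symm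
    simp only [sw, hA]
  rw [h1, h2, ← Finset.univ_product_univ, Finset.expect_product]
  exact Finset.expect_congr rfl fun ω _ => (Fintype.expect_const (ι := ι → Bool) _).symm

theorem prod_expect {ι Ω : Type*} [Fintype ι] [DecidableEq ι] [Fintype Ω] (h : ι → Ω → ℝ) :
    ∏ u, 𝔼 w, h u w = 𝔼 v : ι → Ω, ∏ u, h u (v u) := by
  simp only [Fintype.expect_eq_sum_div_card]
  rw [Finset.prod_div_distrib, Finset.prod_univ_sum, Fintype.piFinset_univ]
  simp

/-- If each element `u` enters a random set independently, the expected value of a set function is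
its multilinear extension at the vector of probabilities. -/
theorem expect_eq_multilinearExt {Ω : Type*} [Fintype Ω] [Nonempty Ω] (P : Fin n → Ω → Prop)
    [∀ u w, Decidable (P u w)] (g : Finset (Fin n) → ℝ) :
    𝔼 v : Fin n → Ω, g (Finset.univ.filter fun u => P u (v u)) =
      multilinearExt g fun u => 𝔼 w, if P u w then (1 : ℝ) else 0 := by
  have hcompl : ∀ u, 1 - (𝔼 w, if P u w then (1 : ℝ) else 0) =
      𝔼 w, if P u w then (0 : ℝ) else 1 := fun u => by
    rw [← Fintype.expect_const (ι := Ω) (1 : ℝ), ← Finset.expect_sub_distrib]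
    exact Finset.expect_congr rfl fun w _ => by by_cases h : P u w <;> simp [h]
  unfold multilinearExt
  have h1 : ∀ S : Finset (Fin n),
      g S * (∏ u ∈ S, 𝔼 w, if P u w then (1 : ℝ) else 0) *
        ∏ u ∈ Sᶜ, (1 - 𝔼 w, if P u w then (1 : ℝ) else 0) =
      𝔼 v : Fin n → Ω, if S = Finset.univ.filter (fun u => P u (v u)) then g S else 0 := by
    intro S
    have h2 : (∏ u ∈ S, 𝔼 w, if P u w then (1 : ℝ) else 0) *
        ∏ u ∈ Sᶜ, (1 - 𝔼 w, if P u w then (1 : ℝ) else 0) =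
        ∏ u, 𝔼 w, if (u ∈ S ↔ P u w) then (1 : ℝ) else 0 := by
      rw [← Finset.prod_mul_prod_compl S]
      congr 1
      · exact Finset.prod_congr rfl fun u hu => by simp [hu]
      · refine Finset.prod_congr rfl fun u hu => ?_
        rw [hcompl]
        exact Finset.expect_congr rfl fun w _ => by
          by_cases h : P u w <;> simp [h, Finset.mem_compl.1 hu]
    rw [mul_assoc, h2, prod_expect, Finset.mul_expect]
    refine Finset.expect_congr rfl fun v _ => ?_
    by_cases h : S = Finset.univ.filter (fun u => P u (v u))
    · rw [if_pos h, Finset.prod_eq_one, mul_one]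
      intro u _
      rw [if_pos]
      rw [h]; simp
    · rw [if_neg h]
      have : ∃ u, ¬ (u ∈ S ↔ P u (v u)) := by
        by_contra hcon
        push Not at hcon
        exact h (by ext u; simp [hcon u])
      obtain ⟨u, hu⟩ := this
      rw [Finset.prod_eq_zero (Finset.mem_univ u) (by rw [if_neg hu]), mul_zero]
  rw [Finset.sum_congr rfl fun S _ => h1 S, ← Finset.expect_sum_comm]
  refine Finset.expect_congr rfl fun v _ => ?_
  simp

/-- The number in `[0,1)` whose binary digits are the bits `v`, the last bit being the leading
digit. -/
noncomputable def dyadic : (b : ℕ) → (Fin b → Bool) → ℝ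
  | 0, _ => 0
  | b + 1, v => (dyadic b (fun i => v i.castSucc) + ((v (Fin.last b)).toNat : ℝ)) / 2

/-- The probability that a random dyadic number with `b` digits is less than `z`. -/
noncomputable def dyadicCdf (b : ℕ) (z : ℝ) : ℝ :=
  𝔼 v : Fin b → Bool, if dyadic b v < z then (1 : ℝ) else 0

theorem dyadicCdf_succ (b : ℕ) (z : ℝ) :
    dyadicCdf (b + 1) z = (dyadicCdf b (2 * z) + dyadicCdf b (2 * z - 1)) / 2 := by
  have h1 : dyadicCdf (b + 1) z = 𝔼 q : Bool × (Fin b → Bool),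
      if (dyadic b q.2 + (q.1.toNat : ℝ)) / 2 < z then (1 : ℝ) else 0 := by
    refine (Fintype.expect_equiv (Fin.snocEquiv fun _ => Bool) _ _ fun q => ?_).symm
    simp [dyadic, Fin.snocEquiv]
  rw [h1, ← Finset.univ_product_univ, Finset.expect_product, Fintype.expect_eq_sum_div_card]
  have h2 : ∀ d : ℝ, d + 1 < 2 * z ↔ d < 2 * z - 1 := fun d => by
    constructor <;> intro h <;> linarith
  have h3 : ∀ d : ℝ, d / 2 < z ↔ d < 2 * z := fun d => by
    rw [div_lt_iff₀ two_pos, mul_comm]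
  simp [h2, h3, dyadicCdf, add_comm]

theorem dyadicCdf_mem (b : ℕ) (z : ℝ) : 0 ≤ dyadicCdf b z ∧ dyadicCdf b z ≤ 1 := by
  constructor
  · exact Finset.expect_nonneg fun v _ => by split_ifs <;> norm_num
  · exact Finset.expect_le Finset.univ_nonempty fun v _ => by split_ifs <;> norm_num

theorem dyadic_mem (b : ℕ) (v : Fin b → Bool) : 0 ≤ dyadic b v ∧ dyadic b v < 1 := by
  induction b with
  | zero => simp [dyadic]
  | succ b ih =>
    have h1 := ih fun i => v i.castSucc
    have h2 : (0 : ℝ) ≤ ((v (Fin.last b)).toNat : ℝ) := Nat.cast_nonneg _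
    have h3 : ((v (Fin.last b)).toNat : ℝ) ≤ 1 := by exact_mod_cast Bool.toNat_le _
    simp only [dyadic]
    constructor <;> linarith [h1.1, h1.2]

theorem dyadicCdf_of_nonpos (b : ℕ) {z : ℝ} (hz : z ≤ 0) : dyadicCdf b z = 0 :=
  Finset.expect_eq_zero fun v _ => if_neg (by linarith [(dyadic_mem b v).1])

theorem dyadicCdf_of_one_le (b : ℕ) {z : ℝ} (hz : 1 ≤ z) : dyadicCdf b z = 1 := by
  unfold dyadicCdf
  rw [Finset.expect_congr rfl fun v _ => if_pos (by linarith [(dyadic_mem b v).2])]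
  exact Fintype.expect_const _

theorem abs_dyadicCdf_sub_le (b : ℕ) {z : ℝ} (hz : 0 ≤ z) (hz1 : z ≤ 1) :
    |dyadicCdf b z - z| ≤ (1 / 2) ^ b := by
  induction b generalizing z with
  | zero =>
    have h1 := dyadicCdf_mem 0 z
    rw [pow_zero, abs_le]
    constructor <;> linarith [h1.1, h1.2]
  | succ b ih =>
    rw [dyadicCdf_succ, pow_succ]
    generalize ((1 : ℝ) / 2) ^ b = t at ih ⊢
    rcases le_total (2 * z) 1 with h | h
    · have h1 := abs_le.1 (ih (z := 2 * z) (by linarith) h)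
      rw [dyadicCdf_of_nonpos b (by linarith : 2 * z - 1 ≤ 0), abs_le]
      constructor <;> linarith [h1.1, h1.2]
    · have h1 := abs_le.1 (ih (z := 2 * z - 1) (by linarith) (by linarith))
      rw [dyadicCdf_of_one_le b h, abs_le]
      constructor <;> linarith [h1.1, h1.2]

open Classical in
/-- Rounding the coordinates of `z ∈ [0,1]^N` against independent random thresholds with `b` binary
digits evaluates the multilinear extension at `z` up to an error of order `2^{-b}`. -/
theorem abs_expect_threshold_sub_le (b : ℕ) {g : Finset (Fin n) → ℝ} {a : ℝ} (h0 : ∀ S, 0 ≤ g S)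
    (ha : ∀ S, g S ≤ a) {z : Fin n → ℝ} (hz : InCube z) :
    |(𝔼 v : Fin n × Fin b → Bool,
        g (Finset.univ.filter fun u => dyadic b (fun i => v (u, i)) < z u)) -
      multilinearExt g z| ≤ a * (n * (1 / 2) ^ b) := by
  have h1 : (𝔼 v : Fin n × Fin b → Bool,
        g (Finset.univ.filter fun u => dyadic b (fun i => v (u, i)) < z u)) =
      multilinearExt g fun u => dyadicCdf b (z u) := by
    unfold dyadicCdf
    rw [← expect_eq_multilinearExt (fun u (w : Fin b → Bool) => dyadic b w < z u) g]
    exact Fintype.expect_equiv (Equiv.curry _ _ _) _ _ fun v => rfl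
  rw [h1]
  refine (multilinearExt_lipschitz h0 ha (fun u => dyadicCdf_mem b (z u)) hz).trans ?_
  have ha0 : 0 ≤ a := (h0 ∅).trans (ha ∅)
  refine mul_le_mul_of_nonneg_left ?_ ha0
  refine (Finset.sum_le_sum fun u _ => abs_dyadicCdf_sub_le b (hz u).1 (hz u).2).trans_eq ?_
  simp

end RandomBits


/-! ### The stochastic ascent method -/

open Classical in
/-- The elements whose threshold is less than their coordinate in `z`. -/
noncomputable def thresholdSet (θ z : Fin n → ℝ) : Finset (Fin n) :=
  Finset.univ.filter fun u => θ u < z u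

/-- An estimate of the field of a scheme by marginals at random sets, all of them obtained from the
same thresholds. -/
noncomputable def Scheme.estimate (σ : Scheme) (f : Finset (Fin n) → ℝ) (θ y : Fin n → ℝ)
    (u : Fin n) : ℝ :=
  ∑ j ∈ Finset.range σ.rounds,
    σ.weight j (y u) * marginal f u (thresholdSet θ fun v => σ.point j (y v))

/-- The projection of the real line onto `[0,1]`. -/
noncomputable def clip (z : ℝ) : ℝ := max 0 (min 1 z)

/-- A gradient step with step size `1 / (2 n⁶)`, relative to the scale `M` of the function. -/
noncomputable def ascend (σ : Scheme) (f : Finset (Fin n) → ℝ) (M : ℝ) (θ y : Fin n → ℝ) :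
    Fin n → ℝ :=
  fun u => clip (y u + σ.estimate f θ y u / (2 * n ^ 6 * M))

/-- Projection onto the hyperplane `⟨p, y⟩ = B`, followed by projection onto the cube. -/
noncomputable def repair (p : Fin n → ℝ) (B : ℝ) (y : Fin n → ℝ) : Fin n → ℝ :=
  fun u => clip (y u - (∑ v, p v * y v - B) / (∑ v, p v ^ 2) * p u)

/-- The solution that belongs to `y`.  A point `y` that violates the budget by a factor of at most
`1 + 1/n²` is scaled down first. -/
noncomputable def Scheme.solution (σ : Scheme) (y : Fin n → ℝ) : Fin n → ℝ :=
  fun u => σ.out (y u / (1 + 1 / n ^ 2))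

open Classical in
/-- One iteration, acting on the current point and the current output.  If the point violates the
budget by too much, it is repaired; otherwise a gradient step is made, and the solution that
belongs to the point becomes the output if `t < 1 / (k + 1)`, so that after `k` iterations each
iteration has determined the output with probability at most about `1 / k`. -/
noncomputable def ascentStep (σ : Scheme) (f : Finset (Fin n) → ℝ) (p : Fin n → ℝ) (B M : ℝ)
    (k : ℕ) (θ : Fin n → ℝ) (t : ℝ) (s : (Fin n → ℝ) × (Fin n → ℝ)) :
    (Fin n → ℝ) × (Fin n → ℝ) :=
  if ∑ u, p u * s.1 u ≤ B * (1 + 1 / n ^ 2) then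
    (ascend σ f M θ s.1, if t < 1 / (k + 1) then σ.solution s.1 else s.2)
  else (repair p B s.1, s.2)

/-- The threshold number `u` in iteration `k`, read from the tape `τ`. -/
noncomputable def threshold (n : ℕ) (τ : ℕ → Bool) (k u : ℕ) : ℝ :=
  dyadic n fun i => τ ((k * (n + 1) + u) * n + i)

/-- The state after `k` iterations with random bits `τ`. -/
noncomputable def trajectory (σ : Scheme) (f : Finset (Fin n) → ℝ) (p : Fin n → ℝ) (B M : ℝ)
    (τ : ℕ → Bool) : ℕ → (Fin n → ℝ) × (Fin n → ℝ)
  | 0 => (fun _ => 0, fun _ => 0)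
  | k + 1 => ascentStep σ f p B M k (fun u => threshold n τ k u) (threshold n τ k n)
      (trajectory σ f p B M τ k)

theorem clip_mem (z : ℝ) : 0 ≤ clip z ∧ clip z ≤ 1 :=
  ⟨le_max_left _ _, max_le zero_le_one (min_le_left _ _)⟩

theorem clip_sub_sq_le {a : ℝ} (ha : 0 ≤ a) (ha1 : a ≤ 1) (z : ℝ) :
    (clip z - a) ^ 2 ≤ (z - a) ^ 2 := by
  unfold clip
  rcases le_total z 0 with h | h
  · rw [min_eq_right (by linarith), max_eq_left h]
    nlinarith
  rcases le_total z 1 with h' | h'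
  · rw [min_eq_right h', max_eq_right h]
  · rw [min_eq_left h', max_eq_right zero_le_one]
    nlinarith

/-- The squared Euclidean distance of `y` to the indicator vector of `O`. -/
noncomputable def sqDist (O : Finset (Fin n)) (y : Fin n → ℝ) : ℝ :=
  ∑ u, (y u - if u ∈ O then 1 else 0) ^ 2

theorem sqDist_clip_le (O : Finset (Fin n)) (y z : Fin n → ℝ) (c : ℝ) :
    sqDist O (fun u => clip (y u + c * z u)) ≤
      sqDist O y - 2 * c * ∑ u, z u * ((if u ∈ O then 1 else 0) - y u) +
        c ^ 2 * ∑ u, z u ^ 2 := by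
  unfold sqDist
  rw [Finset.mul_sum, Finset.mul_sum, ← Finset.sum_sub_distrib, ← Finset.sum_add_distrib]
  refine Finset.sum_le_sum fun u _ => ?_
  refine (clip_sub_sq_le (by split_ifs <;> norm_num) (by split_ifs <;> norm_num) _).trans_eq ?_
  ring

/-- As `1_O` lies on the other side of the hyperplane `⟨p, y⟩ = B`, the projection onto it brings
`y` closer to `1_O` by the squared distance to the hyperplane, which is at least
`(B / n²)² / (n B²)`. -/
theorem sqDist_repair_le {p : Fin n → ℝ} {B : ℝ} (hp : ∀ u, 0 ≤ p u) (hpB : ∀ u, p u ≤ B)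
    {O : Finset (Fin n)} (hO : ∑ u ∈ O, p u ≤ B) {y : Fin n → ℝ}
    (hn : 0 < n) (hB : 0 < B) (hy : B * (1 + 1 / n ^ 2) < ∑ u, p u * y u) :
    sqDist O (repair p B y) ≤ sqDist O y - 1 / n ^ 5 := by
  have hn' : (0 : ℝ) < n := by exact_mod_cast hn
  set d := ∑ u, p u * y u - B with hd
  set Q := ∑ u, p u ^ 2 with hQ
  have hdB : B / n ^ 2 < d := by
    rw [hd]
    have : B * (1 + 1 / n ^ 2) = B + B / n ^ 2 := by ring
    linarith
  have hd0 : 0 < d := lt_trans (by positivity) hdB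
  have hQB : Q ≤ n * B ^ 2 := by
    have : ∀ u ∈ (Finset.univ : Finset (Fin n)), p u ^ 2 ≤ B ^ 2 := fun u _ =>
      pow_le_pow_left₀ (hp u) (hpB u) 2
    simpa using Finset.sum_le_card_nsmul _ _ _ this
  have hQ0 : 0 < Q := by
    refine lt_of_le_of_ne (Finset.sum_nonneg fun u _ => sq_nonneg _) fun h => ?_
    have h1 : ∀ u, p u = 0 := fun u => by
      have := (Finset.sum_eq_zero_iff_of_nonneg fun u _ => sq_nonneg (p u)).1 h.symm u
        (Finset.mem_univ u)
      simpa using this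
    simp only [hd, h1, zero_mul, Finset.sum_const_zero] at hd0
    linarith
  have h1 := sqDist_clip_le O y p (-(d / Q))
  have e1 : (fun u => clip (y u + -(d / Q) * p u)) = repair p B y := by
    funext u; simp only [repair]; congr 1; ring
  have e2 : ∑ u, p u * ((if u ∈ O then 1 else 0) - y u) = ∑ u ∈ O, p u - ∑ u, p u * y u := by
    simp only [mul_sub, Finset.sum_sub_distrib, mul_ite, mul_one, mul_zero]
    rw [Finset.sum_ite_mem, Finset.univ_inter]
  rw [e1, e2] at h1
  have h2 : 2 * (d / Q) * (∑ u ∈ O, p u - ∑ u, p u * y u) ≤ 2 * (d / Q) * (-d) :=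
    mul_le_mul_of_nonneg_left (by rw [hd]; linarith) (by positivity)
  have h3 : (d / Q) ^ 2 * Q = d / Q * d := by field_simp
  have h4 : 1 / (n : ℝ) ^ 5 ≤ d / Q * d := by
    have h5 : (B / n ^ 2) ^ 2 ≤ d ^ 2 := pow_le_pow_left₀ (by positivity) hdB.le 2
    calc 1 / (n : ℝ) ^ 5 = (B / n ^ 2) ^ 2 / (n * B ^ 2) := by field_simp
      _ ≤ d ^ 2 / Q := div_le_div₀ (sq_nonneg d) h5 hQ0 hQB
      _ = d / Q * d := by ring
  linarith

section Estimate

variable {σ : Scheme} {ε W α β : ℝ} {f : Finset (Fin n) → ℝ} {M : ℝ}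

theorem Scheme.Valid.estimate_mem (hσ : σ.Valid ε W α β) (hmon : Monotone f)
    (hsub : IsSubmodular f) (h0 : ∀ S, 0 ≤ f S) (hM : ∀ u, f {u} ≤ M) (hM0 : 0 ≤ M)
    {y : Fin n → ℝ} (hy : InCube y) (θ : Fin n → ℝ) (u : Fin n) :
    0 ≤ σ.estimate f θ y u ∧ σ.estimate f θ y u ≤ W * M := by
  constructor
  · exact Finset.sum_nonneg fun j hj => mul_nonneg
      (hσ.weight_nonneg j (Finset.mem_range.1 hj) _ (hy u).1 (hy u).2) (marginal_nonneg hmon u _)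
  · refine le_trans (Finset.sum_le_sum fun j hj => mul_le_mul_of_nonneg_left
      (hsub.marginal_le h0 hM u _)
      (hσ.weight_nonneg j (Finset.mem_range.1 hj) _ (hy u).1 (hy u).2)) ?_
    rw [← Finset.sum_mul]
    exact mul_le_mul_of_nonneg_right (hσ.sum_weight_le _ (hy u).1 (hy u).2) hM0

theorem Scheme.Valid.sqDist_ascend_le (hσ : σ.Valid ε W α β) (hmon : Monotone f)
    (hsub : IsSubmodular f) (h0 : ∀ S, 0 ≤ f S) (hM : ∀ u, f {u} ≤ M) (hM0 : 0 < M) (hn : 0 < n)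
    {y : Fin n → ℝ} (hy : InCube y) (θ : Fin n → ℝ) (O : Finset (Fin n)) :
    n ^ 6 * M * sqDist O (ascend σ f M θ y) ≤ n ^ 6 * M * sqDist O y -
      ∑ u, σ.estimate f θ y u * ((if u ∈ O then 1 else 0) - y u) + M * (W ^ 2 / n ^ 5) := by
  have hn' : (0 : ℝ) < n := by exact_mod_cast hn
  have h1 := sqDist_clip_le O y (σ.estimate f θ y) (1 / (2 * n ^ 6 * M))
  have e1 : (fun u => clip (y u + 1 / (2 * n ^ 6 * M) * σ.estimate f θ y u)) =
      ascend σ f M θ y := by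
    funext u; simp only [ascend]; congr 1; ring
  rw [e1] at h1
  have h2 : ∑ u, σ.estimate f θ y u ^ 2 ≤ n * (W * M) ^ 2 := by
    have : ∀ u ∈ (Finset.univ : Finset (Fin n)), σ.estimate f θ y u ^ 2 ≤ (W * M) ^ 2 :=
      fun u _ => by
        have h := hσ.estimate_mem hmon hsub h0 hM hM0.le hy θ u
        exact pow_le_pow_left₀ h.1 h.2 2
    simpa using Finset.sum_le_card_nsmul _ _ _ this
  have h3 : (1 / (2 * n ^ 6 * M)) ^ 2 * ∑ u, σ.estimate f θ y u ^ 2 ≤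
      (1 / (2 * n ^ 6 * M)) ^ 2 * (n * (W * M) ^ 2) :=
    mul_le_mul_of_nonneg_left h2 (sq_nonneg _)
  have h4 : (0 : ℝ) ≤ n ^ 6 * M := by positivity
  have h5 := mul_le_mul_of_nonneg_left (h1.trans (add_le_add le_rfl h3)) h4
  refine h5.trans (le_of_sub_nonneg ?_)
  have h6 : n ^ 6 * M * sqDist O y -
      ∑ u, σ.estimate f θ y u * ((if u ∈ O then 1 else 0) - y u) + M * (W ^ 2 / n ^ 5) -
      n ^ 6 * M * (sqDist O y - 2 * (1 / (2 * n ^ 6 * M)) *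
        ∑ u, σ.estimate f θ y u * ((if u ∈ O then 1 else 0) - y u) +
        (1 / (2 * n ^ 6 * M)) ^ 2 * (n * (W * M) ^ 2)) = 3 / 4 * (M * (W ^ 2 / n ^ 5)) := by
    field_simp
    ring
  rw [h6]
  positivity

open scoped BigOperators

/-- The estimate is unbiased, up to the precision of the thresholds. -/
theorem Scheme.Valid.abs_expect_estimate_sub_le (hσ : σ.Valid ε W α β) (hmon : Monotone f)
    (hsub : IsSubmodular f) (h0 : ∀ S, 0 ≤ f S) (hM : ∀ u, f {u} ≤ M) (hM0 : 0 ≤ M)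
    {y : Fin n → ℝ} (hy : InCube y) (b : ℕ) (u : Fin n) :
    |(𝔼 v : Fin n × Fin b → Bool, σ.estimate f (fun w => dyadic b fun i => v (w, i)) y u) -
      σ.field f y u| ≤ W * (M * (n * (1 / 2) ^ b)) := by
  unfold Scheme.estimate Scheme.field
  rw [Finset.expect_sum_comm, ← Finset.sum_sub_distrib]
  refine (Finset.abs_sum_le_sum_abs _ _).trans ?_
  have key : ∀ j ∈ Finset.range σ.rounds,
      |(𝔼 v : Fin n × Fin b → Bool, σ.weight j (y u) * marginal f u
        (thresholdSet (fun w => dyadic b fun i => v (w, i)) fun v => σ.point j (y v))) -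
        σ.weight j (y u) * partialDeriv f u fun v => σ.point j (y v)| ≤
      σ.weight j (y u) * (M * (n * (1 / 2) ^ b)) := by
    intro j hj
    have hw := hσ.weight_nonneg j (Finset.mem_range.1 hj) _ (hy u).1 (hy u).2
    rw [← Finset.mul_expect, ← mul_sub, abs_mul, abs_of_nonneg hw]
    refine mul_le_mul_of_nonneg_left ?_ hw
    exact abs_expect_threshold_sub_le b (marginal_nonneg hmon u) (hsub.marginal_le h0 hM u)
      fun v => hσ.point_mem j (Finset.mem_range.1 hj) _ (hy v).1 (hy v).2
  refine (Finset.sum_le_sum key).trans ?_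
  rw [← Finset.sum_mul]
  exact mul_le_mul_of_nonneg_right (hσ.sum_weight_le _ (hy u).1 (hy u).2) (by positivity)

/-- A step in the direction of the estimated field changes the scaled squared distance to `1_O` by
the inner product of the field with `1_O - y`, up to small errors. -/
theorem Scheme.Valid.le_expect_sqDist_ascend (hσ : σ.Valid ε W α β) (hmon : Monotone f)
    (hsub : IsSubmodular f) (h0 : ∀ S, 0 ≤ f S) (hM : ∀ u, f {u} ≤ M) (hM0 : 0 < M) (hn : 0 < n)
    {y : Fin n → ℝ} (hy : InCube y) (O : Finset (Fin n)) :
    -(n ^ 6 * M * sqDist O y) + ∑ u, σ.field f y u * ((if u ∈ O then 1 else 0) - y u) -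
      M * (W ^ 2 / n ^ 5 + n * (W * (n * (1 / 2) ^ n))) ≤
    𝔼 v : Fin n × Fin n → Bool,
      -(n ^ 6 * M * sqDist O (ascend σ f M (fun w => dyadic n fun i => v (w, i)) y)) := by
  have h1 : ∀ v ∈ (Finset.univ : Finset (Fin n × Fin n → Bool)),
      (-(n ^ 6 * M * sqDist O y) - M * (W ^ 2 / n ^ 5)) +
        ∑ u, σ.estimate f (fun w => dyadic n fun i => v (w, i)) y u *
          ((if u ∈ O then 1 else 0) - y u) ≤
      -(n ^ 6 * M * sqDist O (ascend σ f M (fun w => dyadic n fun i => v (w, i)) y)) :=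
    fun v _ => by
      have := hσ.sqDist_ascend_le hmon hsub h0 hM hM0 hn hy (fun w => dyadic n fun i => v (w, i)) O
      linarith
  refine le_trans ?_ (Finset.expect_le_expect h1)
  rw [Finset.expect_add_distrib, Fintype.expect_const, Finset.expect_sum_comm]
  have h2 : ∑ u, (σ.field f y u * ((if u ∈ O then 1 else 0) - y u) -
      W * (M * (n * (1 / 2) ^ n))) ≤
      ∑ u, 𝔼 v : Fin n × Fin n → Bool, σ.estimate f (fun w => dyadic n fun i => v (w, i)) y u *
          ((if u ∈ O then 1 else 0) - y u) := by
    refine Finset.sum_le_sum fun u _ => ?_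
    rw [← Finset.expect_mul]
    have h3 := hσ.abs_expect_estimate_sub_le hmon hsub h0 hM hM0.le hy n u
    set E := 𝔼 v : Fin n × Fin n → Bool, σ.estimate f (fun w => dyadic n fun i => v (w, i)) y u
    have h4 : |(if u ∈ O then (1 : ℝ) else 0) - y u| ≤ 1 := by
      have := hy u
      rw [abs_le]
      split_ifs <;> constructor <;> linarith
    have h5 := abs_mul (E - σ.field f y u) ((if u ∈ O then (1 : ℝ) else 0) - y u)
    have h6 := mul_le_of_le_one_right (abs_nonneg (E - σ.field f y u)) h4
    have h7 := neg_abs_le ((E - σ.field f y u) * ((if u ∈ O then (1 : ℝ) else 0) - y u))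
    linarith
  rw [Finset.sum_sub_distrib, Finset.sum_const, Finset.card_univ, Fintype.card_fin,
    nsmul_eq_mul] at h2
  linarith

/-- If a current value `a` is replaced by `b` with probability about `1 / (k + 1)`, then the
value, multiplied by the number of iterations, grows by almost `b`. -/
theorem le_expect_replace {k : ℕ} {a b c : ℝ} (ha : 0 ≤ a) (hac : a ≤ c) (hb : 0 ≤ b)
    (hbc : b ≤ c) (d : ℕ) :
    k * a + b - (k + 1) * (1 / 2) ^ d * c ≤
      𝔼 w : Fin d → Bool, (k + 1) * if dyadic d w < 1 / (k + 1) then b else a := by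
  have h1 : ∀ w : Fin d → Bool, ((k : ℝ) + 1) * (if dyadic d w < 1 / (k + 1) then b else a) =
      (k + 1) * a + (k + 1) * (b - a) * (if dyadic d w < 1 / (k + 1) then (1 : ℝ) else 0) :=
    fun w => by split_ifs <;> ring
  rw [Finset.expect_congr rfl fun w _ => h1 w, Finset.expect_add_distrib, Fintype.expect_const,
    ← Finset.mul_expect]
  have hk : (0 : ℝ) < k + 1 := by positivity
  have h2 := abs_dyadicCdf_sub_le d (z := 1 / (k + 1)) (by positivity)
    ((div_le_one hk).2 (by linarith [(Nat.cast_nonneg k : (0 : ℝ) ≤ k)]))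
  change _ ≤ _ + _ * dyadicCdf d (1 / (k + 1))
  set C := dyadicCdf d (1 / (k + 1))
  have h3 : |b - a| ≤ c := by rw [abs_le]; constructor <;> linarith
  have h4 : |(b - a) * (C - 1 / (k + 1))| ≤ c * (1 / 2) ^ d := by
    rw [abs_mul]
    exact mul_le_mul h3 h2 (abs_nonneg _) (ha.trans hac)
  have h5 := (abs_le.1 h4).1
  have h6 := mul_le_mul_of_nonneg_left h5 hk.le
  have h7 : ((k : ℝ) + 1) * ((b - a) * (C - 1 / (k + 1))) = (k + 1) * (b - a) * C - (b - a) := by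
    field_simp
  linarith

end Estimate


/-! ### Expected value of the output of the ascent method -/

section Trajectory

variable {σ : Scheme} {ε W α β : ℝ} {f : Finset (Fin n) → ℝ} {p : Fin n → ℝ} {B M : ℝ}

/-- The tape that carries the bits `ω`. -/
def tapeOf {m : ℕ} (ω : Fin m → Bool) (i : ℕ) : Bool := if h : i < m then ω ⟨i, h⟩ else false

/-- Only the first `k (n + 1) n` bits influence the first `k` iterations. -/
theorem trajectory_congr {τ τ' : ℕ → Bool} {k : ℕ}
    (h : ∀ i < k * (n + 1) * n, τ i = τ' i) :
    trajectory σ f p B M τ k = trajectory σ f p B M τ' k := by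
  induction k with
  | zero => rfl
  | succ k ih =>
    have h1 : ∀ u ≤ n, threshold n τ k u = threshold n τ' k u := fun u hu => by
      unfold threshold
      congr 1
      funext i
      refine h _ ?_
      calc (k * (n + 1) + u) * n + i < (k * (n + 1) + u) * n + n := by omega
        _ = (k * (n + 1) + (u + 1)) * n := by ring
        _ ≤ (k * (n + 1) + (n + 1)) * n := by gcongr
        _ = (k + 1) * (n + 1) * n := by ring
    have h2 := ih fun i hi => h i (hi.trans_le (by gcongr; omega))
    have h3 : (fun u : Fin n => threshold n τ k u) = fun u : Fin n => threshold n τ' k u :=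
      funext fun u => h1 u u.2.le
    simp only [trajectory]
    rw [h2, h3, h1 n le_rfl]

theorem trajectory_fst_mem (τ : ℕ → Bool) (k : ℕ) :
    InCube (trajectory σ f p B M τ k).1 := by
  cases k with
  | zero => exact fun _ => ⟨le_rfl, zero_le_one⟩
  | succ k =>
    simp only [trajectory, ascentStep]
    split_ifs <;> exact fun _ => clip_mem _

theorem trajectory_snd (τ : ℕ → Bool) (k : ℕ) :
    (trajectory σ f p B M τ k).2 = (fun _ => 0) ∨ ∃ y, InCube y ∧
      ∑ u, p u * y u ≤ B * (1 + 1 / n ^ 2) ∧ (trajectory σ f p B M τ k).2 = σ.solution y := by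
  induction k with
  | zero => exact Or.inl rfl
  | succ k ih =>
    simp only [trajectory, ascentStep]
    split_ifs with h1 h2
    · exact Or.inr ⟨_, trajectory_fst_mem τ k, h1, rfl⟩
    · exact ih
    · exact ih

theorem scale_mem {y : Fin n → ℝ} (hy : InCube y) (u : Fin n) :
    0 ≤ y u / (1 + 1 / (n : ℝ) ^ 2) ∧ y u / (1 + 1 / (n : ℝ) ^ 2) ≤ 1 := by
  have h1 : (0 : ℝ) ≤ 1 / (n : ℝ) ^ 2 := by positivity
  refine ⟨div_nonneg (hy u).1 (by linarith), div_le_one_of_le₀ ?_ (by linarith)⟩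
  linarith [(hy u).2]

theorem Scheme.Valid.solution_mem (hσ : σ.Valid ε W α β) (hε : 0 ≤ ε) {y : Fin n → ℝ}
    (hy : InCube y) : InCube (σ.solution y) := fun u =>
  ⟨hσ.out_nonneg _ (scale_mem hy u).1 (scale_mem hy u).2,
    (hσ.out_le _ (scale_mem hy u).1 (scale_mem hy u).2).trans (by linarith)⟩

theorem Scheme.Valid.trajectory_snd_mem (hσ : σ.Valid ε W α β) (hε : 0 ≤ ε) (τ : ℕ → Bool)
    (k : ℕ) : InCube (trajectory σ f p B M τ k).2 := by
  rcases trajectory_snd (σ := σ) (f := f) (p := p) (B := B) (M := M) τ k with h | ⟨y, hy, _, h⟩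
  · rw [h]; exact fun _ => ⟨le_rfl, zero_le_one⟩
  · rw [h]; exact hσ.solution_mem hε hy

/-- Scaling down by a factor of `1 + 1/n²` costs little. -/
theorem Scheme.Valid.le_multilinearExt_solution (hσ : σ.Valid ε W α β) (hε : 0 ≤ ε)
    (hmon : Monotone f) (hsub : IsSubmodular f) (h0 : ∀ S, 0 ≤ f S) (hM : ∀ u, f {u} ≤ M)
    (hn : 0 < n) {y : Fin n → ℝ} (hy : InCube y) :
    multilinearExt f (fun u => σ.out (y u)) - M * (1 / n) ≤ multilinearExt f (σ.solution y) := by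
  have hn' : (0 : ℝ) < n := by exact_mod_cast hn
  set a : ℝ := (1 + 1 / (n : ℝ) ^ 2)⁻¹ with ha
  have h1 : (0 : ℝ) < 1 / (n : ℝ) ^ 2 := by positivity
  have ha0 : 0 ≤ a := by positivity
  have ha1 : a ≤ 1 := inv_le_one_of_one_le₀ (by linarith)
  have hout : InCube fun u => σ.out (y u) := fun u =>
    ⟨hσ.out_nonneg _ (hy u).1 (hy u).2, (hσ.out_le _ (hy u).1 (hy u).2).trans (by linarith)⟩
  have haout : InCube fun u => a * σ.out (y u) := fun u =>
    ⟨mul_nonneg ha0 (hout u).1, mul_le_one₀ ha1 (hout u).1 (hout u).2⟩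
  have h2 := hsub.mul_multilinearExt_le h0 hout ha0 ha1
  have h3 : multilinearExt f (fun u => a * σ.out (y u)) ≤ multilinearExt f (σ.solution y) := by
    refine multilinearExt_le_of_le hmon haout (hσ.solution_mem hε hy) fun u => ?_
    have := hσ.mul_out_le a (y u) ha0 ha1 (hy u).1 (hy u).2
    have e : a * y u = y u / (1 + 1 / (n : ℝ) ^ 2) := by rw [ha, inv_mul_eq_div]
    rw [e] at this
    exact this
  have h4 : multilinearExt f (fun u => σ.out (y u)) ≤ n * M :=
    multilinearExt_le (fun S => hsub.le_card_mul hmon h0 hM hn S) hout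
  have h5 := multilinearExt_nonneg h0 hout
  have h6 : 1 - a ≤ 1 / (n : ℝ) ^ 2 := by
    have : a * (1 + 1 / (n : ℝ) ^ 2) = 1 := by
      rw [ha]; exact inv_mul_cancel₀ (by positivity)
    nlinarith
  have h7 : (1 - a) * multilinearExt f (fun u => σ.out (y u)) ≤ 1 / (n : ℝ) ^ 2 * (n * M) :=
    mul_le_mul h6 h4 h5 (by positivity)
  have h8 : 1 / (n : ℝ) ^ 2 * (n * M) = M * (1 / n) := by field_simp
  linarith

open scoped BigOperators

/-- The error per iteration, in units of the largest value of a singleton. -/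
noncomputable def stepError (n : ℕ) (W β : ℝ) : ℝ :=
  n * β + 1 / n + n ^ 9 * (1 / 2) ^ n + n ^ 2 * W * (1 / 2) ^ n + W ^ 2 / n ^ 5

/-- The potential: the value of the output, weighted by the number of iterations, minus the scaled
squared distance of the current point to the comparison set. -/
noncomputable def potential (f : Finset (Fin n) → ℝ) (M : ℝ) (O : Finset (Fin n)) (k : ℕ)
    (s : (Fin n → ℝ) × (Fin n → ℝ)) : ℝ :=
  k * multilinearExt f s.2 - n ^ 6 * M * sqDist O s.1

/-- In expectation over the thresholds of one iteration, the potential grows by almost `α f(O)`.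
The new output depends on the last threshold only and the new point on the others only, so that
the two parts of the potential are averaged separately, with `0` for the thresholds that do not
matter. -/
theorem Scheme.Valid.potential_step (hσ : σ.Valid ε W α β) (hε : 0 ≤ ε) (hα : α ≤ 1)
    (hW : 0 ≤ W) (hβ : 0 ≤ β) (hmon : Monotone f) (hsub : IsSubmodular f) (h0 : ∀ S, 0 ≤ f S)
    (hM : ∀ u, f {u} ≤ M) (hM0 : 0 < M) (hn : 0 < n) (hp : ∀ u, 0 ≤ p u) (hpB : ∀ u, p u ≤ B)
    (hB : 0 < B) {O : Finset (Fin n)} (hO : ∑ u ∈ O, p u ≤ B) {k : ℕ} (hk : k < n ^ 8)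
    {s : (Fin n → ℝ) × (Fin n → ℝ)} (h1 : InCube s.1) (h2 : InCube s.2) :
    potential f M O k s + (α * f O - M * stepError n W β) ≤
      (𝔼 w : Fin n → Bool, ((k + 1 : ℕ) : ℝ) * multilinearExt f
        (ascentStep σ f p B M k (fun _ => 0) (dyadic n w) s).2) +
      𝔼 v : Fin n × Fin n → Bool, -(n ^ 6 * M * sqDist O
        (ascentStep σ f p B M k (fun u => dyadic n fun i => v (u, i)) 0 s).1) := by
  have hn' : (0 : ℝ) < n := by exact_mod_cast hn
  have hval : ∀ x : Fin n → ℝ, InCube x → multilinearExt f x ≤ n * M := fun x hx =>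
    multilinearExt_le (fun S => hsub.le_card_mul hmon h0 hM hn S) hx
  have hE : 0 ≤ stepError n W β := by unfold stepError; positivity
  by_cases hfeas : ∑ u, p u * s.1 u ≤ B * (1 + 1 / n ^ 2)
  · simp only [ascentStep, if_pos hfeas]
    have e1 : ∀ w : Fin n → Bool, ((k + 1 : ℕ) : ℝ) * multilinearExt f
        (if dyadic n w < 1 / (k + 1) then σ.solution s.1 else s.2) =
        (k + 1) * if dyadic n w < 1 / (k + 1) then multilinearExt f (σ.solution s.1)
          else multilinearExt f s.2 := fun w => by
      push_cast
      split_ifs <;> rfl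
    rw [Finset.expect_congr rfl fun w _ => e1 w]
    have hsol := hσ.solution_mem hε h1
    have h3 := le_expect_replace (k := k) (multilinearExt_nonneg h0 h2) (hval _ h2)
      (multilinearExt_nonneg h0 hsol) (hval _ hsol) n
    have h4 := hσ.le_expect_sqDist_ascend hmon hsub h0 hM hM0 hn h1 O
    have h5 := hσ.inequality n f M h0 hmon hsub hM s.1 h1 O
    have h6 := hσ.le_multilinearExt_solution hε hmon hsub h0 hM hn h1
    have h7 : ((k : ℝ) + 1) * (1 / 2) ^ n * (n * M) ≤ M * (n ^ 9 * (1 / 2) ^ n) := by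
      have : ((k : ℝ) + 1) ≤ n ^ 8 := by exact_mod_cast hk
      calc ((k : ℝ) + 1) * (1 / 2) ^ n * (n * M) ≤ n ^ 8 * (1 / 2) ^ n * (n * M) := by gcongr
        _ = M * (n ^ 9 * (1 / 2) ^ n) := by ring
    have h8 : M * stepError n W β = n * M * β + M * (1 / n) + M * (n ^ 9 * (1 / 2) ^ n) +
        M * (W ^ 2 / n ^ 5 + n * (W * (n * (1 / 2) ^ n))) := by
      unfold stepError; ring
    unfold potential
    rw [h8]
    linarith
  · -- A repair gains `n⁶ M / n⁵ = n M`, which is at least `f O`.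
    simp only [ascentStep, if_neg hfeas, Fintype.expect_const]
    have h3 := sqDist_repair_le hp hpB hO hn hB (not_le.1 hfeas)
    have h4 := mul_le_mul_of_nonneg_left h3 (by positivity : (0 : ℝ) ≤ n ^ 6 * M)
    have h5 : (n : ℝ) ^ 6 * M * (1 / n ^ 5) = n * M := by field_simp
    have h6 := hsub.le_card_mul hmon h0 hM hn O
    have h7 := mul_le_of_le_one_left (h0 O) hα
    have h8 := mul_nonneg hM0.le hE
    have h9 := multilinearExt_nonneg h0 h2
    unfold potential
    push_cast
    linarith

/-- The bits read in iteration `k` are independent of the state before it, so that the bound for a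
fixed state holds on average over all bits. -/
theorem Scheme.Valid.expect_potential_step (hσ : σ.Valid ε W α β) (hε : 0 ≤ ε) (hα : α ≤ 1)
    (hW : 0 ≤ W) (hβ : 0 ≤ β) (hmon : Monotone f) (hsub : IsSubmodular f) (h0 : ∀ S, 0 ≤ f S)
    (hM : ∀ u, f {u} ≤ M) (hM0 : 0 < M) (hn : 0 < n) (hp : ∀ u, 0 ≤ p u) (hpB : ∀ u, p u ≤ B)
    (hB : 0 < B) {O : Finset (Fin n)} (hO : ∑ u ∈ O, p u ≤ B) {k : ℕ} (hk : k < n ^ 8)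
    {m : ℕ} (hm : (k + 1) * (n + 1) * n ≤ m) :
    (𝔼 ω : Fin m → Bool, potential f M O k (trajectory σ f p B M (tapeOf ω) k)) +
        (α * f O - M * stepError n W β) ≤
      𝔼 ω : Fin m → Bool, potential f M O (k + 1) (trajectory σ f p B M (tapeOf ω) (k + 1)) := by
  have hpos : ∀ u ≤ n, ∀ i : Fin n, (k * (n + 1) + u) * n + i < m := fun u hu i => by
    refine lt_of_lt_of_le ?_ hm
    calc (k * (n + 1) + u) * n + i < (k * (n + 1) + u) * n + n := by omega
      _ = (k * (n + 1) + (u + 1)) * n := by ring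
      _ ≤ (k * (n + 1) + (n + 1)) * n := by gcongr
      _ = (k + 1) * (n + 1) * n := by ring
  let e₁ : Fin n → Fin m := fun i => ⟨(k * (n + 1) + n) * n + i, hpos n le_rfl i⟩
  let e₂ : Fin n × Fin n → Fin m := fun q =>
    ⟨(k * (n + 1) + q.1) * n + q.2, hpos q.1 q.1.2.le q.2⟩
  have he₁ : Function.Injective e₁ := fun i j h => by
    have := congrArg Fin.val h
    simp only [e₁] at this
    exact Fin.ext (by omega)
  have he₂ : Function.Injective e₂ := fun q r h => by
    have h1 := congrArg Fin.val h
    simp only [e₂] at h1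
    have h2 := congrArg (· / n) h1
    simp only [mul_comm _ n, Nat.mul_add_div hn, Nat.div_eq_of_lt q.2.2,
      Nat.div_eq_of_lt r.2.2] at h2
    have h3 : (q.1 : ℕ) = r.1 := by omega
    have h4 : (q.2 : ℕ) = r.2 := by rw [h3] at h1; omega
    exact Prod.ext (Fin.ext h3) (Fin.ext h4)
  set A : (Fin m → Bool) → (Fin n → ℝ) × (Fin n → ℝ) :=
    fun ω => trajectory σ f p B M (tapeOf ω) k with hA
  have hfix : ∀ {ι : Type} (e : ι → Fin m), (∀ j, k * (n + 1) * n ≤ e j) →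
      ∀ ω v, A (Function.extend e v ω) = A ω := by
    intro ι e he ω v
    refine trajectory_congr fun i hi => ?_
    unfold tapeOf
    split_ifs with him
    · refine Function.extend_apply' _ _ _ fun ⟨j, hj⟩ => ?_
      have := he j
      rw [hj] at this
      exact absurd hi (not_lt.2 this)
    · rfl
  have hge : ∀ u i : ℕ, k * (n + 1) * n ≤ (k * (n + 1) + u) * n + i := fun u i => by
    rw [add_mul, add_assoc]; exact Nat.le_add_right _ _
  have ht₁ : ∀ ω : Fin m → Bool, threshold n (tapeOf ω) k n = dyadic n (ω ∘ e₁) := fun ω => by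
    unfold threshold tapeOf
    congr 1
    funext i
    exact dif_pos (hpos n le_rfl i)
  have ht₂ : ∀ (ω : Fin m → Bool) (u : Fin n), threshold n (tapeOf ω) k u =
      dyadic n fun i => (ω ∘ e₂) (u, i) := fun ω u => by
    unfold threshold tapeOf
    congr 1
    funext i
    exact dif_pos (hpos u u.2.le i)
  have split : ∀ ω : Fin m → Bool,
      potential f M O (k + 1) (trajectory σ f p B M (tapeOf ω) (k + 1)) =
      ((k + 1 : ℕ) : ℝ) * multilinearExt f
        (ascentStep σ f p B M k (fun _ => 0) (dyadic n (ω ∘ e₁)) (A ω)).2 +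
      -(n ^ 6 * M * sqDist O
        (ascentStep σ f p B M k (fun u => dyadic n fun i => (ω ∘ e₂) (u, i)) 0 (A ω)).1) := by
    intro ω
    simp only [potential, trajectory, ht₁, ht₂, hA, sub_eq_add_neg]
    congr 1
    · simp only [ascentStep]
      split_ifs <;> rfl
    · simp only [ascentStep]
      split_ifs <;> rfl
  rw [Finset.expect_congr rfl fun ω _ => split ω, Finset.expect_add_distrib,
    expect_eq_of_independent he₁ A (hfix e₁ fun j => hge _ _) fun s w =>
      ((k + 1 : ℕ) : ℝ) * multilinearExt f
        (ascentStep σ f p B M k (fun _ => 0) (dyadic n w) s).2,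
    expect_eq_of_independent he₂ A (hfix e₂ fun j => hge _ _) fun s v =>
      -(n ^ 6 * M * sqDist O
        (ascentStep σ f p B M k (fun u => dyadic n fun i => v (u, i)) 0 s).1),
    ← Finset.expect_add_distrib,
    ← Fintype.expect_const (ι := Fin m → Bool) (α * f O - M * stepError n W β),
    ← Finset.expect_add_distrib]
  exact Finset.expect_le_expect fun ω _ => hσ.potential_step hε hα hW hβ hmon hsub h0 hM hM0 hn hp
    hpB hB hO hk (trajectory_fst_mem _ _) (hσ.trajectory_snd_mem hε _ _)

/-- The expected value of the output after `n⁸` iterations. -/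
theorem Scheme.Valid.le_expect_output (hσ : σ.Valid ε W α β) (hε : 0 ≤ ε) (hα : α ≤ 1)
    (hW : 0 ≤ W) (hβ : 0 ≤ β) (hmon : Monotone f) (hsub : IsSubmodular f) (h0 : ∀ S, 0 ≤ f S)
    (hM : ∀ u, f {u} ≤ M) (hM0 : 0 < M) (hn : 0 < n) (hp : ∀ u, 0 ≤ p u) (hpB : ∀ u, p u ≤ B)
    (hB : 0 < B) {O : Finset (Fin n)} (hO : ∑ u ∈ O, p u ≤ B) (hMO : M ≤ f O)
    {m : ℕ} (hm : n ^ 8 * (n + 1) * n ≤ m) :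
    (α - (stepError n W β + 1 / n)) * f O ≤ expect fun ω : Fin m → Bool =>
      multilinearExt f (trajectory σ f p B M (tapeOf ω) (n ^ 8)).2 := by
  have hn' : (0 : ℝ) < n := by exact_mod_cast hn
  have hE : 0 ≤ stepError n W β := by unfold stepError; positivity
  rw [expect_eq]
  have tele : ∀ k ≤ n ^ 8, -((n : ℝ) ^ 7 * M) + k * (α * f O - M * stepError n W β) ≤
      𝔼 ω : Fin m → Bool, potential f M O k (trajectory σ f p B M (tapeOf ω) k) := by
    intro k
    induction k with
    | zero =>
      intro _
      simp only [trajectory, Fintype.expect_const, potential]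
      have h1 : sqDist O (fun _ => (0 : ℝ)) ≤ n := by
        unfold sqDist
        have : ∀ u ∈ (Finset.univ : Finset (Fin n)),
            ((0 : ℝ) - if u ∈ O then 1 else 0) ^ 2 ≤ 1 := fun u _ => by split_ifs <;> norm_num
        simpa using Finset.sum_le_card_nsmul _ _ _ this
      have h2 := mul_le_mul_of_nonneg_left h1 (by positivity : (0 : ℝ) ≤ n ^ 6 * M)
      push_cast
      linarith
    | succ k ih =>
      intro hk
      have h1 := ih (by omega)
      have h2 := hσ.expect_potential_step hε hα hW hβ hmon hsub h0 hM hM0 hn hp hpB hB hO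
        (k := k) (by omega) (m := m) (le_trans (by gcongr) hm)
      push_cast
      linarith
  have h1 := tele (n ^ 8) le_rfl
  have h2 : (𝔼 ω : Fin m → Bool,
      potential f M O (n ^ 8) (trajectory σ f p B M (tapeOf ω) (n ^ 8))) ≤
      𝔼 ω : Fin m → Bool, (n : ℝ) ^ 8 *
        multilinearExt f (trajectory σ f p B M (tapeOf ω) (n ^ 8)).2 := by
    refine Finset.expect_le_expect fun ω _ => ?_
    have : 0 ≤ (n : ℝ) ^ 6 * M * sqDist O (trajectory σ f p B M (tapeOf ω) (n ^ 8)).1 :=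
      mul_nonneg (by positivity) (Finset.sum_nonneg fun u _ => sq_nonneg _)
    unfold potential
    push_cast
    linarith
  rw [← Finset.mul_expect] at h2
  set R := 𝔼 ω : Fin m → Bool, multilinearExt f (trajectory σ f p B M (tapeOf ω) (n ^ 8)).2
  have h3 := h1.trans h2
  push_cast at h3
  have h4 : (n : ℝ) ^ 8 * (α * f O - M * stepError n W β - M * (1 / n)) ≤ n ^ 8 * R := by
    have : (n : ℝ) ^ 8 * (M * (1 / n)) = n ^ 7 * M := by field_simp
    linarith
  have h5 := le_of_mul_le_mul_left h4 (by positivity)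
  have h6 := mul_le_mul_of_nonneg_right hMO (add_nonneg hE (by positivity : (0 : ℝ) ≤ 1 / n))
  linarith

end Trajectory


/-! ### Choice of the parameters -/

theorem one_sub_one_div_mem (hn : 2 ≤ n) : 0 ≤ 1 - 1 / (n : ℝ) ∧ 1 - 1 / (n : ℝ) < 1 := by
  have hn' : (2 : ℝ) ≤ n := by exact_mod_cast hn
  have h1 : 1 / (n : ℝ) ≤ 1 / 2 := one_div_le_one_div_of_le two_pos hn'
  have h2 : 0 < 1 / (n : ℝ) := by positivity
  constructor <;> linarith

/-- The largest `K` with `(1 - 1/n)^K ≥ ε`. -/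
noncomputable def lowRounds (ε : ℝ) (n : ℕ) : ℕ :=
  sInf {K : ℕ | (1 - 1 / (n : ℝ)) ^ (K + 1) < ε}

/-- The smallest `i` with `i² ≥ ε n²`. -/
noncomputable def gridRoot (ε : ℝ) (n : ℕ) : ℕ := sInf {i : ℕ | ε * (n * n) ≤ (i : ℝ) * i}

theorem lowRounds_spec {ε : ℝ} (hε : 0 < ε) (hn : 2 ≤ n) :
    (1 - 1 / (n : ℝ)) ^ (lowRounds ε n + 1) < ε := by
  have h := one_sub_one_div_mem hn
  obtain ⟨K, hK⟩ := exists_pow_lt_of_lt_one hε h.2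
  refine Nat.sInf_mem (s := {K : ℕ | (1 - 1 / (n : ℝ)) ^ (K + 1) < ε}) ⟨K, ?_⟩
  exact lt_of_le_of_lt (pow_le_pow_of_le_one h.1 h.2.le (Nat.le_succ K)) hK

theorem le_of_lt_lowRounds {ε : ℝ} {j : ℕ} (hj : j < lowRounds ε n) :
    ε ≤ (1 - 1 / (n : ℝ)) ^ (j + 1) :=
  not_lt.1 (Nat.notMem_of_lt_sInf (s := {K : ℕ | (1 - 1 / (n : ℝ)) ^ (K + 1) < ε}) hj)

theorem le_pow_lowRounds {ε : ℝ} (hε₁ : ε ≤ 1) :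
    ε ≤ (1 - 1 / (n : ℝ)) ^ lowRounds ε n := by
  rcases h : lowRounds ε n with _ | j
  · simpa using hε₁
  · exact le_of_lt_lowRounds (h ▸ Nat.lt_succ_self j)

theorem le_exp_lowRounds {ε : ℝ} (hε₁ : ε ≤ 1) (hn : 2 ≤ n) :
    ε ≤ Real.exp (-(lowRounds ε n * (1 / n))) := by
  refine (le_pow_lowRounds (n := n) hε₁).trans ?_
  have h1 : 1 - 1 / (n : ℝ) ≤ Real.exp (-(1 / n)) := by
    have := Real.add_one_le_exp (-(1 / (n : ℝ))); linarith
  refine (pow_le_pow_left₀ (one_sub_one_div_mem hn).1 h1 _).trans_eq ?_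
  rw [← Real.exp_nat_mul]; ring_nf

theorem lowRounds_mul_le {ε : ℝ} (hε : 0 < ε) (hε₁ : ε ≤ 1) (hn : 2 ≤ n) :
    lowRounds ε n * (1 / (n : ℝ)) ≤ -Real.log ε := by
  have h := Real.log_le_log hε (le_exp_lowRounds hε₁ hn)
  rw [Real.log_exp] at h
  linarith

theorem exp_neg_le_inv_pow {h z : ℝ} (hh : 0 ≤ h) (hz : 0 ≤ z) (K : ℕ) :
    Real.exp (-(K * h * z)) ≤ ((1 + h * z) ^ K)⁻¹ := by
  rw [Real.exp_neg]
  have h1 : 0 < 1 + h * z := by have := mul_nonneg hh hz; linarith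
  refine inv_anti₀ (by positivity) ?_
  have h2 : 1 + h * z ≤ Real.exp (h * z) := by
    have := Real.add_one_le_exp (h * z); linarith
  refine (pow_le_pow_left₀ h1.le h2 K).trans_eq ?_
  rw [← Real.exp_nat_mul]; ring_nf

theorem le_inv_pow_lowRounds {ε : ℝ} (hε₁ : ε ≤ 1) (hn : 2 ≤ n) :
    ε ≤ ((1 + 1 / (n : ℝ)) ^ lowRounds ε n)⁻¹ := by
  refine (le_exp_lowRounds hε₁ hn).trans ?_
  have := exp_neg_le_inv_pow (h := 1 / (n : ℝ)) (by positivity) zero_le_one (lowRounds ε n)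
  simpa using this

/-- Since `(1 + h)(1 - h) = 1 - h²`, the powers `(1 + h)^{-K}` and `(1 - h)^K` differ little for
`h = 1/n`, and the latter is close to `ε`. -/
theorem inv_pow_lowRounds_le {ε : ℝ} (hε : 0 < ε) (hε₁ : ε ≤ 1) (hn : 2 ≤ n) :
    ((1 + 1 / (n : ℝ)) ^ lowRounds ε n)⁻¹ ≤ ε + (-Real.log ε + 2) / n := by
  have hn' : (2 : ℝ) ≤ n := by exact_mod_cast hn
  set h : ℝ := 1 / n with hh
  set K := lowRounds ε n with hK
  set w := ((1 + h) ^ K)⁻¹ with hw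
  have hh0 : 0 < h := by positivity
  have hh1 : h ≤ 1 / 2 := one_div_le_one_div_of_le two_pos hn'
  have hw01 := inv_pow_mem hh0.le zero_le_one K
  rw [mul_one, ← hw] at hw01
  have h1 : w * (1 - h ^ 2) ^ (K + 1) = (1 + h) * (1 - h) ^ (K + 1) := by
    have : (1 - h ^ 2) ^ (K + 1) = (1 + h) ^ K * (1 + h) * (1 - h) ^ (K + 1) := by
      rw [← pow_succ, ← mul_pow]; ring
    rw [this, hw]
    have h2 : (1 + h) ^ K ≠ 0 := by positivity
    field_simp
  have h2 : 1 - (K + 1 : ℕ) * h ^ 2 ≤ (1 - h ^ 2) ^ (K + 1) := by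
    have := one_add_mul_le_pow (a := -h ^ 2) (by nlinarith) (K + 1)
    rw [← sub_eq_add_neg] at this
    linarith
  have h3 : (1 + h) * (1 - h) ^ (K + 1) ≤ (1 + h) * ε :=
    mul_le_mul_of_nonneg_left (lowRounds_spec hε hn).le (by linarith)
  have h4 := mul_le_mul_of_nonneg_left h2 hw01.1
  have h5 := lowRounds_mul_le hε hε₁ hn
  have h6 : ((K + 1 : ℕ) : ℝ) * h ^ 2 ≤ (-Real.log ε + 1) * h := by
    push_cast
    have : (K : ℝ) * h * h ≤ -Real.log ε * h := mul_le_mul_of_nonneg_right h5 hh0.le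
    nlinarith
  have h7 : w * (((K + 1 : ℕ) : ℝ) * h ^ 2) ≤ (-Real.log ε + 1) * h :=
    (mul_le_of_le_one_left (by positivity) hw01.2).trans h6
  have h8 : h * ε ≤ h := mul_le_of_le_one_right hh0.le hε₁
  have h9 : (-Real.log ε + 2) / n = (-Real.log ε + 2) * h := by rw [hh]; ring
  rw [h9]
  linarith

theorem gridRoot_mem {ε : ℝ} (hε₁ : ε ≤ 1) :
    ε * (n * n) ≤ (gridRoot ε n : ℝ) * gridRoot ε n ∧ gridRoot ε n ≤ n := by
  have h : n ∈ {i : ℕ | ε * (n * n) ≤ (i : ℝ) * i} := by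
    have h0 : (0 : ℝ) ≤ (n : ℝ) * n := by positivity
    exact mul_le_of_le_one_left h0 hε₁
  exact ⟨Nat.sInf_mem ⟨n, h⟩, Nat.sInf_le h⟩

theorem lt_of_lt_gridRoot {ε : ℝ} {i : ℕ} (hi : i < gridRoot ε n) :
    (i : ℝ) * i < ε * (n * n) :=
  not_le.1 (Nat.notMem_of_lt_sInf (s := {i : ℕ | ε * (n * n) ≤ (i : ℝ) * i}) hi)

/-- An approximation of `√ε` from above. -/
noncomputable def approxSqrt (ε : ℝ) (n : ℕ) : ℝ := gridRoot ε n / n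

theorem approxSqrt_mem {ε : ℝ} (hε₁ : ε ≤ 1) (hn : 0 < n) :
    0 ≤ approxSqrt ε n ∧ approxSqrt ε n ≤ 1 ∧ ε ≤ approxSqrt ε n ^ 2 := by
  have hn' : (0 : ℝ) < n := by exact_mod_cast hn
  have h := gridRoot_mem (n := n) hε₁
  refine ⟨by unfold approxSqrt; positivity, ?_, ?_⟩
  · exact (div_le_one hn').2 (by exact_mod_cast h.2)
  · unfold approxSqrt
    rw [div_pow, le_div_iff₀ (by positivity)]
    calc ε * (n : ℝ) ^ 2 = ε * (n * n) := by ring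
      _ ≤ _ := h.1
      _ = _ := by ring

theorem approxSqrt_sq_le {ε : ℝ} (hε : 0 < ε) (hε₁ : ε ≤ 1) (hn : 0 < n) :
    approxSqrt ε n ^ 2 ≤ ε + 2 / n := by
  have hn' : (0 : ℝ) < n := by exact_mod_cast hn
  have h := approxSqrt_mem (n := n) hε₁ hn
  rcases hi : gridRoot ε n with _ | i
  · have : approxSqrt ε n = 0 := by simp [approxSqrt, hi]
    rw [this, zero_pow two_ne_zero]; positivity
  · have h1 := lt_of_lt_gridRoot (hi ▸ Nat.lt_succ_self i : i < gridRoot ε n)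
    have h2 : approxSqrt ε n = (i : ℝ) / n + 1 / n := by
      rw [approxSqrt, hi]; push_cast; ring
    have h3 : ((i : ℝ) / n) ^ 2 ≤ ε := by
      rw [div_pow, div_le_iff₀ (by positivity)]; nlinarith
    have h4 : approxSqrt ε n ^ 2 = ((i : ℝ) / n) ^ 2 + 2 / n * approxSqrt ε n - (1 / n) ^ 2 := by
      rw [h2]; ring
    have h5 : 2 / n * approxSqrt ε n ≤ 2 / n := mul_le_of_le_one_right (by positivity) h.2.1
    have h6 := sq_nonneg (1 / (n : ℝ))
    linarith

open Classical in
/-- The scheme used by the algorithm, depending on whether the density is at most one half. -/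
noncomputable def chosenScheme (ε : ℝ) (p : Fin n → ℝ) (B : ℝ) : Scheme :=
  if B + B ≤ ∑ u, p u then lowScheme (1 / n) (lowRounds ε n)
  else highScheme (approxSqrt ε n) (n * n)

theorem chosenScheme_valid {ε : ℝ} (hε : 0 < ε) (hε₁ : ε ≤ 1) (hn : 2 ≤ n) (p : Fin n → ℝ)
    (B : ℝ) : ∃ W α β, (chosenScheme ε p B).Valid ε W α β ∧ 0 ≤ W ∧ W ≤ -Real.log ε + 1 ∧
      1 - ε - (-Real.log ε + 2) / n ≤ α ∧ α ≤ 1 ∧ 0 ≤ β ∧ β ≤ 1 / (n : ℝ) ^ 2 := by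
  have hn' : (0 : ℝ) < n := by exact_mod_cast (by omega : 0 < n)
  have hlog : 0 ≤ -Real.log ε := neg_nonneg.2 (Real.log_nonpos hε.le hε₁)
  unfold chosenScheme
  split_ifs
  · refine ⟨_, _, _, lowScheme_valid (by positivity) (le_inv_pow_lowRounds hε₁ hn),
      by positivity, ?_, ?_, ?_, le_rfl, by positivity⟩
    · linarith [lowRounds_mul_le hε hε₁ hn]
    · linarith [inv_pow_lowRounds_le hε hε₁ hn]
    · have : 0 ≤ ((1 + 1 / (n : ℝ)) ^ lowRounds ε n)⁻¹ := by positivity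
      linarith
  · have h := approxSqrt_mem (n := n) hε₁ (by omega)
    refine ⟨_, _, _, highScheme_valid h.1 h.2.1 h.2.2
      (Nat.mul_pos (by omega) (by omega) : 0 < n * n), zero_le_one, by linarith, ?_, ?_,
      by positivity, ?_⟩
    · have h1 := approxSqrt_sq_le hε hε₁ (by omega : 0 < n)
      have h2 : 2 / (n : ℝ) ≤ (-Real.log ε + 2) / n := by gcongr; linarith
      linarith
    · linarith [sq_nonneg (approxSqrt ε n)]
    · push_cast; rw [sq]

/-! ### The budget -/

/-- The witnesses are `y₁ = 0` and `y₂ = x / ρ`. -/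
theorem isFeasibleUpTo_of_le {p : Fin n → ℝ} {B ε ρ : ℝ} (hB : 0 ≤ B) {x : Fin n → ℝ}
    (hε : 0 ≤ ε) (hρ : 1 - ε ≤ ρ) (hx : ∀ u, 0 ≤ x u ∧ x u ≤ 1 - ε)
    (hpx : ∑ u, p u * x u ≤ ρ * B) : IsFeasibleUpTo (knapsackPolytope p B) ρ x := by
  have hz : (fun _ => 0 : Fin n → ℝ) ∈ knapsackPolytope p B :=
    ⟨fun _ => ⟨le_rfl, zero_le_one⟩, by simpa using hB⟩
  refine ⟨fun u => ⟨(hx u).1, by linarith [(hx u).2]⟩, fun _ => 0, hz, ?_⟩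
  rcases le_or_gt ρ 0 with h | h
  · exact ⟨fun _ => 0, hz, fun u => ⟨(hx u).1, by linarith [(hx u).2]⟩⟩
  · refine ⟨fun u => x u / ρ, ⟨fun u => ⟨div_nonneg (hx u).1 h.le, ?_⟩, ?_⟩, fun u =>
      ⟨(hx u).1, (mul_div_cancel₀ _ h.ne').ge⟩⟩
    · exact div_le_one_of_le₀ ((hx u).2.trans hρ) h.le
    · have : ∑ u, p u * (x u / ρ) = (∑ u, p u * x u) / ρ := by
        rw [Finset.sum_div]; exact Finset.sum_congr rfl fun u _ => by ring
      rw [this, div_le_iff₀ h]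
      linarith

/-- For `c ≤ 1/2` this is the weighted inequality of arithmetic and geometric means, for `c ≥ 1/2`
it is `(1 - c)(1 - √ε)² ≥ 0`. -/
theorem one_sub_le_rho {c ε : ℝ} (hc : 0 < c) (hc1 : c ≤ 1) (hε : 0 < ε) :
    1 - ε ≤ rho c ε := by
  unfold rho
  split_ifs with h
  · rw [le_div_iff₀ hc]
    have h1 := Real.geom_mean_le_arith_mean2_weighted hc.le (sub_nonneg.2 hc1) hε.le zero_le_one
      (by ring)
    rw [Real.one_rpow] at h1
    linarith
  · rw [le_div_iff₀ hc]
    have h1 := mul_nonneg (sub_nonneg.2 hc1) (sq_nonneg (1 - √ε))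
    have h2 := Real.sq_sqrt hε.le
    nlinarith

/-- The convex function `t ↦ ε^t` lies above its tangent at the density `c`, and the tangent is
summed over the ground set. -/
theorem sum_low_le {p : Fin n → ℝ} {B ε : ℝ} (hp : ∀ u, 0 ≤ p u) (hS : 0 < ∑ u, p u)
    (hε : 0 < ε) (hε₁ : ε ≤ 1) (hn : 2 ≤ n) {y : Fin n → ℝ} (hy : InCube y)
    (hpy : ∑ u, p u * y u ≤ B) :
    ∑ u, p u * (1 - ((1 + 1 / (n : ℝ) * y u) ^ lowRounds ε n)⁻¹) ≤
      (1 - ε ^ (B / ∑ u, p u)) * ∑ u, p u := by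
  set c := B / ∑ u, p u with hc
  have hcS : c * ∑ u, p u = B := div_mul_cancel₀ _ hS.ne'
  have hlog : Real.log ε ≤ 0 := Real.log_nonpos hε.le hε₁
  have hpt : ∀ u, ε ^ c * (1 + Real.log ε * (y u - c)) ≤
      ((1 + 1 / (n : ℝ) * y u) ^ lowRounds ε n)⁻¹ := by
    intro u
    refine le_trans ?_ (exp_neg_le_inv_pow (by positivity) (hy u).1 _)
    have h1 : ε ^ c * (1 + Real.log ε * (y u - c)) ≤
        ε ^ c * Real.exp (Real.log ε * (y u - c)) := by
      refine mul_le_mul_of_nonneg_left ?_ (Real.rpow_nonneg hε.le c)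
      linarith [Real.add_one_le_exp (Real.log ε * (y u - c))]
    refine h1.trans ?_
    rw [Real.rpow_def_of_pos hε, ← Real.exp_add, Real.exp_le_exp]
    have h2 := mul_le_mul_of_nonneg_right (lowRounds_mul_le hε hε₁ hn) (hy u).1
    linarith
  have h1 : ∑ u, p u * (1 - ((1 + 1 / (n : ℝ) * y u) ^ lowRounds ε n)⁻¹) ≤
      ∑ u, p u * (1 - ε ^ c * (1 + Real.log ε * (y u - c))) :=
    Finset.sum_le_sum fun u _ => mul_le_mul_of_nonneg_left (by linarith [hpt u]) (hp u)
  have h2 : ∑ u, p u * (1 - ε ^ c * (1 + Real.log ε * (y u - c))) =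
      (1 - ε ^ c) * ∑ u, p u - ε ^ c * Real.log ε * (∑ u, p u * y u - c * ∑ u, p u) := by
    rw [Finset.mul_sum, Finset.mul_sum, ← Finset.sum_sub_distrib, Finset.mul_sum,
      ← Finset.sum_sub_distrib]
    exact Finset.sum_congr rfl fun u _ => by ring
  rw [h2, hcS] at h1
  have h3 : 0 ≤ ε ^ c * Real.log ε * (∑ u, p u * y u - B) :=
    mul_nonneg_of_nonpos_of_nonpos
      (mul_nonpos_of_nonneg_of_nonpos (Real.rpow_nonneg hε.le c) hlog) (by linarith)
  linarith

/-- The solution is affine in `y`, and the bound for its cost decreases in the parameter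
`s ≥ √ε`. -/
theorem sum_high_le {p : Fin n → ℝ} {B ε s : ℝ} (hS : 0 < ∑ u, p u)
    (hs : 0 ≤ s) (hs1 : s ≤ 1) (hεs : ε ≤ s ^ 2) (hB : ∑ u, p u ≤ 2 * B)
    (hBS : B ≤ ∑ u, p u) {y : Fin n → ℝ} (hpy : ∑ u, p u * y u ≤ B) :
    ∑ u, p u * ((1 - s) ^ 2 + 2 * s * (1 - s) * y u) ≤
      (1 - 2 * (1 - B / ∑ u, p u) * √ε - ε * (2 * (B / ∑ u, p u) - 1)) * ∑ u, p u := by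
  have h1 : ∑ u, p u * ((1 - s) ^ 2 + 2 * s * (1 - s) * y u) =
      (1 - s) ^ 2 * ∑ u, p u + 2 * s * (1 - s) * ∑ u, p u * y u := by
    rw [Finset.mul_sum, Finset.mul_sum, ← Finset.sum_add_distrib]
    exact Finset.sum_congr rfl fun u _ => by ring
  have h2 : 2 * s * (1 - s) * ∑ u, p u * y u ≤ 2 * s * (1 - s) * B :=
    mul_le_mul_of_nonneg_left hpy (mul_nonneg (by linarith) (sub_nonneg.2 hs1))
  set S := ∑ u, p u
  have h3 : (1 - 2 * (1 - B / S) * √ε - ε * (2 * (B / S) - 1)) * S =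
      S - 2 * (S - B) * √ε - ε * (2 * B - S) := by field_simp
  have h4 : √ε ≤ s := Real.sqrt_le_iff.2 ⟨hs, hεs⟩
  have h5 := mul_le_mul_of_nonneg_left h4 (sub_nonneg.2 hBS)
  have h6 := mul_le_mul_of_nonneg_right hεs (sub_nonneg.2 hB)
  rw [h1, h3]
  nlinarith

/-- Every solution produced by the algorithm is feasible up to the factor `ρ(c, ε)`. -/
theorem chosenScheme_feasible {p : Fin n → ℝ} {B ε : ℝ} (hε : 0 < ε) (hε₁ : ε ≤ 1) (hn : 2 ≤ n)
    (hp : ∀ u, 0 ≤ p u) (hB : 0 < B) (hBS : B < ∑ u, p u) {y : Fin n → ℝ} (hy : InCube y)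
    (hpy : ∑ u, p u * y u ≤ B * (1 + 1 / n ^ 2)) :
    IsFeasibleUpTo (knapsackPolytope p B) (rho (density p B) ε)
      ((chosenScheme ε p B).solution y) := by
  have hS := hB.trans hBS
  obtain ⟨W, α, β, hσ, -⟩ := chosenScheme_valid hε hε₁ hn p B
  have hc : 0 < density p B := div_pos hB hS
  have hc1 : density p B ≤ 1 := (div_le_one hS).2 hBS.le
  refine isFeasibleUpTo_of_le hB.le hε.le (one_sub_le_rho hc hc1 hε) (fun u =>
    ⟨hσ.out_nonneg _ (scale_mem hy u).1 (scale_mem hy u).2,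
      hσ.out_le _ (scale_mem hy u).1 (scale_mem hy u).2⟩) ?_
  have hd : (0 : ℝ) < 1 + 1 / (n : ℝ) ^ 2 := by positivity
  have hpy' : ∑ u, p u * (y u / (1 + 1 / (n : ℝ) ^ 2)) ≤ B := by
    have : ∑ u, p u * (y u / (1 + 1 / (n : ℝ) ^ 2)) = (∑ u, p u * y u) / (1 + 1 / n ^ 2) := by
      rw [Finset.sum_div]; exact Finset.sum_congr rfl fun u _ => by ring
    rw [this, div_le_iff₀ hd]
    exact hpy
  have hiff : B + B ≤ ∑ u, p u ↔ density p B ≤ 1 / 2 := by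
    rw [density, div_le_iff₀ hS]; constructor <;> intro h <;> linarith
  have hdB : B = density p B * ∑ u, p u := (div_mul_cancel₀ _ hS.ne').symm
  have key : ∀ X : ℝ, X * ∑ u, p u = X / density p B * B := fun X => by
    rw [div_mul_eq_mul_div, eq_div_iff hc.ne']
    linear_combination (-X) * hdB
  unfold Scheme.solution chosenScheme rho
  by_cases h : B + B ≤ ∑ u, p u
  · rw [if_pos h, if_pos (hiff.1 h)]
    have h1 := sum_low_le (y := fun u => y u / (1 + 1 / (n : ℝ) ^ 2)) hp hS hε hε₁ hn
      (fun u => scale_mem hy u) hpy'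
    refine h1.trans_eq ?_
    exact key _
  · rw [if_neg h, if_neg (fun h' => h (hiff.2 h'))]
    have h2 := approxSqrt_mem (n := n) hε₁ (by omega)
    have h1 := sum_high_le (y := fun u => y u / (1 + 1 / (n : ℝ) ^ 2)) hS h2.1 h2.2.1 h2.2.2
      (by linarith) hBS.le hpy'
    refine h1.trans_eq ?_
    exact key _

/-! ### The total error -/

/-- The total error of the algorithm. -/
noncomputable def totalError (ε : ℝ) (n : ℕ) : ℝ :=
  (-Real.log ε + 2) / n + (stepError n (-Real.log ε + 1) (1 / (n : ℝ) ^ 2) + 1 / n)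

theorem tendsto_totalError (ε : ℝ) :
    Filter.Tendsto (totalError ε) Filter.atTop (nhds 0) := by
  have h1 : Filter.Tendsto (fun n : ℕ => 1 / (n : ℝ)) Filter.atTop (nhds 0) :=
    tendsto_one_div_atTop_nhds_zero_nat
  have h2 : ∀ k : ℕ, Filter.Tendsto (fun n : ℕ => (n : ℝ) ^ k * (1 / 2) ^ n) Filter.atTop
      (nhds 0) := fun k =>
    tendsto_pow_const_mul_const_pow_of_abs_lt_one k (by rw [abs_of_pos] <;> norm_num)
  have h3 := (((((h1.const_mul (-Real.log ε + 2)).add ((h1.add h1).add (h2 9))).add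
    ((h2 2).const_mul (-Real.log ε + 1))).add ((h1.pow 5).const_mul ((-Real.log ε + 1) ^ 2))).add
    h1)
  simp only [mul_zero, add_zero, ne_eq, OfNat.ofNat_ne_zero, not_false_eq_true, zero_pow] at h3
  refine h3.congr' ?_
  filter_upwards [Filter.eventually_gt_atTop 0] with n hn
  have hn' : (n : ℝ) ≠ 0 := by exact_mod_cast hn.ne'
  unfold totalError stepError
  field_simp
  ring

theorem stepError_mono {W W' β β' : ℝ} (hW : 0 ≤ W) (hWW : W ≤ W') (hββ : β ≤ β') :
    stepError n W β ≤ stepError n W' β' := by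
  unfold stepError
  gcongr

/-- The algorithm with its parameters chosen attains the value `1 - ε - o(1)`. -/
theorem le_expect_chosenScheme {f : Finset (Fin n) → ℝ} {p : Fin n → ℝ} {B M ε : ℝ}
    (hε : 0 < ε) (hε₁ : ε ≤ 1) (hn : 2 ≤ n) (hmon : Monotone f) (hsub : IsSubmodular f)
    (h0 : ∀ S, 0 ≤ f S) (hM : ∀ u, f {u} ≤ M) (hM0 : 0 ≤ M) (hp : ∀ u, 0 ≤ p u)
    (hpB : ∀ u, p u ≤ B) (hB : 0 < B) {O : Finset (Fin n)} (hO : ∑ u ∈ O, p u ≤ B)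
    (hMO : M ≤ f O) {m : ℕ} (hm : n ^ 8 * (n + 1) * n ≤ m) :
    (1 - ε - totalError ε n) * f O ≤ expect fun ω : Fin m → Bool =>
      multilinearExt f (trajectory (chosenScheme ε p B) f p B M (tapeOf ω) (n ^ 8)).2 := by
  obtain ⟨W, α, β, hσ, hW, hW', hα, hα1, hβ, hβ'⟩ := chosenScheme_valid hε hε₁ hn p B
  -- If all singletons have value zero, so has every set.
  rcases hM0.eq_or_lt with h | h
  · have h1 : f O = 0 := by
      have h2 := hsub.le_card_mul hmon h0 hM (by omega) O
      rw [← h, mul_zero] at h2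
      exact le_antisymm h2 (h0 O)
    rw [h1, mul_zero, expect_eq]
    exact Finset.expect_nonneg fun ω _ => multilinearExt_nonneg h0 (hσ.trajectory_snd_mem hε.le _ _)
  · refine le_trans ?_ (hσ.le_expect_output hε.le hα1 hW hβ hmon hsub h0 hM h (by omega) hp hpB hB
      hO hMO hm)
    refine mul_le_mul_of_nonneg_right ?_ (h0 O)
    have := stepError_mono (n := n) hW hW' hβ'
    unfold totalError
    linarith


/-! ### A program logic -/

/-- The program `P` halts within `T` steps in a state satisfying `Q`. -/
def Runs (f : Finset (Fin n) → ℝ) (P : Prog) (s : State) (T : ℕ) (Q : State → Prop) : Prop :=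
  ∃ t ≤ T, ∃ s', Exec f P s t s' ∧ Q s'

/-- Whether `P` contains an assignment to the real array `a`. -/
def Prog.writesReal (a : ℕ) : Prog → Bool
  | .skip => false
  | .setNat _ _ _ => false
  | .setReal b _ _ => a == b
  | .flip _ _ => false
  | .query _ b _ => a == b
  | .seq P Q => P.writesReal a || Q.writesReal a
  | .cond _ P Q => P.writesReal a || Q.writesReal a
  | .loop _ P => P.writesReal a

/-- Whether `P` contains an assignment to the natural number array `a`. -/
def Prog.writesNat (a : ℕ) : Prog → Bool
  | .skip => false
  | .setNat b _ _ => a == b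
  | .setReal _ _ _ => false
  | .flip b _ => a == b
  | .query _ _ _ => false
  | .seq P Q => P.writesNat a || Q.writesNat a
  | .cond _ P Q => P.writesNat a || Q.writesNat a
  | .loop _ P => P.writesNat a

/-- Whether `P` contains a coin flip. -/
def Prog.flips : Prog → Bool
  | .skip => false
  | .setNat _ _ _ => false
  | .setReal _ _ _ => false
  | .flip _ _ => true
  | .query _ _ _ => false
  | .seq P Q => P.flips || Q.flips
  | .cond _ P Q => P.flips || Q.flips
  | .loop _ P => P.flips

/-- The states `s` and `s'` differ only in arrays that `P` writes to. -/
structure Frame (P : Prog) (s s' : State) : Prop where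
  real : ∀ a, P.writesReal a = false → s'.real a = s.real a
  nat : ∀ a, P.writesNat a = false → s'.nat a = s.nat a
  tape : s'.tape = s.tape
  pos : P.flips = false → s'.pos = s.pos

theorem Frame.refl (P : Prog) (s : State) : Frame P s s :=
  ⟨fun _ _ => rfl, fun _ _ => rfl, rfl, fun _ => rfl⟩

theorem Frame.trans {P : Prog} {s s' s'' : State} (h : Frame P s s') (h' : Frame P s' s'') :
    Frame P s s'' :=
  ⟨fun a ha => (h'.real a ha).trans (h.real a ha), fun a ha => (h'.nat a ha).trans (h.nat a ha),
    h'.tape.trans h.tape, fun hp => (h'.pos hp).trans (h.pos hp)⟩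

theorem Frame.mono {P Q : Prog} {s s' : State} (h : Frame P s s')
    (hr : ∀ a, Q.writesReal a = false → P.writesReal a = false)
    (hn : ∀ a, Q.writesNat a = false → P.writesNat a = false)
    (hf : Q.flips = false → P.flips = false) : Frame Q s s' :=
  ⟨fun a ha => h.real a (hr a ha), fun a ha => h.nat a (hn a ha), h.tape, fun hp => h.pos (hf hp)⟩

/-- The frame rule: an execution changes only the arrays to which the program assigns.  As
`Prog.writesReal` and its companions are computable, the conditions on a concrete program hold by
`rfl`. -/
theorem Exec.frame {f : Finset (Fin n) → ℝ} {P : Prog} {s s' : State} {t : ℕ}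
    (h : Exec f P s t s') : Frame P s s' := by
  induction h with
  | skip s => exact Frame.refl _ _
  | setNat s a i e =>
    refine ⟨fun _ _ => rfl, fun b hb => ?_, rfl, fun _ => rfl⟩
    simp only [Prog.writesNat, beq_eq_false_iff_ne, ne_eq] at hb
    simp [State.writeNat, hb]
  | setReal s a i e =>
    refine ⟨fun b hb => ?_, fun _ _ => rfl, rfl, fun _ => rfl⟩
    simp only [Prog.writesReal, beq_eq_false_iff_ne, ne_eq] at hb
    simp [State.writeReal, hb]
  | flip s a i =>
    refine ⟨fun _ _ => rfl, fun b hb => ?_, rfl, fun h => by simp [Prog.flips] at h⟩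
    simp only [Prog.writesNat, beq_eq_false_iff_ne, ne_eq] at hb
    simp [State.writeNat, hb]
  | query s q a i =>
    refine ⟨fun b hb => ?_, fun _ _ => rfl, rfl, fun _ => rfl⟩
    simp only [Prog.writesReal, beq_eq_false_iff_ne, ne_eq] at hb
    simp [State.writeReal, hb]
  | seq _ _ ih₁ ih₂ =>
    refine (ih₁.mono ?_ ?_ ?_).trans (ih₂.mono ?_ ?_ ?_) <;>
      simp +contextual [Prog.writesReal, Prog.writesNat, Prog.flips]
  | condTrue _ _ ih =>
    refine ih.mono ?_ ?_ ?_ <;> simp +contextual [Prog.writesReal, Prog.writesNat, Prog.flips]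
  | condFalse _ _ ih =>
    refine ih.mono ?_ ?_ ?_ <;> simp +contextual [Prog.writesReal, Prog.writesNat, Prog.flips]
  | loopDone _ => exact Frame.refl _ _
  | loopStep _ _ _ ih₁ ih₂ =>
    exact (Frame.mono (Q := .loop _ _) ih₁ (fun _ h => h) (fun _ h => h) fun h => h).trans ih₂

section Rules

variable {f : Finset (Fin n) → ℝ} {P P' : Prog} {s : State} {T T' : ℕ} {Q R : State → Prop}

theorem Runs.mono (h : Runs f P s T Q) (hT : T ≤ T') (hQ : ∀ s', Frame P s s' → Q s' → R s') :
    Runs f P s T' R := by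
  obtain ⟨t, ht, s', he, hq⟩ := h
  exact ⟨t, ht.trans hT, s', he, hQ s' he.frame hq⟩

theorem Runs.seq (h : Runs f P s T fun s' => Frame P s s' → Runs f P' s' T' Q) :
    Runs f (.seq P P') s (T + T') Q := by
  obtain ⟨t, ht, s', he, hq⟩ := h
  obtain ⟨t', ht', s'', he', hq'⟩ := hq he.frame
  exact ⟨t + t', add_le_add ht ht', s'', .seq he he', hq'⟩

theorem Runs.exec_seq {s' : State} {t : ℕ} (h : Exec f P s t s') (h' : Runs f P' s' T Q) :
    Runs f (.seq P P') s (t + T) Q := by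
  obtain ⟨t', ht', s'', he', hq'⟩ := h'
  exact ⟨t + t', by omega, s'', .seq h he', hq'⟩

theorem Runs.cond {b : Test} (h : b.Holds s → Runs f P s T Q)
    (h' : ¬ b.Holds s → Runs f P' s T Q) : Runs f (.cond b P P') s (T + 1) Q := by
  by_cases hb : b.Holds s
  · obtain ⟨t, ht, s', he, hq⟩ := h hb
    exact ⟨t + 1, by omega, s', .condTrue hb he, hq⟩
  · obtain ⟨t, ht, s', he, hq⟩ := h' hb
    exact ⟨t + 1, by omega, s', .condFalse hb he, hq⟩

/-- A loop that makes exactly `N` iterations, with invariant `I`. -/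
theorem Runs.loop {b : Test} (I : ℕ → State → Prop) (N : ℕ) (h0 : I 0 s)
    (hstep : ∀ i < N, ∀ s', Frame P s s' → I i s' → b.Holds s' ∧ Runs f P s' T (I (i + 1)))
    (hend : ∀ s', Frame P s s' → I N s' → ¬ b.Holds s') :
    Runs f (.loop b P) s (N * (T + 1) + 1) (I N) := by
  have key : ∀ d i, i + d = N → ∀ s', Frame P s s' → I i s' →
      Runs f (.loop b P) s' (d * (T + 1) + 1) (I N) := by
    intro d
    induction d with
    | zero =>
      intro i hi s' hs hI
      rw [add_zero] at hi
      subst hi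
      exact ⟨1, by omega, s', .loopDone (hend s' hs hI), hI⟩
    | succ d ih =>
      intro i hi s' hs hI
      obtain ⟨hb, t, ht, s'', he, hI'⟩ := hstep i (by omega) s' hs hI
      obtain ⟨t', ht', s₃, he', hI₃⟩ := ih (i + 1) (by omega) s'' (hs.trans he.frame) hI'
      refine ⟨t + t' + 1, ?_, s₃, .loopStep hb he he', hI₃⟩
      rw [add_mul]
      omega
  exact key N 0 (zero_add N) s (Frame.refl P s) h0

end Rules

/-- The weakest precondition of a program without loops. -/
def Prog.wp (f : Finset (Fin n) → ℝ) : Prog → (State → Prop) → State → Prop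
  | .skip, Q, s => Q s
  | .setNat a i e, Q, s => Q (s.writeNat a (i.eval s) (e.eval s))
  | .setReal a i e, Q, s => Q (s.writeReal a (i.eval s) (e.eval s))
  | .flip a i, Q, s => Q { s.writeNat a (i.eval s) (s.tape s.pos).toNat with pos := s.pos + 1 }
  | .query q a i, Q, s => Q (s.writeReal a (i.eval s) (f (s.markedSet n q)))
  | .seq P P', Q, s => P.wp f (P'.wp f Q) s
  | .cond b P P', Q, s => (b.Holds s → P.wp f Q s) ∧ (¬ b.Holds s → P'.wp f Q s)
  | .loop _ _, _, _ => False

/-- A bound for the running time of a program without loops. -/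
def Prog.cost : Prog → ℕ
  | .seq P Q => P.cost + Q.cost
  | .cond _ P Q => P.cost + Q.cost + 1
  | _ => 1

theorem Runs.of_wp {f : Finset (Fin n) → ℝ} {P : Prog} {s : State} {Q : State → Prop}
    (h : P.wp f Q s) : Runs f P s P.cost Q := by
  induction P generalizing s Q with
  | skip => exact ⟨1, le_rfl, _, .skip s, h⟩
  | setNat a i e => exact ⟨1, le_rfl, _, .setNat s a i e, h⟩
  | setReal a i e => exact ⟨1, le_rfl, _, .setReal s a i e, h⟩
  | flip a i => exact ⟨1, le_rfl, _, .flip s a i, h⟩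
  | query q a i => exact ⟨1, le_rfl, _, .query s q a i, h⟩
  | seq P P' ih ih' => exact Runs.seq ((ih h).mono le_rfl fun s' _ hs' _ => ih' hs')
  | cond b P P' ih ih' =>
    refine Runs.cond (T := P.cost + P'.cost) (fun hb => ?_) fun hb => ?_
    · exact (ih (h.1 hb)).mono (Nat.le_add_right _ _) fun _ _ h => h
    · exact (ih' (h.2 hb)).mono (Nat.le_add_left _ _) fun _ _ h => h
  | loop b P _ => exact h.elim

/-- `for c := 0, …, bound - 1 do P`, with a counter in the natural number array `c`. -/
def forNat (c : ℕ) (bound : NExp) (P : Prog) : Prog :=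
  .seq (.setNat c (.lit 0) (.lit 0))
    (.loop (.natLe (.add (.get c (.lit 0)) (.lit 1)) bound)
      (.seq P (.setNat c (.lit 0) (.add (.get c (.lit 0)) (.lit 1)))))

/-- `for c := 0, …, bound - 1 do P`, with a counter in the real array `c`. -/
def forReal (c : ℕ) (bound : RExp) (P : Prog) : Prog :=
  .seq (.setReal c (.lit 0) (.ofNat (.lit 0)))
    (.loop (.realLe (.add (.get c (.lit 0)) (.ofNat (.lit 1))) bound)
      (.seq P (.setReal c (.lit 0) (.add (.get c (.lit 0)) (.ofNat (.lit 1))))))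

theorem Runs.forNat {f : Finset (Fin n) → ℝ} {c : ℕ} {bound : NExp} {P : Prog} {s : State}
    {T : ℕ} (I : ℕ → State → Prop) (N : ℕ) (hc : P.writesNat c = false)
    (hb : ∀ s', Frame (forNat c bound P) s s' → bound.eval s' = N)
    (hI : ∀ i s' v, I i s' → I i (s'.writeNat c 0 v)) (h0 : I 0 s)
    (hstep : ∀ i < N, ∀ s', Frame (Bicriteria.forNat c bound P) s s' → s'.nat c 0 = i → I i s' →
      Runs f P s' T (I (i + 1))) :
    Runs f (Bicriteria.forNat c bound P) s (N * (T + 2) + 2) (I N) := by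
  have hfr : ∀ {s₁}, Frame (Bicriteria.forNat c bound P) s (s.writeNat c 0 0) →
      Frame (.seq P (.setNat c (.lit 0) (.add (.get c (.lit 0)) (.lit 1)))) (s.writeNat c 0 0) s₁ →
      Frame (Bicriteria.forNat c bound P) s s₁ := fun h h' => by
    refine h.trans (h'.mono ?_ ?_ ?_) <;>
      simp +contextual [Bicriteria.forNat, Prog.writesReal, Prog.writesNat, Prog.flips]
  have hfr0 : Frame (Bicriteria.forNat c bound P) s (s.writeNat c 0 0) := by
    have : Exec f (.setNat c (.lit 0) (.lit 0)) s 1 (s.writeNat c 0 0) := .setNat s _ _ _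
    refine this.frame.mono ?_ ?_ ?_ <;>
      simp +contextual [Bicriteria.forNat, Prog.writesReal, Prog.writesNat, Prog.flips]
  suffices key : Runs f (.loop
      (.natLe (.add (.get c (.lit 0)) (.lit 1)) bound)
      (.seq P (.setNat c (.lit 0) (.add (.get c (.lit 0)) (.lit 1)))))
      (s.writeNat c 0 0) (N * (T + 1 + 1) + 1) fun s' => s'.nat c 0 = N ∧ I N s' from
    (Runs.exec_seq (.setNat s _ _ _) key).mono (by ring_nf; omega) fun _ _ h => h.2
  refine Runs.loop (fun i s' => s'.nat c 0 = i ∧ I i s') N ⟨by simp [State.writeNat], hI _ _ _ h0⟩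
    ?_ ?_
  · rintro i hi s' hs' ⟨hci, hIi⟩
    have hF := hfr hfr0 hs'
    refine ⟨?_, ?_⟩
    · simp only [Test.Holds, NExp.eval, hb s' hF, hci]
      omega
    · refine Runs.seq ((hstep i hi s' hF hci hIi).mono le_rfl fun s'' hs'' hI' _ => ?_)
      have e : s''.nat c 0 = i := by rw [hs''.nat c hc, hci]
      refine ⟨1, le_rfl, _, .setNat s'' _ _ _, ?_, ?_⟩
      · simp [State.writeNat, NExp.eval, e]
      · exact hI _ _ _ hI'
  · rintro s' hs' ⟨hci, -⟩
    simp only [Test.Holds, NExp.eval, hb s' (hfr hfr0 hs'), hci]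
    omega

theorem Runs.forReal {f : Finset (Fin n) → ℝ} {c : ℕ} {bound : RExp} {P : Prog} {s : State}
    {T : ℕ} (I : ℕ → State → Prop) (N : ℕ) (hc : P.writesReal c = false)
    (hb : ∀ s', Frame (forReal c bound P) s s' → bound.eval s' = N)
    (hI : ∀ i s' v, I i s' → I i (s'.writeReal c 0 v)) (h0 : I 0 s)
    (hstep : ∀ i < N, ∀ s', Frame (Bicriteria.forReal c bound P) s s' → s'.real c 0 = i → I i s' →
      Runs f P s' T (I (i + 1))) :
    Runs f (Bicriteria.forReal c bound P) s (N * (T + 2) + 2) (I N) := by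
  have hfr : ∀ {s₁}, Frame (Bicriteria.forReal c bound P) s (s.writeReal c 0 0) →
      Frame (.seq P (.setReal c (.lit 0) (.add (.get c (.lit 0)) (.ofNat (.lit 1)))))
        (s.writeReal c 0 0) s₁ → Frame (Bicriteria.forReal c bound P) s s₁ := fun h h' => by
    refine h.trans (h'.mono ?_ ?_ ?_) <;>
      simp +contextual [Bicriteria.forReal, Prog.writesReal, Prog.writesNat, Prog.flips]
  have h1 : Exec f (.setReal c (.lit 0) (.ofNat (.lit 0))) s 1 (s.writeReal c 0 0) := by
    have := Exec.setReal (f := f) s c (.lit 0) (.ofNat (.lit 0))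
    simpa only [NExp.eval, RExp.eval, Nat.cast_zero] using this
  have hfr0 : Frame (Bicriteria.forReal c bound P) s (s.writeReal c 0 0) := by
    refine h1.frame.mono ?_ ?_ ?_ <;>
      simp +contextual [Bicriteria.forReal, Prog.writesReal, Prog.writesNat, Prog.flips]
  suffices key : Runs f (.loop
      (.realLe (.add (.get c (.lit 0)) (.ofNat (.lit 1))) bound)
      (.seq P (.setReal c (.lit 0) (.add (.get c (.lit 0)) (.ofNat (.lit 1))))))
      (s.writeReal c 0 0) (N * (T + 1 + 1) + 1) fun s' => s'.real c 0 = N ∧ I N s' from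
    (Runs.exec_seq h1 key).mono (by ring_nf; omega) fun _ _ h => h.2
  refine Runs.loop (fun i s' => s'.real c 0 = i ∧ I i s') N
    ⟨by simp [State.writeReal], hI _ _ _ h0⟩ ?_ ?_
  · rintro i hi s' hs' ⟨hci, hIi⟩
    have hF := hfr hfr0 hs'
    refine ⟨?_, ?_⟩
    · simp only [Test.Holds, RExp.eval, NExp.eval, hb s' hF, hci]
      exact_mod_cast hi
    · refine Runs.seq ((hstep i hi s' hF hci hIi).mono le_rfl fun s'' hs'' hI' _ => ?_)
      have e : s''.real c 0 = i := by rw [hs''.real c hc, hci]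
      refine ⟨1, le_rfl, _, .setReal s'' _ _ _, ?_, ?_⟩
      · simp [State.writeReal, RExp.eval, NExp.eval, e]
      · exact hI _ _ _ hI'
  · rintro s' hs' ⟨hci, -⟩
    simp only [Test.Holds, RExp.eval, NExp.eval, hb s' (hfr hfr0 hs'), hci, not_le]
    push_cast
    linarith


/-! ### The program: evaluation of the scheme -/

/-!
Memory layout.  Real arrays: `0` costs, `1` budget and `ε`, `2` output, `3` current point, `4` marks
for oracle queries, `5` thresholds, `6` estimate of the field, `8` weights.  Scalars, each in cell
`0` of a real array: `10` sum of the costs, `11` largest value of a singleton, `12` approximation of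
`√ε`, `13` number of sample points, `16` iteration, `17` cost of the current point, `18` sum of the
squared costs, `20` to `33` arguments, results and temporary values.  Natural number arrays: `0`
size of the ground set, `1` loop variable, `2` random bit, `3` counter of the inner loop.
-/

/-- A numeral. -/
abbrev num (k : ℕ) : RExp := .ofNat (.lit k)

/-- The scalar variable stored in cell `0` of the real array `a`. -/
abbrev cell (a : ℕ) : RExp := .get a (.lit 0)

/-- The entry of the real array `a` whose index is the loop variable. -/
abbrev entry (a : ℕ) : RExp := .get a (.get 1 (.lit 0))

/-- The size of the ground set. -/
abbrev size : RExp := .ofNat (.get 0 (.lit 0))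

/-- Assign to the scalar variable in the real array `a`. -/
abbrev setCell (a : ℕ) (e : RExp) : Prog := .setReal a (.lit 0) e

/-- Assign to the entry of the real array `a` whose index is the loop variable. -/
abbrev setEntry (a : ℕ) (e : RExp) : Prog := .setReal a (.get 1 (.lit 0)) e

/-- Run a program for all elements of the ground set. -/
abbrev forElements (P : Prog) : Prog := forNat 1 (.get 0 (.lit 0)) P

/-- Test whether the density is at most one half. -/
abbrev lowTest : Test := .realLe (.add (cell 1) (cell 1)) (cell 10)

/-- Cell `32` receives `(1 + x / n)^{-k}` for the numbers `x` and `k` in the cells `30` and `31`. -/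
def powProg : Prog :=
  .seq (setCell 32 (num 1)) (forReal 33 (cell 31)
    (setCell 32 (.div (cell 32) (.add (num 1) (.mul (.div (num 1) size) (cell 30))))))

theorem runs_powProg {f : Finset (Fin n) → ℝ} {s : State} {z : ℝ} {K : ℕ} (h0 : s.nat 0 0 = n)
    (h30 : s.real 30 0 = z) (h31 : s.real 31 0 = K) :
    Runs f powProg s (3 * K + 3) fun s' => s'.real 32 0 = ((1 + 1 / (n : ℝ) * z) ^ K)⁻¹ := by
  refine (Runs.seq (T' := K * (1 + 2) + 2) ((Runs.of_wp (Q := fun s' => s'.real 32 0 = 1)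
    (by simp [Prog.wp, RExp.eval, NExp.eval, State.writeReal])).mono le_rfl
    fun s₁ _ hs₁ hF => ?_)).mono (T := 1 + (K * (1 + 2) + 2)) (by omega) fun _ _ h => h
  refine Runs.forReal (fun i s' => s'.real 32 0 = ((1 + 1 / (n : ℝ) * z) ^ i)⁻¹) K rfl ?_ ?_ ?_ ?_
  · intro s' hs'
    simp only [RExp.eval, NExp.eval]
    rw [hs'.real 31 rfl, hF.real 31 rfl, h31]
  · intro i s' v h
    simpa [State.writeReal] using h
  · simpa using hs₁
  · intro i _ s' hs' _ hI
    refine Runs.of_wp ?_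
    simp only [Prog.wp, RExp.eval, NExp.eval, State.writeReal, Function.update_self]
    rw [hs'.real 30 rfl, hF.real 30 rfl, h30, hs'.nat 0 rfl, hF.nat 0 rfl, h0, hI, pow_succ,
      mul_inv]
    simp [div_eq_mul_inv]

/-- The input and the values computed in the initialisation are in place; `M` is the scale of the
function. -/
structure Ready (s : State) (ε : ℝ) (p : Fin n → ℝ) (B M : ℝ) : Prop where
  size : s.nat 0 0 = n
  costs : ∀ u : Fin n, s.real 0 u = p u
  budget : s.real 1 0 = B
  sum : s.real 10 0 = ∑ u, p u
  scale : s.real 11 0 = M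
  root : ¬ B + B ≤ ∑ u, p u → s.real 12 0 = approxSqrt ε n
  rounds : s.real 13 0 = (chosenScheme ε p B).rounds
  sumSq : s.real 18 0 = ∑ u, p u ^ 2

/-- Whether `P` leaves the values computed in the initialisation alone. -/
def Prog.keepsReady (P : Prog) : Bool :=
  !(P.writesNat 0) && !(P.writesReal 0) && !(P.writesReal 1) && !(P.writesReal 10) &&
    !(P.writesReal 11) && !(P.writesReal 12) && !(P.writesReal 13) && !(P.writesReal 18)

theorem Ready.of_frame {s s' : State} {ε : ℝ} {p : Fin n → ℝ} {B M : ℝ}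
    (h : Ready s ε p B M) {P : Prog} (hF : Frame P s s') (hP : P.keepsReady = true) :
    Ready s' ε p B M := by
  simp only [Prog.keepsReady, Bool.and_eq_true, Bool.not_eq_true'] at hP
  obtain ⟨⟨⟨⟨⟨⟨⟨h0, h1⟩, h2⟩, h3⟩, h4⟩, h5⟩, h6⟩, h7⟩ := hP
  constructor
  · rw [hF.nat 0 h0, h.size]
  · intro u; rw [hF.real 0 h1, h.costs]
  · rw [hF.real 1 h2, h.budget]
  · rw [hF.real 10 h3, h.sum]
  · rw [hF.real 11 h4, h.scale]
  · intro hh; rw [hF.real 12 h5, h.root hh]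
  · rw [hF.real 13 h6, h.rounds]
  · rw [hF.real 18 h7, h.sumSq]

theorem Ready.lowTest_iff {s : State} {ε : ℝ} {p : Fin n → ℝ} {B M : ℝ}
    (h : Ready s ε p B M) : lowTest.Holds s ↔ B + B ≤ ∑ u, p u := by
  simp only [Test.Holds, RExp.eval, NExp.eval, h.budget, h.sum]

/-- Cells `21` and `22` receive the coordinate and the weight of the sample point whose number is
in cell `20`, for the coordinate in cell `23`, if the density is at most one half. -/
def lowSample : Prog :=
  .seq (setCell 30 (num 1)) <| .seq (setCell 31 (.sub (cell 13) (cell 20))) <| .seq powProg <|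
  .seq (setCell 22 (.mul (.div (num 1) size) (cell 32))) <| .seq (setCell 30 (cell 23)) <|
  .seq (setCell 31 (.add (cell 20) (num 1))) <| .seq powProg <|
  .seq (setCell 22 (.mul (cell 22) (cell 32))) (setCell 21 (.sub (num 1) (cell 32)))

/-- The solution coordinate `q² + 2 s q y` for `s` in cell `12` and `y` in cell `23`. -/
abbrev highExp : RExp :=
  .add (.mul (.sub (num 1) (cell 12)) (.sub (num 1) (cell 12)))
    (.mul (.mul (.mul (num 2) (cell 12)) (.sub (num 1) (cell 12))) (cell 23))

/-- The counterpart of `lowSample` for density more than one half. -/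
def highSample : Prog :=
  .seq (setCell 27 highExp) <|
  .cond (.realLe (.add (cell 20) (num 1)) (.mul size size))
    (.seq (setCell 21 (.mul (.div (.add (cell 20) (num 1)) (.mul size size)) (cell 27)))
      (setCell 22 (.div (.mul (.mul (.mul (num 2) (cell 12)) (.sub (num 1) (cell 12)))
        (.sub (num 1) (cell 27))) (.mul size size))))
    (.seq (setCell 21 (.sub (num 1) (.mul
        (.div (.sub (cell 20) (.mul size size)) (.mul size size)) (.sub (num 1) (cell 27)))))
      (setCell 22 (.div (.mul (.mul (.mul (num 2) (cell 12)) (.sub (num 1) (cell 12)))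
        (cell 27)) (.mul size size))))

/-- Cells `21` and `22` receive the coordinate and the weight of a sample point. -/
def sampleProg : Prog := .cond lowTest lowSample highSample

/-- Cell `26` receives the solution coordinate for the coordinate in cell `23`. -/
def outProg : Prog :=
  .cond lowTest
    (.seq (setCell 30 (cell 23)) <| .seq (setCell 31 (cell 13)) <| .seq powProg
      (setCell 26 (.sub (num 1) (cell 32))))
    (setCell 26 highExp)

section

variable {f : Finset (Fin n) → ℝ} {s : State} {ε B M : ℝ} {p : Fin n → ℝ}

theorem runs_sampleProg (h : Ready s ε p B M) {z : ℝ} {j : ℕ} (hz : s.real 23 0 = z)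
    (hj : s.real 20 0 = j) (hjJ : j < (chosenScheme ε p B).rounds) :
    Runs f sampleProg s (6 * (chosenScheme ε p B).rounds + 20) fun s' =>
      s'.real 21 0 = (chosenScheme ε p B).point j z ∧
      s'.real 22 0 = (chosenScheme ε p B).weight j z := by
  refine Runs.cond (T := 6 * (chosenScheme ε p B).rounds + 19) (fun hlow => ?_) fun hhigh => ?_
  · rw [h.lowTest_iff] at hlow
    have e : chosenScheme ε p B = lowScheme (1 / n) (lowRounds ε n) := if_pos hlow
    have hr := h.rounds
    rw [e] at hr hjJ ⊢
    change s.real 13 0 = lowRounds ε n at hr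
    change j < lowRounds ε n at hjJ
    set K := lowRounds ε n
    have hK : (lowScheme (1 / n) K).rounds = K := rfl
    rw [hK]
    have key : Runs f lowSample s
        (1 + (1 + ((3 * (K - j) + 3) + (1 + (1 + (1 + ((3 * (j + 1) + 3) + (1 + 1))))))))
        fun s' => s'.real 21 0 = (lowScheme (1 / n) K).point j z ∧
          s'.real 22 0 = (lowScheme (1 / n) K).weight j z := by
      refine Runs.seq (Runs.mono (Runs.of_wp (Q := fun s' => s'.real 30 0 = 1)
        (by simp [Prog.wp, RExp.eval, NExp.eval, State.writeReal])) le_rfl fun s₁ _ h₁ F₁ => ?_)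
      refine Runs.seq (Runs.mono (Runs.of_wp (Q := fun s' => s'.real 31 0 = (K - j : ℕ)) ?_) le_rfl
        fun s₂ _ h₂ F₂ => ?_)
      · simp only [Prog.wp, RExp.eval, NExp.eval, State.writeReal, Function.update_self]
        rw [F₁.real 13 rfl, F₁.real 20 rfl, hr, hj, Nat.cast_sub hjJ.le]
      refine Runs.seq (Runs.mono (runs_powProg (z := 1) (K := K - j)
        (by rw [F₂.nat 0 rfl, F₁.nat 0 rfl, h.size]) (by rw [F₂.real 30 rfl, h₁]) h₂) le_rfl
        fun s₃ _ h₃ F₃ => ?_)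
      refine Runs.seq (Runs.mono (Runs.of_wp (Q := fun s' => s'.real 22 0 =
        1 / n * ((1 + 1 / (n : ℝ)) ^ (K - j))⁻¹) ?_) le_rfl fun s₄ _ h₄ F₄ => ?_)
      · simp only [Prog.wp, RExp.eval, NExp.eval, State.writeReal, Function.update_self]
        rw [F₃.nat 0 rfl, F₂.nat 0 rfl, F₁.nat 0 rfl, h.size, h₃, mul_one]
        simp
      refine Runs.seq (Runs.mono (Runs.of_wp (Q := fun s' => s'.real 30 0 = z) ?_) le_rfl
        fun s₅ _ h₅ F₅ => ?_)
      · simp only [Prog.wp, RExp.eval, NExp.eval, State.writeReal, Function.update_self]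
        rw [F₄.real 23 rfl, F₃.real 23 rfl, F₂.real 23 rfl, F₁.real 23 rfl, hz]
      refine Runs.seq (Runs.mono (Runs.of_wp (Q := fun s' => s'.real 31 0 = (j + 1 : ℕ)) ?_) le_rfl
        fun s₆ _ h₆ F₆ => ?_)
      · simp only [Prog.wp, RExp.eval, NExp.eval, State.writeReal, Function.update_self]
        rw [F₅.real 20 rfl, F₄.real 20 rfl, F₃.real 20 rfl, F₂.real 20 rfl, F₁.real 20 rfl, hj]
        simp
      refine Runs.seq (Runs.mono (runs_powProg (z := z) (K := j + 1)
        (by rw [F₆.nat 0 rfl, F₅.nat 0 rfl, F₄.nat 0 rfl, F₃.nat 0 rfl, F₂.nat 0 rfl,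
          F₁.nat 0 rfl, h.size]) (by rw [F₆.real 30 rfl, h₅]) h₆) le_rfl fun s₇ _ h₇ F₇ => ?_)
      refine Runs.of_wp (P := .seq _ _) ?_
      have e22 : s₇.real 22 0 = 1 / n * ((1 + 1 / (n : ℝ)) ^ (K - j))⁻¹ := by
        rw [F₇.real 22 rfl, F₆.real 22 rfl, F₅.real 22 rfl, h₄]
      simp [Prog.wp, RExp.eval, NExp.eval, State.writeReal, h₇, e22, lowScheme]
    refine key.mono ?_ fun _ _ h => h
    omega
  · rw [h.lowTest_iff] at hhigh
    have e : chosenScheme ε p B = highScheme (approxSqrt ε n) (n * n) := if_neg hhigh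
    have hs := h.root hhigh
    rw [e]
    refine (Runs.of_wp (P := highSample) ?_).mono (by simp [highSample, Prog.cost])
      fun _ _ h => h
    have hiff : (j : ℝ) + 1 ≤ (n : ℝ) * n ↔ j + 1 ≤ n * n := by
      constructor <;> intro h' <;> exact_mod_cast h'
    by_cases hjn : j + 1 ≤ n * n
    · simp [highSample, Prog.wp, RExp.eval, NExp.eval, State.writeReal, Test.Holds, hs, hz, hj,
        h.size, hiff, hjn, highScheme, sq]
      constructor <;> intro h' <;> exfalso <;> omega
    · simp [highSample, Prog.wp, RExp.eval, NExp.eval, State.writeReal, Test.Holds, hs, hz, hj,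
        h.size, hiff, hjn, highScheme, sq]
      constructor <;> intro h' <;> exfalso <;> omega

theorem runs_outProg (h : Ready s ε p B M) {z : ℝ} (hz : s.real 23 0 = z) :
    Runs f outProg s (3 * (chosenScheme ε p B).rounds + 20) fun s' =>
      s'.real 26 0 = (chosenScheme ε p B).out z := by
  refine Runs.cond (T := 3 * (chosenScheme ε p B).rounds + 19) (fun hlow => ?_) fun hhigh => ?_
  · rw [h.lowTest_iff] at hlow
    have e : chosenScheme ε p B = lowScheme (1 / n) (lowRounds ε n) := if_pos hlow
    have hr := h.rounds
    rw [e] at hr ⊢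
    change s.real 13 0 = lowRounds ε n at hr
    set K := lowRounds ε n
    have hK : (lowScheme (1 / n) K).rounds = K := rfl
    rw [hK]
    refine Runs.mono (T := 1 + (1 + ((3 * K + 3) + 1))) ?_ (by omega) fun _ _ h => h
    refine Runs.seq (Runs.mono (Runs.of_wp (Q := fun s' => s'.real 30 0 = z)
      (by simpa [Prog.wp, RExp.eval, NExp.eval, State.writeReal] using hz)) le_rfl
      fun s₁ _ h₁ F₁ => ?_)
    refine Runs.seq (Runs.mono (Runs.of_wp (Q := fun s' => s'.real 31 0 = K) ?_) le_rfl
      fun s₂ _ h₂ F₂ => ?_)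
    · simp only [Prog.wp, RExp.eval, NExp.eval, State.writeReal, Function.update_self]
      rw [F₁.real 13 rfl, hr]
    refine Runs.seq (Runs.mono (runs_powProg (z := z) (K := K)
      (by rw [F₂.nat 0 rfl, F₁.nat 0 rfl, h.size]) (by rw [F₂.real 30 rfl, h₁]) h₂) le_rfl
      fun s₃ _ h₃ F₃ => ?_)
    refine Runs.of_wp ?_
    simp [Prog.wp, RExp.eval, NExp.eval, State.writeReal, h₃, lowScheme]
  · rw [h.lowTest_iff] at hhigh
    have e : chosenScheme ε p B = highScheme (approxSqrt ε n) (n * n) := if_neg hhigh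
    have hs := h.root hhigh
    rw [e]
    refine (Runs.of_wp ?_).mono (by simp [Prog.cost]) fun _ _ h => h
    simp [Prog.wp, RExp.eval, NExp.eval, State.writeReal, hs, hz, highScheme, sq]

end


/-! ### The program: one iteration -/

section

variable {f : Finset (Fin n) → ℝ} {s : State} {ε B M : ℝ} {p : Fin n → ℝ}

/-- A loop over the ground set whose body for `u` assigns the value `g u` to the entry `u` of the
array `a`. -/
theorem runs_forElements {P : Prog} {T : ℕ} (a : ℕ) (g : Fin n → ℝ) (hsize : s.nat 0 0 = n)
    (h1 : P.writesNat 1 = false) (h0 : P.writesNat 0 = false)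
    (hstep : ∀ u : Fin n, ∀ s', Frame (forElements P) s s' → s'.nat 1 0 = u →
      (∀ v : Fin n, u ≤ v → s'.real a v = s.real a v) →
      Runs f P s' T fun s'' => s''.real a u = g u ∧
        ∀ v : Fin n, v ≠ u → s''.real a v = s'.real a v) :
    Runs f (forElements P) s (n * (T + 2) + 2) fun s' => ∀ u : Fin n, s'.real a u = g u := by
  have hn0 : (forElements P).writesNat 0 = false := by
    simp [forElements, forNat, Prog.writesNat, h0]
  refine (Runs.forNat (fun i s' => ∀ v : Fin n, s'.real a v = if v.val < i then g v else s.real a v)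
    n h1 (fun s' hs' => ?_) (fun i s' v h => h) (by simp) ?_).mono le_rfl fun s' _ h u => ?_
  · simp only [NExp.eval]
    rw [hs'.nat 0 hn0, hsize]
  · intro i hi s' hs' hc hI
    refine (hstep ⟨i, hi⟩ s' hs' hc fun v hv => ?_).mono le_rfl fun s'' _ h v => ?_
    · have hv' : i ≤ v.val := hv
      rw [hI, if_neg (by omega)]
    · by_cases hv : v = ⟨i, hi⟩
      · rw [hv, h.1, if_pos (Nat.lt_succ_self i)]
      · have hv' : v.val ≠ i := fun h' => hv (Fin.ext h')
        rw [h.2 v hv, hI]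
        by_cases hlt : v.val < i
        · rw [if_pos hlt, if_pos (by omega)]
        · rw [if_neg hlt, if_neg (by omega)]
  · rw [h, if_pos u.2]

/-- Draw the `n + 1` random thresholds of an iteration and store them in the array `5`. -/
def thresholdProg : Prog :=
  forNat 1 (.add (.get 0 (.lit 0)) (.lit 1)) <|
    .seq (setEntry 5 (num 0)) <| forNat 3 (.get 0 (.lit 0)) <|
      .seq (.flip 2 (.lit 0)) <|
        setEntry 5 (.div (.add (entry 5) (.ofNat (.get 2 (.lit 0)))) (num 2))

theorem runs_thresholdProg {r : ℕ} (h0 : s.nat 0 0 = n) (hpos : s.pos = r) :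
    Runs f thresholdProg s ((n + 1) * (n * 4 + 5) + 2) fun s' =>
      (∀ u ≤ n, s'.real 5 u = dyadic n fun i => s.tape (r + u * n + i)) ∧
        s'.pos = r + (n + 1) * n := by
  refine (Runs.forNat (T := 1 + (n * (2 + 2) + 2)) (fun i s' =>
    (∀ u < i, s'.real 5 u = dyadic n fun i => s.tape (r + u * n + i)) ∧ s'.pos = r + i * n)
    (n + 1) rfl ?_ ?_ ?_ ?_).mono (by ring_nf; omega) fun s' _ h =>
      ⟨fun u hu => h.1 u (by omega), h.2⟩
  · intro s' hs'
    simp only [NExp.eval]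
    rw [hs'.nat 0 rfl, h0]
  · exact fun i s' v h => h
  · exact ⟨by simp, by simpa using hpos⟩
  · intro i _ s' hs' hc hI
    refine Runs.seq ((Runs.of_wp (Q := fun s'' => s''.real 5 i = 0 ∧
      ∀ u < i, s''.real 5 u = s'.real 5 u) ?_).mono le_rfl fun s₁ F₁ h₁ F₁' => ?_)
    · simp only [Prog.wp, RExp.eval, NExp.eval, State.writeReal, hc, Function.update_self]
      exact ⟨by simp, fun u hu => Function.update_of_ne hu.ne _ _⟩
    · have hc₁ : s₁.nat 1 0 = i := by rw [F₁.nat 1 rfl, hc]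
      have ht₁ : s₁.tape = s.tape := F₁.tape.trans hs'.tape
      refine (Runs.forNat (fun l s'' => s''.real 5 i = dyadic l
        (fun t : Fin l => s.tape (r + i * n + t)) ∧ s''.pos = r + i * n + l ∧
        ∀ u < i, s''.real 5 u = s'.real 5 u) n rfl ?_ (fun _ _ _ h => h) ?_ ?_).mono le_rfl
        fun s'' _ h => ?_
      · intro s'' hs''
        simp only [NExp.eval]
        rw [hs''.nat 0 rfl, F₁.nat 0 rfl, hs'.nat 0 rfl, h0]
      · exact ⟨by simpa [dyadic] using h₁.1, by rw [F₁.pos rfl, hI.2, add_zero], h₁.2⟩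
      · intro l _ s₂ hs₂ _ hJ
        have hc₂ : s₂.nat 1 0 = i := by rw [hs₂.nat 1 rfl, hc₁]
        refine Runs.of_wp ?_
        simp only [Prog.wp, RExp.eval, NExp.eval, State.writeReal, State.writeNat,
          Function.update_self, ne_eq, not_false_eq_true, Function.update_of_ne,
          OfNat.one_ne_ofNat, hc₂]
        refine ⟨?_, by rw [hJ.2.1]; ring, fun u hu => ?_⟩
        · rw [hJ.1, hs₂.tape, ht₁, hJ.2.1]
          simp [dyadic]
        · rw [Function.update_of_ne hu.ne, hJ.2.2 u hu]
      · refine ⟨fun u hu => ?_, by rw [h.2.1]; ring⟩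
        rcases Nat.lt_succ_iff_lt_or_eq.1 hu with hu | hu
        · rw [h.2.2 u hu, hI.1 u hu]
        · rw [hu, h.1]

/-- Mark the elements whose threshold is less than the coordinate of the sample point, and store
the weights of the sample point in the array `8`. -/
def markProg : Prog :=
  forElements <| .seq (setCell 23 (entry 3)) <| .seq sampleProg <|
    .seq (setEntry 8 (cell 22)) <|
    .cond (.realLe (cell 21) (entry 5)) (setEntry 4 (num 0)) (setEntry 4 (num 1))

theorem runs_markProg (h : Ready s ε p B M) {θ y : Fin n → ℝ} {j : ℕ}
    (hθ : ∀ u : Fin n, s.real 5 u = θ u) (hy : ∀ u : Fin n, s.real 3 u = y u)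
    (hj : s.real 20 0 = j) (hjJ : j < (chosenScheme ε p B).rounds) :
    Runs f markProg s (n * (6 * (chosenScheme ε p B).rounds + 27) + 2) fun s' =>
      (∀ u : Fin n, s'.real 8 u = (chosenScheme ε p B).weight j (y u)) ∧
      s'.markedSet n 4 = thresholdSet θ fun v => (chosenScheme ε p B).point j (y v) := by
  set σ := chosenScheme ε p B with hσ
  refine (Runs.forNat (T := 1 + ((6 * σ.rounds + 20) + (1 + 3))) (fun i s' =>
    ∀ u : Fin n, u.val < i → s'.real 8 u = σ.weight j (y u) ∧
      (s'.real 4 u ≠ 0 ↔ θ u < σ.point j (y u))) n rfl ?_ (fun _ _ _ h => h) ?_ ?_).mono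
      (by ring_nf; omega) fun s' _ h' => ⟨fun u => (h' u u.2).1, ?_⟩
  · intro s' hs'
    simp only [NExp.eval]
    rw [hs'.nat 0 rfl, h.size]
  · exact fun u hu => absurd hu (Nat.not_lt_zero _)
  · intro i hi s' hs' hc hI
    refine Runs.seq ((Runs.of_wp (Q := fun s'' => s''.real 23 0 = y ⟨i, hi⟩) ?_).mono le_rfl
      fun s₁ _ h₁ F₁ => ?_)
    · simp only [Prog.wp, RExp.eval, NExp.eval, State.writeReal, hc, Function.update_self]
      rw [hs'.real 3 rfl, ← hy]
    have hR := (h.of_frame hs' rfl).of_frame F₁ rfl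
    refine Runs.seq ((runs_sampleProg hR (z := y ⟨i, hi⟩) (j := j) h₁
      (by rw [F₁.real 20 rfl, hs'.real 20 rfl, hj]) hjJ).mono le_rfl fun s₂ _ h₂ F₂ => ?_)
    have hc₂ : s₂.nat 1 0 = i := by rw [F₂.nat 1 rfl, F₁.nat 1 rfl, hc]
    have hθ₂ : s₂.real 5 i = θ ⟨i, hi⟩ := by
      rw [F₂.real 5 rfl, F₁.real 5 rfl, hs'.real 5 rfl, ← hθ]
    have h8 : s₂.real 8 = s'.real 8 := by rw [F₂.real 8 rfl, F₁.real 8 rfl]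
    have h4 : s₂.real 4 = s'.real 4 := by rw [F₂.real 4 rfl, F₁.real 4 rfl]
    have hor : ∀ u : Fin n, u.val < i + 1 → u = ⟨i, hi⟩ ∨ u.val ≠ i ∧ u.val < i := fun u hu => by
      by_cases hui : u.val = i
      · exact Or.inl (Fin.ext hui)
      · exact Or.inr ⟨hui, by omega⟩
    refine Runs.of_wp (P := .seq _ (.cond _ _ _)) ?_
    simp only [Prog.wp, RExp.eval, NExp.eval, State.writeReal, Test.Holds, hc₂,
      Function.update_self]
    refine ⟨fun hle u hu => ?_, fun hle u hu => ?_⟩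
    · simp only [ne_eq, Nat.reduceEqDiff, not_false_eq_true, Function.update_of_ne] at hle
      rw [h₂.1, hθ₂] at hle
      rcases hor u hu with rfl | ⟨hui, hlt⟩
      · simpa [h₂.2, ← hσ] using hle
      · simpa [hui, h8, h4] using hI u hlt
    · simp only [ne_eq, Nat.reduceEqDiff, not_false_eq_true, Function.update_of_ne] at hle
      rw [h₂.1, hθ₂] at hle
      rcases hor u hu with rfl | ⟨hui, hlt⟩
      · simpa [h₂.2, ← hσ] using hle
      · simpa [hui, h8, h4] using hI u hlt
  · ext u
    simp only [State.markedSet, thresholdSet, Finset.mem_filter, Finset.mem_univ, true_and]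
    exact (h' u u.2).2

/-- Add the marginals at the marked set, multiplied by the weights in the array `8`, to the entries
of the array `6`. -/
def marginalProg : Prog :=
  forElements <| .seq (setCell 26 (entry 4)) <| .seq (setEntry 4 (num 1)) <|
    .seq (.query 4 24 (.lit 0)) <| .seq (setEntry 4 (num 0)) <| .seq (.query 4 25 (.lit 0)) <|
    .seq (setEntry 4 (cell 26))
    (setEntry 6 (.add (entry 6) (.mul (entry 8) (.sub (cell 24) (cell 25)))))

theorem runs_marginalProg (h0 : s.nat 0 0 = n) {w V : Fin n → ℝ}
    (hw : ∀ u : Fin n, s.real 8 u = w u) (hV : ∀ u : Fin n, s.real 6 u = V u)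
    {R : Finset (Fin n)} (hR : s.markedSet n 4 = R) :
    Runs f marginalProg s (n * 9 + 2) fun s' =>
      ∀ u : Fin n, s'.real 6 u = V u + w u * marginal f u R := by
  refine (Runs.forNat (T := 7) (fun i s' => s'.real 4 = s.real 4 ∧
    ∀ u : Fin n, s'.real 6 u = if u.val < i then V u + w u * marginal f u R else V u) n rfl ?_
    (fun _ _ _ h => h) ⟨rfl, fun u => by simpa using hV u⟩ ?_).mono le_rfl fun s' _ h u => ?_
  · intro s' hs'
    simp only [NExp.eval]
    rw [hs'.nat 0 rfl, h0]
  · rintro i hi s' hs' hc ⟨h4, hI⟩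
    have hins : ∀ z : State, z.real 4 = Function.update (s.real 4) i 1 →
        z.markedSet n 4 = insert ⟨i, hi⟩ R := fun z hz => by
      ext v
      rw [← hR]
      simp only [State.markedSet, Finset.mem_filter, Finset.mem_univ, true_and, Finset.mem_insert,
        hz, Function.update_apply, Fin.ext_iff]
      by_cases hv : v.val = i <;> simp [hv]
    have hera : ∀ z : State, z.real 4 = Function.update (s.real 4) i 0 →
        z.markedSet n 4 = R.erase ⟨i, hi⟩ := fun z hz => by
      ext v
      rw [← hR]
      simp only [State.markedSet, Finset.mem_filter, Finset.mem_univ, true_and, Finset.mem_erase,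
        hz, Function.update_apply, Fin.ext_iff, ne_eq]
      by_cases hv : v.val = i <;> simp [hv]
    refine (Runs.of_wp ?_).mono (by simp [Prog.cost]) fun _ _ h => h
    simp only [Prog.wp, RExp.eval, NExp.eval, State.writeReal, hc, Function.update_self, ne_eq,
      Nat.reduceEqDiff, not_false_eq_true, Function.update_of_ne, h4, Function.update_idem,
      Function.update_eq_self, Nat.cast_one, Nat.cast_zero]
    rw [hins _ (by simp), hera _ (by simp)]
    refine ⟨trivial, fun u => ?_⟩
    have h8 : s'.real 8 i = w ⟨i, hi⟩ := by rw [hs'.real 8 rfl, ← hw]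
    by_cases hui : u = ⟨i, hi⟩
    · have h6 := hI u
      rw [hui] at h6 ⊢
      simp only [lt_irrefl, if_false] at h6
      simp [h8, h6, marginal]
    · have hui' : u.val ≠ i := fun h' => hui (Fin.ext h')
      rw [Function.update_of_ne hui', hI]
      by_cases hlt : u.val < i
      · rw [if_pos hlt, if_pos (by omega)]
      · rw [if_neg hlt, if_neg (by omega)]
  · rw [h.2, if_pos u.2]

/-- Compute the estimate of the field in the array `6`. -/
def estimateProg : Prog :=
  .seq (forElements (setEntry 6 (num 0))) (forReal 20 (cell 13) (.seq markProg marginalProg))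

theorem runs_estimateProg (h : Ready s ε p B M) {θ y : Fin n → ℝ}
    (hθ : ∀ u : Fin n, s.real 5 u = θ u) (hy : ∀ u : Fin n, s.real 3 u = y u) :
    Runs f estimateProg s (n * 3 + 2 + ((chosenScheme ε p B).rounds *
      (n * (6 * (chosenScheme ε p B).rounds + 27) + 2 + (n * 9 + 2) + 2) + 2)) fun s' =>
      ∀ u : Fin n, s'.real 6 u = (chosenScheme ε p B).estimate f θ y u := by
  set σ := chosenScheme ε p B with hσ
  refine Runs.seq ((runs_forElements 6 (fun _ => 0) h.size rfl rfl fun u s' hs' hc _ => ?_).mono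
    le_rfl fun s₁ _ h₁ F₁ => ?_)
  · refine Runs.of_wp ?_
    simp only [Prog.wp, RExp.eval, NExp.eval, State.writeReal, hc, Function.update_self]
    exact ⟨Nat.cast_zero, fun v hv => Function.update_of_ne (fun h' => hv (Fin.ext h')) _ _⟩
  · have hR₁ := h.of_frame F₁ rfl
    refine (Runs.forReal (fun j s' => ∀ u : Fin n, s'.real 6 u = ∑ i ∈ Finset.range j,
      σ.weight i (y u) * marginal f u (thresholdSet θ fun v => σ.point i (y v))) σ.rounds rfl ?_
      (fun _ _ _ h => by simpa [State.writeReal] using h) ?_ ?_).mono le_rfl fun s' _ h' => h'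
    · intro s' hs'
      simp only [RExp.eval, NExp.eval]
      rw [hs'.real 13 rfl, hR₁.rounds]
    · intro u
      rw [h₁, Finset.sum_range_zero]
    · intro j hj s' hs' hcj hI
      refine Runs.seq ((runs_markProg (hR₁.of_frame hs' rfl) (θ := θ) (y := y)
        (fun u => by rw [hs'.real 5 rfl, F₁.real 5 rfl, hθ])
        (fun u => by rw [hs'.real 3 rfl, F₁.real 3 rfl, hy]) hcj hj).mono le_rfl
        fun s₂ _ h₂ F₂ => ?_)
      refine (runs_marginalProg (by rw [F₂.nat 0 rfl, hs'.nat 0 rfl, hR₁.size]) h₂.1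
        (fun u => by rw [F₂.real 6 rfl, hI]) h₂.2).mono le_rfl fun s₃ _ h₃ u => ?_
      rw [h₃, Finset.sum_range_succ]

end


/-! ### The program: the main loop -/

/-- Cell `0` of the array `a` receives the sum of an expression over the ground set. -/
def sumProg (a : ℕ) (e : RExp) : Prog :=
  .seq (setCell a (num 0)) (forElements (setCell a (.add (cell a) e)))

/-- The array `3` receives the values of an expression, projected onto the unit interval. -/
def updateProg (e : RExp) : Prog :=
  forElements <| .seq (setCell 24 e) <|
    .cond (.realLe (cell 24) (num 0)) (setEntry 3 (num 0)) <|
    .cond (.realLe (num 1) (cell 24)) (setEntry 3 (num 1)) (setEntry 3 (cell 24))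

/-- The factor `1 + 1 / n²` by which the points may violate the budget. -/
abbrev slackExp : RExp := .add (num 1) (.div (num 1) (.mul size size))

/-- Store the solution that belongs to the point in the array `3` in the array `2`. -/
def solutionProg : Prog :=
  forElements <| .seq (setCell 23 (.div (entry 3) slackExp)) <| .seq outProg
    (setEntry 2 (cell 26))

/-- Replace the output if the last threshold is less than `1 / (k + 1)`, where `k` is the number of
the iteration, in cell `16`. -/
def replaceProg : Prog :=
  .cond (.realLe (.div (num 1) (.add (cell 16) (num 1))) (.get 5 (.get 0 (.lit 0)))) .skip
    solutionProg

/-- A step in the direction of the estimated field. -/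
def ascendProg : Prog :=
  .seq estimateProg <| updateProg <| .add (entry 3) <| .div (entry 6) <|
    .mul (.mul (num 2) (.mul (.mul (.mul size size) (.mul size size)) (.mul size size))) (cell 11)

/-- Projection onto the hyperplane `⟨p, y⟩ = B` and onto the cube, with the cost of `y` in
cell `17`. -/
def repairProg : Prog :=
  updateProg <| .sub (entry 3) <| .mul (.div (.sub (cell 17) (cell 1)) (cell 18)) (entry 0)

/-- One iteration. -/
def iterationProg : Prog :=
  .seq thresholdProg <| .seq (sumProg 17 (.mul (entry 0) (entry 3))) <|
    .cond (.realLe (cell 17) (.mul (cell 1) slackExp)) (.seq replaceProg ascendProg) repairProg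

/-- A bound for the running time of an iteration in terms of the number of sample points. -/
def iterationTime (n r : ℕ) : ℕ :=
  (n + 1) * (n * 4 + 5) + 2 + (n * 3 + 3 + ((n * (3 * r + 24) + 3) +
    (n * 3 + 2 + (r * (n * (6 * r + 27) + 2 + (n * 9 + 2) + 2) + 2) + (n * 8 + 2)) + 1))

section

variable {f : Finset (Fin n) → ℝ} {s : State} {ε B M : ℝ} {p : Fin n → ℝ}

theorem runs_sumProg {a : ℕ} {e : RExp} {g : Fin n → ℝ} (hsize : s.nat 0 0 = n)
    (he : ∀ u : Fin n, ∀ s', Frame (sumProg a e) s s' → s'.nat 1 0 = u → e.eval s' = g u) :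
    Runs f (sumProg a e) s (n * 3 + 3) fun s' => s'.real a 0 = ∑ u, g u := by
  have hF : ∀ {s₁ s₂ : State}, Frame (setCell a (num 0)) s s₁ →
      Frame (forElements (setCell a (.add (cell a) e))) s₁ s₂ → Frame (sumProg a e) s s₂ :=
    fun h h' => by
      refine (h.mono ?_ ?_ ?_).trans (h'.mono ?_ ?_ ?_) <;>
        simp +contextual [sumProg, Prog.writesReal, Prog.writesNat, Prog.flips]
  refine (Runs.seq (T := 1) (T' := n * (1 + 2) + 2) ((Runs.of_wp (Q := fun s' => s'.real a 0 = 0)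
    ?_).mono le_rfl fun s₁ _ h₁ F₁ => ?_)).mono (by omega) fun _ _ h => h
  · simp [Prog.wp, RExp.eval, NExp.eval, State.writeReal]
  · refine (Runs.forNat (fun i s' => s'.real a 0 =
      ∑ j ∈ Finset.range i, if h : j < n then g ⟨j, h⟩ else 0) n rfl ?_ (fun _ _ _ h => h)
      (by simpa using h₁) ?_).mono le_rfl fun s' _ h => ?_
    · intro s' hs'
      simp only [NExp.eval]
      rw [hs'.nat 0 rfl, F₁.nat 0 rfl, hsize]
    · intro i hi s' hs' hc hI
      refine Runs.of_wp ?_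
      simp only [Prog.wp, RExp.eval, NExp.eval, State.writeReal, Function.update_self]
      rw [he ⟨i, hi⟩ s' (hF F₁ hs') hc, hI, Finset.sum_range_succ, dif_pos hi]
    · rw [h, Finset.sum_range]
      simp

theorem runs_updateProg {e : RExp} {g : Fin n → ℝ} (hsize : s.nat 0 0 = n)
    (he : ∀ u : Fin n, ∀ s', Frame (updateProg e) s s' → s'.nat 1 0 = u →
      s'.real 3 u = s.real 3 u → e.eval s' = g u) :
    Runs f (updateProg e) s (n * 8 + 2) fun s' => ∀ u : Fin n, s'.real 3 u = clip (g u) := by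
  refine runs_forElements 3 _ hsize rfl rfl fun u s' hs' hc h3 => ?_
  refine (Runs.of_wp ?_).mono (by simp [Prog.cost]) fun _ _ h => h
  have hne : ∀ v : Fin n, v ≠ u → v.val ≠ u.val := fun v hv h' => hv (Fin.ext h')
  simp only [Prog.wp, NExp.eval, RExp.eval, State.writeReal, Test.Holds, Function.update_self, hc,
    he u s' hs' hc (h3 u le_rfl), Nat.cast_zero, Nat.cast_one]
  refine ⟨fun h => ⟨?_, fun v hv => ?_⟩, fun h => ⟨fun h' => ⟨?_, fun v hv => ?_⟩,
    fun h' => ⟨?_, fun v hv => ?_⟩⟩⟩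
  · rw [clip, max_eq_left (by exact (min_le_right _ _).trans h)]
  · simp [hne v hv]
  · rw [clip, min_eq_left h', max_eq_right zero_le_one]
  · simp [hne v hv]
  · rw [clip, min_eq_right (not_le.1 h').le, max_eq_right (not_le.1 h).le]
  · simp [hne v hv]

theorem eval_slackExp (hsize : s.nat 0 0 = n) : slackExp.eval s = 1 + 1 / (n : ℝ) ^ 2 := by
  simp [RExp.eval, NExp.eval, hsize, sq]

theorem runs_solutionProg (h : Ready s ε p B M) {y : Fin n → ℝ}
    (hy : ∀ u : Fin n, s.real 3 u = y u) :
    Runs f solutionProg s (n * (3 * (chosenScheme ε p B).rounds + 24) + 2) fun s' =>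
      ∀ u : Fin n, s'.real 2 u = (chosenScheme ε p B).solution y u := by
  refine (runs_forElements 2 ((chosenScheme ε p B).solution y) h.size rfl rfl
    (T := 1 + ((3 * (chosenScheme ε p B).rounds + 20) + 1)) fun u s' hs' hc _ => ?_).mono
    (by ring_nf; omega) fun _ _ h => h
  have hR := h.of_frame hs' rfl
  refine Runs.seq ((Runs.of_wp (Q := fun s'' => s''.real 23 0 = y u / (1 + 1 / (n : ℝ) ^ 2))
    ?_).mono le_rfl fun s₁ _ h₁ F₁ => ?_)
  · have := eval_slackExp hR.size
    simp only [Prog.wp, NExp.eval, State.writeReal, Function.update_self]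
    simp only [RExp.eval, NExp.eval] at this ⊢
    rw [this, hc, hs'.real 3 rfl, hy]
  · refine Runs.seq ((runs_outProg (hR.of_frame F₁ rfl) h₁).mono le_rfl fun s₂ _ h₂ F₂ => ?_)
    refine Runs.of_wp ?_
    have hc₂ : s₂.nat 1 0 = u := by rw [F₂.nat 1 rfl, F₁.nat 1 rfl, hc]
    simp only [Prog.wp, RExp.eval, NExp.eval, State.writeReal, Function.update_self, hc₂]
    refine ⟨h₂, fun v hv => ?_⟩
    rw [Function.update_of_ne (fun h' => hv (Fin.ext h')), F₂.real 2 rfl, F₁.real 2 rfl]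

open Classical in
theorem runs_replaceProg (h : Ready s ε p B M) {x y : Fin n → ℝ} {t : ℝ} {k : ℕ}
    (hx : ∀ u : Fin n, s.real 2 u = x u) (hy : ∀ u : Fin n, s.real 3 u = y u)
    (ht : s.real 5 n = t) (hk : s.real 16 0 = k) :
    Runs f replaceProg s (n * (3 * (chosenScheme ε p B).rounds + 24) + 3) fun s' =>
      ∀ u : Fin n, s'.real 2 u =
        (if t < 1 / (k + 1) then (chosenScheme ε p B).solution y else x) u := by
  refine Runs.cond (T := n * (3 * (chosenScheme ε p B).rounds + 24) + 2) (fun hb => ?_) fun hb => ?_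
  all_goals
    simp only [Test.Holds, RExp.eval, NExp.eval, hk, h.size, ht, Nat.cast_one] at hb
  · rw [if_neg hb.not_gt]
    exact (Runs.of_wp (P := .skip) (Q := fun s' => ∀ u : Fin n, s'.real 2 u = x u) hx).mono
      (by simp [Prog.cost]) fun _ _ h => h
  · rw [if_pos (not_le.1 hb)]
    exact runs_solutionProg h hy

theorem runs_ascendProg (h : Ready s ε p B M) {θ y : Fin n → ℝ}
    (hθ : ∀ u : Fin n, s.real 5 u = θ u) (hy : ∀ u : Fin n, s.real 3 u = y u) :
    Runs f ascendProg s (n * 3 + 2 + ((chosenScheme ε p B).rounds *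
      (n * (6 * (chosenScheme ε p B).rounds + 27) + 2 + (n * 9 + 2) + 2) + 2) + (n * 8 + 2))
      fun s' => ∀ u : Fin n, s'.real 3 u = ascend (chosenScheme ε p B) f M θ y u := by
  refine Runs.seq ((runs_estimateProg h hθ hy).mono le_rfl fun s₁ _ h₁ F₁ => ?_)
  have hR₁ := h.of_frame F₁ rfl
  refine runs_updateProg hR₁.size fun u s' hs' hc h3 => ?_
  simp only [RExp.eval, NExp.eval, hc]
  rw [h3, F₁.real 3 rfl, hy, hs'.real 6 rfl, h₁, hs'.nat 0 rfl, hR₁.size, hs'.real 11 rfl,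
    hR₁.scale]
  push_cast
  ring

theorem runs_repairProg (h : Ready s ε p B M) {y : Fin n → ℝ}
    (hy : ∀ u : Fin n, s.real 3 u = y u) (h17 : s.real 17 0 = ∑ u, p u * y u) :
    Runs f repairProg s (n * 8 + 2) fun s' => ∀ u : Fin n, s'.real 3 u = repair p B y u := by
  refine runs_updateProg h.size fun u s' hs' hc h3 => ?_
  have hR := h.of_frame hs' rfl
  simp only [RExp.eval, NExp.eval, hc]
  rw [h3, hy, hs'.real 17 rfl, h17, hR.budget, hR.sumSq, hR.costs]

theorem runs_iterationProg (h : Ready s ε p B M) {τ : ℕ → Bool} {k : ℕ} {x y : Fin n → ℝ}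
    (hτ : s.tape = τ) (hpos : s.pos = k * (n + 1) * n) (hk : s.real 16 0 = k)
    (hx : ∀ u : Fin n, s.real 2 u = x u) (hy : ∀ u : Fin n, s.real 3 u = y u) :
    Runs f iterationProg s (iterationTime n (chosenScheme ε p B).rounds) fun s' =>
      s'.pos = (k + 1) * (n + 1) * n ∧
      (∀ u : Fin n, s'.real 3 u = (ascentStep (chosenScheme ε p B) f p B M k
        (fun u => threshold n τ k u) (threshold n τ k n) (y, x)).1 u) ∧
      ∀ u : Fin n, s'.real 2 u = (ascentStep (chosenScheme ε p B) f p B M k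
        (fun u => threshold n τ k u) (threshold n τ k n) (y, x)).2 u := by
  set σ := chosenScheme ε p B with hσ
  refine Runs.seq ((runs_thresholdProg h.size hpos).mono le_rfl fun s₁ _ h₁ F₁ => ?_)
  have hR₁ := h.of_frame F₁ rfl
  have hθ : ∀ u ≤ n, s₁.real 5 u = threshold n τ k u := fun u hu => by
    rw [h₁.1 u hu, hτ, threshold]
    congr 1
    funext i
    congr 1
    ring
  refine Runs.seq ((runs_sumProg (g := fun u => p u * y u) hR₁.size
    fun u s' hs' hc => ?_).mono le_rfl fun s₂ _ h₂ F₂ => ?_)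
  · simp only [RExp.eval, NExp.eval, hc]
    rw [(hR₁.of_frame hs' rfl).costs, hs'.real 3 rfl, F₁.real 3 rfl, hy]
  have hR₂ := hR₁.of_frame F₂ rfl
  have hx₂ : ∀ u : Fin n, s₂.real 2 u = x u := fun u => by
    rw [F₂.real 2 rfl, F₁.real 2 rfl, hx]
  have hy₂ : ∀ u : Fin n, s₂.real 3 u = y u := fun u => by
    rw [F₂.real 3 rfl, F₁.real 3 rfl, hy]
  have hpos₂ : s₂.pos = (k + 1) * (n + 1) * n := by
    rw [F₂.pos rfl, h₁.2]
    ring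
  have htest : Test.Holds s₂ (.realLe (cell 17) (.mul (cell 1) slackExp)) ↔
      ∑ u, p u * y u ≤ B * (1 + 1 / (n : ℝ) ^ 2) := by
    have := eval_slackExp hR₂.size
    simp only [RExp.eval, NExp.eval] at this
    simp only [Test.Holds, RExp.eval, NExp.eval, this, h₂, hR₂.budget]
  refine Runs.cond (fun hb => ?_) fun hb => ?_
  · rw [htest] at hb
    simp only [ascentStep, if_pos hb]
    refine Runs.seq ((runs_replaceProg hR₂ hx₂ hy₂ (t := threshold n τ k n) (k := k)
      (by rw [F₂.real 5 rfl, hθ n le_rfl])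
      (by rw [F₂.real 16 rfl, F₁.real 16 rfl, hk])).mono le_rfl fun s₃ _ h₃ F₃ => ?_)
    refine (runs_ascendProg (hR₂.of_frame F₃ rfl) (θ := fun u => threshold n τ k u) (y := y)
      (fun u => by rw [F₃.real 5 rfl, F₂.real 5 rfl, hθ u u.2.le])
      (fun u => by rw [F₃.real 3 rfl, hy₂])).mono le_rfl fun s₄ F₄ h₄ => ⟨?_, h₄, fun u => ?_⟩
    · rw [F₄.pos rfl, F₃.pos rfl, hpos₂]
    · rw [F₄.real 2 rfl, h₃]
  · rw [htest] at hb
    simp only [ascentStep, if_neg hb]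
    refine (runs_repairProg hR₂ hy₂ h₂).mono (by ring_nf; omega) fun s₃ F₃ h₃ =>
      ⟨?_, h₃, fun u => ?_⟩
    · rw [F₃.pos rfl, hpos₂]
    · rw [F₃.real 2 rfl, hx₂]

/-- `n⁸` iterations. -/
def mainLoop : Prog :=
  forReal 16 (.mul (.mul (.mul size size) (.mul size size))
    (.mul (.mul size size) (.mul size size))) iterationProg

theorem runs_mainLoop (h : Ready s ε p B M) (hpos : s.pos = 0)
    (hx : ∀ u : Fin n, s.real 2 u = 0) (hy : ∀ u : Fin n, s.real 3 u = 0) :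
    Runs f mainLoop s (n ^ 8 * (iterationTime n (chosenScheme ε p B).rounds + 2) + 2) fun s' =>
      ∀ u : Fin n, s'.real 2 u = (trajectory (chosenScheme ε p B) f p B M s.tape (n ^ 8)).2 u := by
  refine (Runs.forReal (fun k s' => s'.pos = k * (n + 1) * n ∧
    (∀ u : Fin n, s'.real 3 u = (trajectory (chosenScheme ε p B) f p B M s.tape k).1 u) ∧
    ∀ u : Fin n, s'.real 2 u = (trajectory (chosenScheme ε p B) f p B M s.tape k).2 u) (n ^ 8) rfl
    (fun s' hs' => ?_) (fun k s' v h => by simpa [State.writeReal] using h)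
    ⟨by simpa using hpos, hy, hx⟩
    fun k _ s' hs' hc hI => ?_).mono le_rfl fun s' _ h' => h'.2.2
  · simp only [RExp.eval, NExp.eval]
    rw [hs'.nat 0 rfl, h.size]
    push_cast
    ring
  · exact runs_iterationProg (h.of_frame hs' rfl) hs'.tape hI.1 hc hI.2.2 hI.2.1

end


/-! ### The program: initialisation -/

/-- Cell `11` receives the largest value of a singleton. -/
def scaleProg : Prog :=
  .seq (setCell 11 (num 0)) <| forElements <| .seq (setEntry 4 (num 1)) <|
    .seq (.query 4 24 (.lit 0)) <| .seq (setEntry 4 (num 0)) <|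
    .cond (.realLe (cell 11) (cell 24)) (setCell 11 (cell 24)) .skip

/-- Cell `13` receives `lowRounds ε n`. -/
def lowInitProg : Prog :=
  .seq (setCell 13 (num 0)) <| .seq (setCell 24 (.sub (num 1) (.div (num 1) size))) <|
    .loop (.realLe (.get 1 (.lit 1)) (cell 24)) <|
      .seq (setCell 24 (.mul (cell 24) (.sub (num 1) (.div (num 1) size))))
        (setCell 13 (.add (cell 13) (num 1)))

/-- Cell `12` receives `approxSqrt ε n`. -/
def highInitProg : Prog :=
  .seq (setCell 24 (num 0)) <| .seq
    (.loop (.neg (.realLe (.mul (.get 1 (.lit 1)) (.mul size size)) (.mul (cell 24) (cell 24))))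
      (setCell 24 (.add (cell 24) (num 1)))) <|
    .seq (setCell 12 (.div (cell 24) size)) (setCell 13 (.add (.mul size size) (.mul size size)))

/-- Compute the values on which `Ready` insists. -/
def initProg : Prog :=
  .seq (sumProg 10 (entry 0)) <| .seq (sumProg 18 (.mul (entry 0) (entry 0))) <|
    .seq scaleProg <| .cond lowTest lowInitProg highInitProg

/-- A bound for the running time of the algorithm in terms of the number of sample points. -/
def totalTime (n r : ℕ) : ℕ :=
  n * 3 + 3 + (n * 3 + 3 + (n * 8 + 3 + (r * 3 + n * 2 + 5))) +
    (n ^ 8 * (iterationTime n r + 2) + 2)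

section

variable {f : Finset (Fin n) → ℝ} {s : State} {ε B M : ℝ} {p : Fin n → ℝ}

theorem runs_scaleProg (h0 : s.nat 0 0 = n) (h4 : ∀ i, s.real 4 i = 0) (hM : ∀ u, f {u} ≤ M)
    (hM0 : 0 ≤ M) (hex : ∃ u, f {u} = M) :
    Runs f scaleProg s (n * 8 + 3) fun s' => s'.real 11 0 = M := by
  refine (Runs.seq (T := 1) (T' := n * (6 + 2) + 2) ((Runs.of_wp
    (Q := fun s' => s'.real 11 0 = 0) ?_).mono le_rfl fun s₁ _ h₁ F₁ => ?_)).mono (by omega)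
    fun _ _ h => h
  · simp [Prog.wp, RExp.eval, NExp.eval, State.writeReal]
  · refine (Runs.forNat (fun i s' => (s'.real 4 = fun _ => 0) ∧ s'.real 11 0 ≤ M ∧
      ∀ u : Fin n, u.val < i → f {u} ≤ s'.real 11 0) n rfl ?_ (fun _ _ _ h => h) ?_ ?_).mono le_rfl
      fun s' _ h => ?_
    · intro s' hs'
      simp only [NExp.eval]
      rw [hs'.nat 0 rfl, F₁.nat 0 rfl, h0]
    · exact ⟨by rw [F₁.real 4 rfl]; exact funext h4, by rw [h₁]; exact hM0,
        fun u hu => absurd hu (Nat.not_lt_zero _)⟩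
    · intro i hi s' hs' hc hI
      have hmark : ∀ z : State, z.real 4 = Function.update (fun _ => 0) i 1 →
          z.markedSet n 4 = {⟨i, hi⟩} := fun z hz => by
        ext v
        simp only [State.markedSet, Finset.mem_filter, Finset.mem_univ, true_and,
          Finset.mem_singleton, hz, Function.update_apply, Fin.ext_iff]
        by_cases hv : v.val = i <;> simp [hv]
      refine (Runs.of_wp ?_).mono (by simp [Prog.cost]) fun _ _ h => h
      simp only [Prog.wp, RExp.eval, NExp.eval, State.writeReal, Test.Holds, hc,
        Function.update_self, ne_eq, Nat.reduceEqDiff, not_false_eq_true, Function.update_of_ne,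
        hI.1, Nat.cast_one, Nat.cast_zero, Function.update_idem]
      rw [hmark _ (by simp)]
      have hor : ∀ u : Fin n, u.val < i + 1 → u = ⟨i, hi⟩ ∨ u.val < i := fun u hu => by
        by_cases hui : u.val = i
        · exact Or.inl (Fin.ext hui)
        · exact Or.inr (by omega)
      refine ⟨fun hle => ⟨by simp, by simpa using hM _, fun u hu => ?_⟩,
        fun hle => ⟨by simp, by simpa using hI.2.1, fun u hu => ?_⟩⟩
      · rcases hor u hu with rfl | hu
        · exact le_rfl
        · exact (hI.2.2 u hu).trans hle
      · rcases hor u hu with rfl | hu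
        · exact (not_le.1 hle).le
        · exact hI.2.2 u hu
    · obtain ⟨u, rfl⟩ := hex
      exact le_antisymm h.2.1 (h.2.2 u u.2)

theorem runs_lowInitProg (h0 : s.nat 0 0 = n) (hε : s.real 1 1 = ε) (hε₀ : 0 < ε) (hn : 2 ≤ n) :
    Runs f lowInitProg s (lowRounds ε n * 3 + 3) fun s' => s'.real 13 0 = lowRounds ε n := by
  refine (Runs.seq (T := 1) (T' := 1 + (lowRounds ε n * (2 + 1) + 1)) ((Runs.of_wp
    (Q := fun s' => s'.real 13 0 = 0) ?_).mono le_rfl fun s₁ _ h₁ F₁ => ?_)).mono (by omega)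
    fun _ _ h => h
  · simp [Prog.wp, RExp.eval, NExp.eval, State.writeReal]
  refine Runs.seq ((Runs.of_wp (Q := fun s' => s'.real 24 0 = 1 - 1 / (n : ℝ)) ?_).mono le_rfl
    fun s₂ _ h₂ F₂ => ?_)
  · simp only [Prog.wp, RExp.eval, NExp.eval, State.writeReal, Function.update_self]
    rw [F₁.nat 0 rfl, h0, Nat.cast_one]
  refine (Runs.loop (fun i s' => s'.real 24 0 = (1 - 1 / (n : ℝ)) ^ (i + 1) ∧ s'.real 13 0 = i)
    (lowRounds ε n) ⟨by rw [h₂, zero_add, pow_one], by rw [F₂.real 13 rfl, h₁, Nat.cast_zero]⟩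
    (fun i hi s' hs' hI => ⟨?_, Runs.of_wp (P := .seq _ _) ?_⟩) fun s' hs' hI => ?_).mono le_rfl
    fun s' _ h => h.2
  · simp only [Test.Holds, RExp.eval, NExp.eval, hI.1]
    rw [hs'.real 1 rfl, F₂.real 1 rfl, F₁.real 1 rfl, hε]
    exact le_of_lt_lowRounds hi
  · have hs0 : s'.nat 0 0 = n := by rw [hs'.nat 0 rfl, F₂.nat 0 rfl, F₁.nat 0 rfl, h0]
    simp [Prog.wp, RExp.eval, NExp.eval, State.writeReal, hs0, hI.1, hI.2, pow_succ]
  · simp only [Test.Holds, RExp.eval, NExp.eval, hI.1, not_le]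
    rw [hs'.real 1 rfl, F₂.real 1 rfl, F₁.real 1 rfl, hε]
    exact lowRounds_spec hε₀ hn

theorem runs_highInitProg (h0 : s.nat 0 0 = n) (hε : s.real 1 1 = ε) (hε₁ : ε ≤ 1) :
    Runs f highInitProg s (n * 2 + 4) fun s' =>
      s'.real 12 0 = approxSqrt ε n ∧ s'.real 13 0 = (n * n + n * n : ℕ) := by
  refine (Runs.seq (T := 1) (T' := (gridRoot ε n * (1 + 1) + 1) + 2) ((Runs.of_wp
    (Q := fun s' => s'.real 24 0 = 0) ?_).mono le_rfl fun s₁ _ h₁ F₁ => ?_)).mono ?_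
    fun _ _ h => h
  · simp [Prog.wp, RExp.eval, NExp.eval, State.writeReal]
  · refine Runs.seq ((Runs.loop (fun i s' => s'.real 24 0 = i) (gridRoot ε n)
      (by rw [h₁, Nat.cast_zero]) (fun i hi s' hs' hI => ⟨?_, Runs.of_wp ?_⟩)
      fun s' hs' hI => ?_).mono le_rfl fun s₂ _ h₂ F₂ => ?_)
    · simp only [Test.Holds, RExp.eval, NExp.eval, hI, not_le]
      rw [hs'.real 1 rfl, F₁.real 1 rfl, hε, hs'.nat 0 rfl, F₁.nat 0 rfl, h0]
      exact lt_of_lt_gridRoot hi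
    · simp [Prog.wp, RExp.eval, NExp.eval, State.writeReal, hI]
    · simp only [Test.Holds, RExp.eval, NExp.eval, hI, not_not]
      rw [hs'.real 1 rfl, F₁.real 1 rfl, hε, hs'.nat 0 rfl, F₁.nat 0 rfl, h0]
      exact (gridRoot_mem hε₁).1
    · refine Runs.of_wp (P := .seq _ _) ?_
      have hs0 : s₂.nat 0 0 = n := by rw [F₂.nat 0 rfl, F₁.nat 0 rfl, h0]
      simp [Prog.wp, RExp.eval, NExp.eval, State.writeReal, hs0, h₂, approxSqrt]
  · have := (gridRoot_mem (n := n) hε₁).2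
    omega

theorem runs_initProg (hn : 2 ≤ n) (hε₀ : 0 < ε) (hε₁ : ε ≤ 1) (h0 : s.nat 0 0 = n)
    (hp : ∀ u : Fin n, s.real 0 u = p u) (hB : s.real 1 0 = B) (hε : s.real 1 1 = ε)
    (h4 : ∀ i, s.real 4 i = 0) (hM : ∀ u, f {u} ≤ M) (hM0 : 0 ≤ M) (hex : ∃ u, f {u} = M) :
    Runs f initProg s (n * 3 + 3 + (n * 3 + 3 + (n * 8 + 3 +
      ((chosenScheme ε p B).rounds * 3 + n * 2 + 5)))) fun s' => Ready s' ε p B M := by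
  refine Runs.seq ((runs_sumProg (g := p) h0 fun u s' hs' hc => ?_).mono le_rfl
    fun s₁ _ h₁ F₁ => ?_)
  · simp only [RExp.eval, NExp.eval, hc]
    rw [hs'.real 0 rfl, hp]
  refine Runs.seq ((runs_sumProg (g := fun u => p u ^ 2) (by rw [F₁.nat 0 rfl, h0])
    fun u s' hs' hc => ?_).mono le_rfl fun s₂ _ h₂ F₂ => ?_)
  · simp only [RExp.eval, NExp.eval, hc]
    rw [hs'.real 0 rfl, F₁.real 0 rfl, hp, sq]
  refine Runs.seq ((runs_scaleProg (by rw [F₂.nat 0 rfl, F₁.nat 0 rfl, h0])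
    (fun i => by rw [F₂.real 4 rfl, F₁.real 4 rfl, h4]) hM hM0 hex).mono le_rfl
    fun s₃ _ h₃ F₃ => ?_)
  have hsize : s₃.nat 0 0 = n := by rw [F₃.nat 0 rfl, F₂.nat 0 rfl, F₁.nat 0 rfl, h0]
  have hcosts : ∀ u : Fin n, s₃.real 0 u = p u := fun u => by
    rw [F₃.real 0 rfl, F₂.real 0 rfl, F₁.real 0 rfl, hp]
  have h1 : s₃.real 1 = s.real 1 := by rw [F₃.real 1 rfl, F₂.real 1 rfl, F₁.real 1 rfl]
  have hsum : s₃.real 10 0 = ∑ u, p u := by rw [F₃.real 10 rfl, F₂.real 10 rfl, h₁]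
  have hsq : s₃.real 18 0 = ∑ u, p u ^ 2 := by rw [F₃.real 18 rfl, h₂]
  have htest : lowTest.Holds s₃ ↔ B + B ≤ ∑ u, p u := by
    simp only [Test.Holds, RExp.eval, NExp.eval, h1, hB, hsum]
  refine Runs.cond (T := (chosenScheme ε p B).rounds * 3 + n * 2 + 4) (fun hb => ?_) fun hb => ?_
  · rw [htest] at hb
    have e : (chosenScheme ε p B).rounds = lowRounds ε n := by
      rw [chosenScheme, if_pos hb]; rfl
    refine (runs_lowInitProg hsize (by rw [h1, hε]) hε₀ hn).mono (by rw [e]; omega)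
      fun s₄ F₄ h₄ => ?_
    exact ⟨by rw [F₄.nat 0 rfl, hsize], fun u => by rw [F₄.real 0 rfl, hcosts],
      by rw [F₄.real 1 rfl, h1, hB], by rw [F₄.real 10 rfl, hsum], by rw [F₄.real 11 rfl, h₃],
      fun h => absurd hb h, by rw [h₄, e], by rw [F₄.real 18 rfl, hsq]⟩
  · rw [htest] at hb
    have e : (chosenScheme ε p B).rounds = n * n + n * n := by
      rw [chosenScheme, if_neg hb]; rfl
    refine (runs_highInitProg hsize (by rw [h1, hε]) hε₁).mono (by omega) fun s₄ F₄ h₄ => ?_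
    exact ⟨by rw [F₄.nat 0 rfl, hsize], fun u => by rw [F₄.real 0 rfl, hcosts],
      by rw [F₄.real 1 rfl, h1, hB], by rw [F₄.real 10 rfl, hsum], by rw [F₄.real 11 rfl, h₃],
      fun _ => h₄.1, by rw [h₄.2, e], by rw [F₄.real 18 rfl, hsq]⟩

end

/-! ### The algorithm -/

/-- The whole algorithm: the initialisation and `n⁸` iterations. -/
def ascentProg : Prog := .seq initProg mainLoop

theorem rounds_le {ε : ℝ} (hε : 0 < ε) (hε₁ : ε ≤ 1) (hn : 2 ≤ n) (p : Fin n → ℝ) (B : ℝ) :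
    (chosenScheme ε p B).rounds ≤ ⌈-Real.log ε⌉₊ * n + (n * n + n * n) := by
  unfold chosenScheme
  split_ifs
  · refine le_trans (?_ : lowRounds ε n ≤ ⌈-Real.log ε⌉₊ * n) (Nat.le_add_right _ _)
    have h := (lowRounds_mul_le hε hε₁ hn).trans (Nat.le_ceil _)
    have hn' : (0 : ℝ) < n := by exact_mod_cast (by omega : 0 < n)
    rw [mul_one_div, div_le_iff₀ hn'] at h
    exact_mod_cast h
  · exact Nat.le_add_left _ _

/-- The running time is polynomial, and it exceeds the number of random bits. -/
theorem exists_polynomial_time (C : ℕ) : ∃ T : Polynomial ℕ, ∀ n : ℕ,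
    n ^ 8 * (n + 1) * n ≤ T.eval n ∧
    ∀ r ≤ C * n + (n * n + n * n), totalTime n r ≤ T.eval n := by
  let X : Polynomial ℕ := Polynomial.X
  let r : Polynomial ℕ := Polynomial.C C * X + (X * X + X * X)
  refine ⟨X * 3 + 3 + (X * 3 + 3 + (X * 8 + 3 + (r * 3 + X * 2 + 5))) +
    (X ^ 8 * ((X + 1) * (X * 4 + 5) + 2 + (X * 3 + 3 + ((X * (3 * r + 24) + 3) +
      (X * 3 + 2 + (r * (X * (6 * r + 27) + 2 + (X * 9 + 2) + 2) + 2) + (X * 8 + 2)) + 1)) + 2) +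
      2), fun n => ?_⟩
  have h : ∀ {m : ℕ}, totalTime n (C * n + (n * n + n * n)) = m → n ^ 8 * (n + 1) * n ≤ m ∧
      ∀ r ≤ C * n + (n * n + n * n), totalTime n r ≤ m := by
    rintro _ rfl
    refine ⟨?_, fun r hr => ?_⟩
    · generalize C * n + (n * n + n * n) = r
      have h1 : (n + 1) * n ≤ iterationTime n r + 2 := by
        have h2 : (n + 1) * n ≤ (n + 1) * (n * 4 + 5) := Nat.mul_le_mul_left _ (by omega)
        unfold iterationTime
        omega
      have h3 := Nat.mul_le_mul_left (n ^ 8) h1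
      rw [mul_assoc]
      unfold totalTime
      omega
    · unfold totalTime iterationTime
      gcongr
  apply h
  simp [totalTime, iterationTime, r, X]

end Bicriteria

theorem mainTheorem1 (ε : ℝ) (hε₀ : 0 < ε) (hε₁ : ε ≤ 1) :
    ∃ (P : Bicriteria.Prog) (T : Polynomial ℕ) (err : ℕ → ℝ),
      Filter.Tendsto err Filter.atTop (nhds 0) ∧
      ∀ (n : ℕ) (f : Finset (Fin n) → ℝ) (p : Fin n → ℝ) (B : ℝ),
        (∀ S, 0 ≤ f S) → Monotone f → Bicriteria.IsSubmodular f →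
        (∀ u, 0 ≤ p u) → (∀ u, p u ≤ B) →
        0 < Bicriteria.density p B → Bicriteria.density p B < 1 →
        ∃ x : (Fin (T.eval n) → Bool) → Fin n → ℝ,
          Bicriteria.OutputsWithin P f p B ε (T.eval n) x ∧
          (∀ ω, Bicriteria.IsFeasibleUpTo (Bicriteria.knapsackPolytope p B)
            (Bicriteria.rho (Bicriteria.density p B) ε) (x ω)) ∧
          ∀ O, Bicriteria.IsKnapsackOpt f p B O →
            (1 - ε - err n) * f O ≤
              Bicriteria.expect fun ω => Bicriteria.multilinearExt f (x ω) := by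
  open Bicriteria in
  obtain ⟨T, hT⟩ := exists_polynomial_time ⌈-Real.log ε⌉₊
  refine ⟨ascentProg, T, totalError ε, tendsto_totalError ε,
    fun n f p B h0 hmon hsub hp hpB hc hc1 => ?_⟩
  have hS : 0 < ∑ u, p u := by
    refine (Finset.sum_nonneg fun u _ => hp u).lt_of_ne fun h => ?_
    rw [density, ← h, div_zero] at hc
    exact lt_irrefl _ hc
  have hB : 0 < B := by
    rw [density, div_pos_iff_of_pos_right hS] at hc
    exact hc
  have hBS : B < ∑ u, p u := (div_lt_one hS).1 hc1
  -- A single element would be affordable, which contradicts a density below one.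
  have hn : 2 ≤ n := by
    by_contra hn
    obtain rfl | rfl : n = 0 ∨ n = 1 := by omega
    · simp at hS
    · rw [Fin.sum_univ_one] at hBS
      exact absurd hBS (hpB 0).not_gt
  have : Nonempty (Fin n) := ⟨⟨0, by omega⟩⟩
  obtain ⟨u₀, hu₀⟩ := Finite.exists_max fun u => f {u}
  have hr := rounds_le hε₀ hε₁ hn p B
  refine ⟨fun ω => (trajectory (chosenScheme ε p B) f p B (f {u₀}) (tapeOf ω) (n ^ 8)).2,
    fun ω => ?_, fun ω => ?_, fun O hO => ?_⟩
  · have hinit : Runs f initProg (initState p B ε ω) _ _ := runs_initProg (p := p) (B := B) hn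
      hε₀ hε₁ (by simp [initState]) (fun u => by simp [initState]) (by simp [initState])
      (by simp [initState]) (fun i => by simp [initState]) hu₀ (h0 _) ⟨u₀, rfl⟩
    have hrun : Runs f ascentProg (initState p B ε ω) (totalTime n (chosenScheme ε p B).rounds)
        fun s => ∀ u : Fin n, s.real 2 u =
          (trajectory (chosenScheme ε p B) f p B (f {u₀}) (tapeOf ω) (n ^ 8)).2 u := by
      refine Runs.seq (hinit.mono le_rfl fun s _ hs hF => ?_)
      have h := runs_mainLoop (f := f) hs (hF.pos rfl)
        (fun u => by rw [hF.real 2 rfl]; simp [initState])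
        fun u => by rw [hF.real 3 rfl]; simp [initState]
      rwa [hF.tape] at h
    obtain ⟨t, ht, s, hs, hx⟩ := hrun
    exact ⟨t, ht.trans ((hT n).2 _ hr), s, hs, funext hx⟩
  · rcases trajectory_snd (σ := chosenScheme ε p B) (f := f) (p := p) (B := B) (M := f {u₀})
      (tapeOf ω) (n ^ 8) with h | ⟨y, hy, hpy, h⟩
    · have hρ := one_sub_le_rho hc hc1.le hε₀
      simp only [h]
      refine isFeasibleUpTo_of_le hB.le hε₀.le hρ (fun _ => ⟨le_rfl, by linarith⟩) ?_
      simpa using mul_nonneg (by linarith : 0 ≤ rho (density p B) ε) hB.le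
    · simp only [h]
      exact chosenScheme_feasible hε₀ hε₁ hn hp hB hBS hy hpy
  · exact le_expect_chosenScheme hε₀ hε₁ hn hmon hsub h0 hu₀ (h0 _) hp hpB hB hO.1
      (hO.2 _ (by simpa using hpB u₀)) (hT n).1
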